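/- **Notation.** For a real kernel $K$ and complex functions $\varphi,\psi$ on an interval $I=[a_1,a_2]$ let $\mathbb K_I f(x)=\int_I K(x,y)f(y)\,dy$. With $(\mathbb I-\mathbb K_I)^{-1}=\sum_{n\ge 0}\mathbb K_I^n$, and for $j,k\in\{1,2\}$, put $$q_j=(\mathbb I-\mathbb K_I)^{-1}\varphi(a_j),\quad p_j=(\mathbb I-\mathbb K_I)^{-1}\psi(a_j),\quad R_{jk}=\big((\mathbb I-\mathbb K_I)^{-1}K(\cdot,a_k)\big)(a_j),$$ $$u=\int_I\varphi\,(\mathbb I-\mathbb K_I)^{-1}\varphi,\quad w=\int_I\psi\,(\mathbb I-\mathbb K_I)^{-1}\psi,\quad v=\int_I\psi\,(\mathbb I-\mathbb K_I)^{-1}\varphi,$$ $$\tilde J=\det(\mathbb I-\mathbb K_I)=\exp\Big(-\sum_{n\ge1}\tfrac1n\operatorname{tr}\mathbb K_I^n\Big),$$ all regarded as functions of $(a_1,a_2)$ with $a_1<0<a_2$. For a kernel $K$ let $\tilde K(x,y)=K(x,y)-K(x,0)K(0,0)^{-1}K(0,y)$. *CUE quantities* ($N\ge 1$): formed with $\tilde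 K$ for $K(x,y)=\frac1{2\pi}\frac{\sin(N(x-y)/2)}{\sin((x-y)/2)}$ and $$\tilde\varphi_N(x)=\tfrac{e^{ix/2}}{\sqrt{2\pi}}\Big(e^{iNx/2}-\rho_N(x)\Big),\quad \tilde\psi_N(x)=\tfrac{e^{ix/2}}{\sqrt{2\pi}}\Big(e^{-iNx/2}-\rho_N(x)\Big),\quad \rho_N(x)=\frac{e^{iNx/2}-e^{-iNx/2}}{N(e^{ix}-1)}$$ (removable singularities are filled in by continuity). $\tilde J$ is then the Jánossy density $\tilde J_1(0;[a_1,a_2])$. *Unfolded CUE quantities*: $q_j,p_j,\tilde J$ evaluated at $(\frac2Na_1,\frac2Na_2)$; $Nu,Nw,Nv$ evaluated there (the redefinition $u\mapsto u/N$, etc.); and $\frac2NR_{jk}$ evaluated there. *Sine-kernel quantities*: formed with $\tilde K$ for $K(x,y)=\frac{\sin(x-y)}{\pi(x-y)}$, $\varphi(x)=\frac1{\sqrt{2\pi}}\big(e^{ix}-\frac{\sin x}{x}\big)$, $\psi(x)=\frac1{\sqrt{2\pi}}\big(e^{-ix}-\frac{\sin x}{x}\big)$, with $u,w,v$ multiplied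 by $2$. **Statement.** (0) *CUE system.* Let $N\ge1$, $a_1<0<a_2$, $a_2-a_1<2\pi$. On continuous functions on $I$ the Neumann series converges pointwise to the inverse of $\mathbb I-\tilde{\mathbb K}_I$, the series defining $\log\tilde J$ converges absolutely, and the CUE quantities $q_j,p_j,u,w,v,\tilde J$ are differentiable in $(a_1,a_2)$ and satisfy, for $\{j,k\}=\{1,2\}$, $$i(1-e^{ia_j})\partial_{a_j}q_j=-\Big\{\tfrac{N+1}2(1-e^{ia_j})+v-\tfrac1N\Big\}q_j+(N+1)\big(u-\tfrac1N\big)p_j-(-1)^ki(1-e^{ia_k})R_{jk}q_k,$$ $$i(1-e^{ia_j})\partial_{a_j}p_j=\Big\{\tfrac{N-1}2(1-e^{ia_j})+v-\tfrac1N\Big\}p_j+(N-1)\big(w-\tfrac1N\big)q_j-(-1)^ki(1-e^{ia_k})R_{jk}p_k,$$ $$\partial_{a_k}q_j=(-1)^kR_{jk}q_k,\quad \partial_{a_k}p_j=(-1)^kR_{jk}p_k,$$ $$\partial_{a_j}u=(-1)^jq_j^2,\quad \partial_{a_j}w=(-1)^jp_j^2,\quad \partial_{a_j}v=(-1)^jq_jp_j,\quad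 \partial_{a_j}\log\tilde J=-(-1)^jR_{jj},$$ $$R_{jk}=\frac{q_jp_k-p_jq_k}{e^{ia_j}-e^{ia_k}},\qquad R_{jj}=-ie^{-ia_j}\big(p_j\partial_{a_j}q_j-q_j\partial_{a_j}p_j\big).$$ For $I=[-t,t]$, $0<t<\pi$, with $q(t)=q_2$, $p(t)=p_2$ and $'=d/dt$: $q_2=\overline{q_1}$, $p_2=\overline{p_1}$, $u,w,v$ are real, and $$i(1-e^{it})q'=-\Big\{\tfrac{N+1}2(1-e^{it})+v-\tfrac1N\Big\}q+(N+1)\big(u-\tfrac1N\big)p+\tan\tfrac t2\,(q\bar p-p\bar q)\bar q,$$ $$i(1-e^{it})p'=\Big\{\tfrac{N-1}2(1-e^{it})+v-\tfrac1N\Big\}p+(N-1)\big(w-\tfrac1N\big)q+\tan\tfrac t2\,(q\bar p-p\bar q)\bar p,$$ $$u'=q^2+\bar q^2,\quad w'=p^2+\bar p^2,\quad v'=qp+\bar q\bar p,$$ $$(\log\tilde J)'=ie^{-it}(pq'-qp')-ie^{it}(\bar p\bar q'-\bar q\bar p')+\cot t\,(q\bar p-p\bar q)^2.$$ (1) *Large-$N$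 limit.* As $N\to\infty$, $\frac2N\tilde K(\frac2Nx,\frac2Ny)$, $\tilde\varphi_N(\frac2Nx)$ and $\tilde\psi_N(\frac2Nx)$ (CUE) converge locally uniformly to the sine-kernel $\tilde K(x,y)$, $\varphi(x)$ and $\psi(x)=\overline{\varphi(x)}$. On $\{a_1<0<a_2\}$ the sine-kernel quantities are well defined in the sense of (0), and the unfolded CUE quantities converge to them locally uniformly, those other than $R_{jk}$ together with their first partial derivatives. (2) *Sine-kernel system.* For all $a_1<0<a_2$ the sine-kernel quantities (those other than $R_{jk}$) are differentiable and satisfy $p_j=\overline{q_j}$, $w=\overline u$ and, for $\{j,k\}=\{1,2\}$, $$a_j\partial_{a_j}q_j=ia_jq_j+(u-1)\overline{q_j}-(-1)^ka_kR_{jk}q_k,\qquad R_{jk}=\frac{q_j\overline{q_k}-\overline{q_j}q_k}{i(a_j-a_k)},$$ the complex conjugate equation for $p_j$, and $\partial_{a_k}q_j=(-1)^kR_{jk}q_k$, $\partial_{a_j}u=2(-1)^jq_j^2$, $\partial_{a_j}\log\tilde J=-(-1)^jR_{jj}$, $R_{jj}=-i(\overline{q_j}\,\partial_{a_j}q_j-q_j\,\overline{\partial_{a_j}q_j})$.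 (3) *Symmetric intervals.* For $I=[-t,t]$, $t>0$, the sine-kernel quantities $q(t)=q_2=\overline{q_1}$, $p(t)=p_2$, $u(t)$, $w(t)$ satisfy $p=\bar q$, $u=w\in\mathbb R$ and $$q'=iq+\frac{u-1}t\bar q,\quad u'=2(q^2+\bar q^2),\quad (\log\tilde J)'=2i(\bar qq'-q\bar q')+\frac{(q^2-\bar q^2)^2}t .$$ Moreover $q$ satisfies the autonomous equation $$q'=iq+\frac{2\,\mathrm{Im}(q^2)-1}{t}\,\bar q,\qquad q(t)=\frac{it}{\sqrt{2\pi}}-\frac{t^2}{3\sqrt{2\pi}}-\frac{it^3}{6\sqrt{2\pi}}+O(t^4)\quad(t\downarrow0).$$ -/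

import Mathlib

open Set Filter Topology ComplexConjugate

noncomputable section

namespace CUEJanossy

/-! Endpoints `(a₁, a₂)` of the interval `I = [a₁, a₂]` are vectors `a : Fin 2 → ℝ`,
so `a 0 = a₁` and `a 1 = a₂`. -/

/-- `(-1)^j` for `j = 1, 2`, where the indices `1, 2` are `0, 1 : Fin 2`. -/
def sgn (j : Fin 2) : ℝ := if j = 0 then -1 else 1

/-- The partial derivative `∂F/∂a_k` at the point `a`. -/
def pd {E : Type*} [NormedAddCommGroup E] [NormedSpace ℝ E]
    (F : (Fin 2 → ℝ) → E) (k : Fin 2) (a : Fin 2 → ℝ) : E :=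
  deriv (fun s : ℝ => F (Function.update a k s)) (a k)

/-! ### Integral operators on an interval -/

/-- `(𝕂_I ^ n f)(x)`, with `(𝕂_I f)(x) = ∫_I K(x,z) f(z) dz`. -/
def kernelIter {E : Type*} [NormedAddCommGroup E] [NormedSpace ℝ E]
    (K : ℝ → ℝ → ℝ) (a : Fin 2 → ℝ) (f : ℝ → E) : ℕ → ℝ → E
  | 0, x => f x
  | n + 1, x => ∫ z in (a 0)..(a 1), K x z • kernelIter K a f n z

/-- `((𝕀 - 𝕂_I)⁻¹ f)(x)`, given by its Neumann expansion. -/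
def resolvent {E : Type*} [NormedAddCommGroup E] [NormedSpace ℝ E]
    (K : ℝ → ℝ → ℝ) (a : Fin 2 → ℝ) (f : ℝ → E) (x : ℝ) : E :=
  ∑' n : ℕ, kernelIter K a f n x

/-- On the continuous `E`-valued functions on `I` the Neumann expansion converges pointwise,
and it is the two-sided inverse of `𝕀 - 𝕂_I`. -/
def NeumannInverts (E : Type*) [NormedAddCommGroup E] [NormedSpace ℝ E]
    (K : ℝ → ℝ → ℝ) (a : Fin 2 → ℝ) : Prop :=
  ∀ f : ℝ → E, ContinuousOn f (Icc (a 0) (a 1)) →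
    (∀ x ∈ Icc (a 0) (a 1), Summable fun n : ℕ => kernelIter K a f n x) ∧
    ContinuousOn (resolvent K a f) (Icc (a 0) (a 1)) ∧
    ∀ g : ℝ → E, ContinuousOn g (Icc (a 0) (a 1)) →
      ((∀ x ∈ Icc (a 0) (a 1), g x - (∫ z in (a 0)..(a 1), K x z • g z) = f x) ↔
        ∀ x ∈ Icc (a 0) (a 1), g x = resolvent K a f x)

/-- `tr 𝕂_I ^ (n+1)`, the `(n+1)`-fold integral of
`K(x₀,x₁) K(x₁,x₂) ⋯ K(xₙ,x₀)` over `I`. -/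
def traceSucc (K : ℝ → ℝ → ℝ) (a : Fin 2 → ℝ) (n : ℕ) : ℝ :=
  ∫ x in (a 0)..(a 1), kernelIter K a (fun z => K z x) n x

/-- The Fredholm determinant `det(𝕀 - 𝕂_I) = exp(- ∑_{n ≥ 1} tr(𝕂_I ^ n) / n)`. -/
def fredholmDet (K : ℝ → ℝ → ℝ) (a : Fin 2 → ℝ) : ℝ :=
  Real.exp (-∑' n : ℕ, traceSucc K a n / ((n : ℝ) + 1))

/-- The modified kernel, with one particle fixed at the origin:
`K̃(x,y) = K(x,y) - K(x,0) K(0,0)⁻¹ K(0,y)`. -/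
def conditioned (K : ℝ → ℝ → ℝ) (x y : ℝ) : ℝ :=
  K x y - K x 0 * (K 0 0)⁻¹ * K 0 y

/-! ### The Tracy-Widom quantities -/

/-- The quantities `q_j, p_j, u, w, v, R_jk` and the Fredholm determinant `J`,
as functions of the endpoints. -/
structure Quantities where
  q : Fin 2 → (Fin 2 → ℝ) → ℂ
  p : Fin 2 → (Fin 2 → ℝ) → ℂ
  u : (Fin 2 → ℝ) → ℂ
  w : (Fin 2 → ℝ) → ℂ
  v : (Fin 2 → ℝ) → ℂ
  R : Fin 2 → Fin 2 → (Fin 2 → ℝ) → ℝ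
  J : (Fin 2 → ℝ) → ℝ

/-- The quantities belonging to a kernel `K` and a pair of functions `φ, ψ`. -/
def quantitiesOf (K : ℝ → ℝ → ℝ) (φ ψ : ℝ → ℂ) : Quantities where
  q j a := resolvent K a φ (a j)
  p j a := resolvent K a ψ (a j)
  u a := ∫ x in (a 0)..(a 1), φ x * resolvent K a φ x
  w a := ∫ x in (a 0)..(a 1), ψ x * resolvent K a ψ x
  v a := ∫ x in (a 0)..(a 1), ψ x * resolvent K a φ x
  R j k a := resolvent K a (fun z => K z (a k)) (a j)
  J a := fredholmDet K a

/-! ### The circular unitary ensemble -/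

/-- The kernel of the eigenphases of Haar-distributed `U(N)` matrices, with its value by
continuity on the diagonal. -/
def cueKernel (N : ℕ) (x y : ℝ) : ℝ :=
  if x = y then N / (2 * Real.pi)
  else 1 / (2 * Real.pi) * (Real.sin (N * (x - y) / 2) / Real.sin ((x - y) / 2))

/-- `(e^{iNx/2} - e^{-iNx/2}) / (N (e^{ix} - 1))`, with its value by continuity at `0`. -/
def cueRatio (N : ℕ) (x : ℝ) : ℂ :=
  if x = 0 then 1
  else (Complex.exp (Complex.I * N * x / 2) - Complex.exp (-(Complex.I * N * x / 2))) /
    (N * (Complex.exp (Complex.I * x) - 1))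

/-- The function `φ̃` of the conditioned ensemble. -/
def cuePhi (N : ℕ) (x : ℝ) : ℂ :=
  Complex.exp (Complex.I * x / 2) / Real.sqrt (2 * Real.pi) *
    (Complex.exp (Complex.I * N * x / 2) - cueRatio N x)

/-- The function `ψ̃` of the conditioned ensemble. -/
def cuePsi (N : ℕ) (x : ℝ) : ℂ :=
  Complex.exp (Complex.I * x / 2) / Real.sqrt (2 * Real.pi) *
    (Complex.exp (-(Complex.I * N * x / 2)) - cueRatio N x)

/-- The quantities of the conditioned CUE; `J` is the Jánossy density `J̃₁(0;[a₁,a₂])`. -/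
def cue (N : ℕ) : Quantities :=
  quantitiesOf (conditioned (cueKernel N)) (cuePhi N) (cuePsi N)

/-- The CUE quantities as functions of the unfolded endpoints `a_j ↦ (2/N) a_j`, after the
redefinition `u ↦ u/N`, `w ↦ w/N`, `v ↦ v/N`; the resolvent kernel `R_jk`, a density,
is multiplied by the Jacobian `2/N`. -/
def unfoldedCue (N : ℕ) : Quantities where
  q j a := (cue N).q j ((2 / N : ℝ) • a)
  p j a := (cue N).p j ((2 / N : ℝ) • a)
  u a := N * (cue N).u ((2 / N : ℝ) • a)
  w a := N * (cue N).w ((2 / N : ℝ) • a)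
  v a := N * (cue N).v ((2 / N : ℝ) • a)
  R j k a := 2 / N * (cue N).R j k ((2 / N : ℝ) • a)
  J a := (cue N).J ((2 / N : ℝ) • a)

/-! ### The sine kernel -/

/-- `sin(x-y) / (π (x-y))`. -/
def sineKernel (x y : ℝ) : ℝ := Real.sinc (x - y) / Real.pi

/-- `(e^{ix} - sin(x)/x) / √(2π)`. -/
def sinePhi (x : ℝ) : ℂ :=
  (Complex.exp (Complex.I * x) - Real.sinc x) / Real.sqrt (2 * Real.pi)

/-- `(e^{-ix} - sin(x)/x) / √(2π)`. -/
def sinePsi (x : ℝ) : ℂ :=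
  (Complex.exp (-(Complex.I * x)) - Real.sinc x) / Real.sqrt (2 * Real.pi)

/-- The quantities of the conditioned sine kernel. The factor `2` is the Jacobian `2/N` of
the unfolding times the factor `N` from `u ↦ u/N`. -/
def sine : Quantities where
  q := (quantitiesOf (conditioned sineKernel) sinePhi sinePsi).q
  p := (quantitiesOf (conditioned sineKernel) sinePhi sinePsi).p
  u a := 2 * (quantitiesOf (conditioned sineKernel) sinePhi sinePsi).u a
  w a := 2 * (quantitiesOf (conditioned sineKernel) sinePhi sinePsi).w a
  v a := 2 * (quantitiesOf (conditioned sineKernel) sinePhi sinePsi).v a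
  R := (quantitiesOf (conditioned sineKernel) sinePhi sinePsi).R
  J := (quantitiesOf (conditioned sineKernel) sinePhi sinePsi).J

/-! ### The systems of differential equations -/

/-- All quantities are differentiable in the endpoints, and `J > 0`. -/
structure Regular (D : Quantities) (a : Fin 2 → ℝ) : Prop where
  q (j : Fin 2) : DifferentiableAt ℝ (D.q j) a
  p (j : Fin 2) : DifferentiableAt ℝ (D.p j) a
  u : DifferentiableAt ℝ D.u a
  w : DifferentiableAt ℝ D.w a
  v : DifferentiableAt ℝ D.v a
  J : DifferentiableAt ℝ D.J a
  J_pos : 0 < D.J a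

/-- The CUE system of partial differential equations at the point `a`. -/
structure CUESystem (N : ℕ) (D : Quantities) (a : Fin 2 → ℝ) : Prop where
  regular : Regular D a
  dq (j k : Fin 2) : j ≠ k →
    Complex.I * (1 - Complex.exp (Complex.I * a j)) * pd (D.q j) j a =
      -(((N : ℂ) + 1) / 2 * (1 - Complex.exp (Complex.I * a j)) + D.v a - 1 / N) * D.q j a
      + ((N : ℂ) + 1) * (D.u a - 1 / N) * D.p j a
      - sgn k * (Complex.I * (1 - Complex.exp (Complex.I * a k))) * D.R j k a * D.q k a
  dp (j k : Fin 2) : j ≠ k →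
    Complex.I * (1 - Complex.exp (Complex.I * a j)) * pd (D.p j) j a =
      (((N : ℂ) - 1) / 2 * (1 - Complex.exp (Complex.I * a j)) + D.v a - 1 / N) * D.p j a
      + ((N : ℂ) - 1) * (D.w a - 1 / N) * D.q j a
      - sgn k * (Complex.I * (1 - Complex.exp (Complex.I * a k))) * D.R j k a * D.p k a
  dq_off (j k : Fin 2) : j ≠ k → pd (D.q j) k a = sgn k * D.R j k a * D.q k a
  dp_off (j k : Fin 2) : j ≠ k → pd (D.p j) k a = sgn k * D.R j k a * D.p k a
  du (j : Fin 2) : pd D.u j a = sgn j * D.q j a ^ 2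
  dw (j : Fin 2) : pd D.w j a = sgn j * D.p j a ^ 2
  dv (j : Fin 2) : pd D.v j a = sgn j * (D.q j a * D.p j a)
  dlogJ (j : Fin 2) : pd (fun b => Real.log (D.J b)) j a = -sgn j * D.R j j a
  R_off (j k : Fin 2) : j ≠ k →
    (D.R j k a : ℂ) = (D.q j a * D.p k a - D.p j a * D.q k a) /
      (Complex.exp (Complex.I * a j) - Complex.exp (Complex.I * a k))
  R_diag (j : Fin 2) :
    (D.R j j a : ℂ) = -Complex.I * Complex.exp (-(Complex.I * a j)) *
      (D.p j a * pd (D.q j) j a - D.q j a * pd (D.p j) j a)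

/-- The sine-kernel Jánossy system of partial differential equations at the point `a`,
together with the relations `p_j = conj q_j`, `w = conj u`. -/
structure SineSystem (D : Quantities) (a : Fin 2 → ℝ) : Prop where
  regular : Regular D a
  p_eq (j : Fin 2) : D.p j a = conj (D.q j a)
  w_eq : D.w a = conj (D.u a)
  dq (j k : Fin 2) : j ≠ k →
    a j * pd (D.q j) j a =
      Complex.I * a j * D.q j a + (D.u a - 1) * conj (D.q j a)
      - sgn k * a k * D.R j k a * D.q k a
  dp (j k : Fin 2) : j ≠ k →
    a j * pd (D.p j) j a =
      -(Complex.I * a j * D.p j a) + (D.w a - 1) * conj (D.p j a)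
      - sgn k * a k * D.R j k a * D.p k a
  dq_off (j k : Fin 2) : j ≠ k → pd (D.q j) k a = sgn k * D.R j k a * D.q k a
  du (j : Fin 2) : pd D.u j a = 2 * sgn j * D.q j a ^ 2
  dlogJ (j : Fin 2) : pd (fun b => Real.log (D.J b)) j a = -sgn j * D.R j j a
  R_off (j k : Fin 2) : j ≠ k →
    (D.R j k a : ℂ) = (D.q j a * conj (D.q k a) - conj (D.q j a) * D.q k a) /
      (Complex.I * (a j - a k))
  R_diag (j : Fin 2) :
    (D.R j j a : ℂ) = -Complex.I *
      (conj (D.q j a) * pd (D.q j) j a - D.q j a * conj (pd (D.q j) j a))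

/-- The endpoints of the symmetric interval `[-t, t]`. -/
def sym (t : ℝ) : Fin 2 → ℝ := ![-t, t]

/-- All quantities are differentiable along the symmetric intervals, and `J > 0`. -/
structure SymRegular (D : Quantities) (t : ℝ) : Prop where
  q (j : Fin 2) : DifferentiableAt ℝ (fun s => D.q j (sym s)) t
  p (j : Fin 2) : DifferentiableAt ℝ (fun s => D.p j (sym s)) t
  u : DifferentiableAt ℝ (fun s => D.u (sym s)) t
  w : DifferentiableAt ℝ (fun s => D.w (sym s)) t
  v : DifferentiableAt ℝ (fun s => D.v (sym s)) t
  J : DifferentiableAt ℝ (fun s => D.J (sym s)) t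
  J_pos : 0 < D.J (sym t)

/-- The CUE system of ordinary differential equations for symmetric intervals, for
`q(t) = q₂`, `p(t) = p₂`, `u(t)`, `w(t)`, `v(t)` at `a = (-t, t)`. -/
structure CUESymSystem (N : ℕ) (D : Quantities) (t : ℝ) : Prop where
  regular : SymRegular D t
  q_sym : D.q 1 (sym t) = conj (D.q 0 (sym t))
  p_sym : D.p 1 (sym t) = conj (D.p 0 (sym t))
  u_real : (D.u (sym t)).im = 0
  w_real : (D.w (sym t)).im = 0
  v_real : (D.v (sym t)).im = 0
  dq : Complex.I * (1 - Complex.exp (Complex.I * t)) * deriv (fun s => D.q 1 (sym s)) t =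
      -(((N : ℂ) + 1) / 2 * (1 - Complex.exp (Complex.I * t)) + D.v (sym t) - 1 / N)
          * D.q 1 (sym t)
      + ((N : ℂ) + 1) * (D.u (sym t) - 1 / N) * D.p 1 (sym t)
      + Real.tan (t / 2) * (D.q 1 (sym t) * conj (D.p 1 (sym t))
          - D.p 1 (sym t) * conj (D.q 1 (sym t))) * conj (D.q 1 (sym t))
  dp : Complex.I * (1 - Complex.exp (Complex.I * t)) * deriv (fun s => D.p 1 (sym s)) t =
      (((N : ℂ) - 1) / 2 * (1 - Complex.exp (Complex.I * t)) + D.v (sym t) - 1 / N)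
          * D.p 1 (sym t)
      + ((N : ℂ) - 1) * (D.w (sym t) - 1 / N) * D.q 1 (sym t)
      + Real.tan (t / 2) * (D.q 1 (sym t) * conj (D.p 1 (sym t))
          - D.p 1 (sym t) * conj (D.q 1 (sym t))) * conj (D.p 1 (sym t))
  du : deriv (fun s => D.u (sym s)) t = D.q 1 (sym t) ^ 2 + conj (D.q 1 (sym t)) ^ 2
  dw : deriv (fun s => D.w (sym s)) t = D.p 1 (sym t) ^ 2 + conj (D.p 1 (sym t)) ^ 2
  dv : deriv (fun s => D.v (sym s)) t =
      D.q 1 (sym t) * D.p 1 (sym t) + conj (D.q 1 (sym t)) * conj (D.p 1 (sym t))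
  dlogJ : ((deriv (fun s => Real.log (D.J (sym s))) t : ℝ) : ℂ) =
      Complex.I * Complex.exp (-(Complex.I * t)) *
        (D.p 1 (sym t) * deriv (fun s => D.q 1 (sym s)) t
          - D.q 1 (sym t) * deriv (fun s => D.p 1 (sym s)) t)
      - Complex.I * Complex.exp (Complex.I * t) *
        (conj (D.p 1 (sym t)) * conj (deriv (fun s => D.q 1 (sym s)) t)
          - conj (D.q 1 (sym t)) * conj (deriv (fun s => D.p 1 (sym s)) t))
      + Real.cot t * (D.q 1 (sym t) * conj (D.p 1 (sym t))
          - D.p 1 (sym t) * conj (D.q 1 (sym t))) ^ 2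

/-- The Forrester-Odlyzko system of ordinary differential equations for symmetric intervals,
with the relations `p = conj q`, `u = w ∈ ℝ`, and the equation that results for `q` alone
when `u` is eliminated. -/
structure FOSystem (D : Quantities) (t : ℝ) : Prop where
  regular : SymRegular D t
  q_sym : D.q 1 (sym t) = conj (D.q 0 (sym t))
  p_eq : D.p 1 (sym t) = conj (D.q 1 (sym t))
  u_real : (D.u (sym t)).im = 0
  w_eq : D.w (sym t) = D.u (sym t)
  dq : deriv (fun s => D.q 1 (sym s)) t =
      Complex.I * D.q 1 (sym t) + (D.u (sym t) - 1) / t * conj (D.q 1 (sym t))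
  du : deriv (fun s => D.u (sym s)) t =
      2 * (D.q 1 (sym t) ^ 2 + conj (D.q 1 (sym t)) ^ 2)
  dlogJ : ((deriv (fun s => Real.log (D.J (sym s))) t : ℝ) : ℂ) =
      2 * Complex.I * (conj (D.q 1 (sym t)) * deriv (fun s => D.q 1 (sym s)) t
        - D.q 1 (sym t) * conj (deriv (fun s => D.q 1 (sym s)) t))
      + (D.q 1 (sym t) ^ 2 - conj (D.q 1 (sym t)) ^ 2) ^ 2 / t
  dq_autonomous : deriv (fun s => D.q 1 (sym s)) t =
      Complex.I * D.q 1 (sym t)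
      + (2 * ((D.q 1 (sym t) ^ 2).im : ℂ) - 1) / t * conj (D.q 1 (sym t))

/-! ### Convergence -/

/-- The open set of endpoints with `a₁ < 0 < a₂`. -/
def domain : Set (Fin 2 → ℝ) := {a | a 0 < 0 ∧ 0 < a 1}

/-- `F N → G` as `N → ∞`, together with the first partial derivatives, locally uniformly for
`a₁ < 0 < a₂`. -/
def TendstoC1 {E : Type*} [NormedAddCommGroup E] [NormedSpace ℝ E]
    (F : ℕ → (Fin 2 → ℝ) → E) (G : (Fin 2 → ℝ) → E) : Prop :=
  TendstoLocallyUniformlyOn F G atTop domain ∧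
  ∀ k : Fin 2, TendstoLocallyUniformlyOn (fun N => pd (F N) k) (pd G k) atTop domain

/-- Convergence as `N → ∞` of all the quantities `D N` to `D'`. -/
structure QuantitiesTendsto (D : ℕ → Quantities) (D' : Quantities) : Prop where
  q (j : Fin 2) : TendstoC1 (fun N => (D N).q j) (D'.q j)
  p (j : Fin 2) : TendstoC1 (fun N => (D N).p j) (D'.p j)
  u : TendstoC1 (fun N => (D N).u) D'.u
  w : TendstoC1 (fun N => (D N).w) D'.w
  v : TendstoC1 (fun N => (D N).v) D'.v
  R (j k : Fin 2) : TendstoLocallyUniformlyOn (fun N => (D N).R j k) (D'.R j k) atTop domain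
  J : TendstoC1 (fun N => (D N).J) D'.J

/-- `𝕀 - 𝕂_I` is inverted by its Neumann expansion, and the series that defines
`log det(𝕀 - 𝕂_I)` converges absolutely. -/
def WellDefined (K : ℝ → ℝ → ℝ) (a : Fin 2 → ℝ) : Prop :=
  NeumannInverts ℝ K a ∧ NeumannInverts ℂ K a ∧
    Summable fun n : ℕ => traceSucc K a n / ((n : ℝ) + 1)

end CUEJanossy

end

open CUEJanossy

/-! The algebra comes from the integrable form of the kernels. For the CUE and for the sine kernel,
K(x,y) = k(x-y), and 2π(e(x)-e(y))k(x-y) is an antisymmetrised product of two plane waves, with e(x)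
= e^{ix}-1 and e(x) = ix respectively. Since e(0) = 0, conditioning on a particle at the origin
preserves this form and turns the waves into φ and ψ (`Profile.toIntegrableKernel`). Hence the
commutator of 𝕂 with multiplication by e has rank two, and its commutator with the derivation m
d/dx, m = -ie, has finite rank once the boundary terms at the endpoints are included.

These relations pass to (𝕀-𝕂)⁻¹ by uniqueness: the difference of the two sides is fixed by 𝕂, hence
zero (`eq_zero_of_fixed`). This gives the quotient formula for R (`commutator_resolvent`) and a
formula for m times the spatial derivative of (𝕀-𝕂)⁻¹φ (`derivation_resolvent`). Moving an endpoint
changes (𝕀-𝕂)⁻¹f by ±R(·,a_k) times the value of (𝕀-𝕂)⁻¹f at a_k (`hasFDerivAt_res`). Together they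
yield one abstract system, `IntegrableKernel.system`, of which the CUE and sine systems are
specialisations.

For the analysis, kernels are clamped to bounded continuous ones, so that 𝕂 acts on a Banach space
of bounded continuous functions. It suffices that some power of 𝕂 has norm below one (`Good`). This
condition is open and gives locally uniform geometric bounds, hence Neumann series,
differentiability in the endpoints, and joint continuity in kernel and endpoints. It follows from
strict contraction on L²(I) (`good_of_contractive`). The conditioned CUE kernel is a projection on a
full period, so ∫(𝕂f)² over the period equals ⟨f,𝕂f⟩ over I. If the norm on L²(I) were one,
compactness would give a nonzero h = 𝕂h on I whose extension 𝕂h vanishes just outside I; but 𝕂h is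
the restriction of an entire function (`contractive_of_unique_continuation`). The sine kernel has no
finite period; it inherits the inequality as a limit of rescaled CUE kernels (`contractive_sine`).

On the scale c = 2/N the CUE profile tends to the sine profile, so the quantities converge by joint
continuity. Their derivatives converge because the systems express them algebraically through the
quantities, with division by m(a_j), which is nonzero in the limit since a_j ≠ 0
(`IKTendsto.quant`).

On [-t,t], reflection acts as complex conjugation and the partial systems collapse to ordinary ones.
For the sine kernel, u - 2 Im(q²) is a first integral with value 0 at t = 0, which eliminates u. The
expansion at t = 0 is that of φ(t), since the conditioned kernel is O(t²) and φ is O(t) on [-t,t].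
-/

noncomputable section
namespace CUEJanossy
open MeasureTheory

/-! ### Integral operators on bounded continuous functions -/

/-- Bounded continuous functions on the line. -/
abbrev Fn (E : Type*) [NormedAddCommGroup E] := BoundedContinuousFunction ℝ E

/-- Bounded continuous kernels, `κ z x = K(x,z)`. -/
abbrev Ker := Fn (Fn ℝ)

section Operator

variable {E : Type*} [NormedAddCommGroup E] [NormedSpace ℝ E]

/-- `x ↦ f x • e`, as a bounded bilinear map. -/
def tensor : Fn ℝ →L[ℝ] E →L[ℝ] Fn E :=
  LinearMap.mkContinuous₂
    (LinearMap.mk₂ ℝ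
      (fun (f : Fn ℝ) (e : E) => BoundedContinuousFunction.ofNormedAddCommGroup
        (fun x => f x • e) (f.continuous.smul continuous_const) (‖f‖ * ‖e‖)
        (fun x => by
          rw [norm_smul]
          exact mul_le_mul_of_nonneg_right (f.norm_coe_le_norm x) (norm_nonneg _)))
      (fun f f' e => by ext x; simp [add_smul])
      (fun c f e => by ext x; simp [mul_smul])
      (fun f e e' => by ext x; simp)
      (fun c f e => by ext x; exact smul_comm (f x) c e))
    1 (fun f e => by
      rw [one_mul, LinearMap.mk₂_apply]
      refine BoundedContinuousFunction.norm_ofNormedAddCommGroup_le _ (by positivity) _)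

@[simp] lemma tensor_apply (f : Fn ℝ) (e : E) (x : ℝ) : tensor f e x = f x • e := rfl

lemma norm_tensor_le (f : Fn ℝ) (e : E) : ‖tensor f e‖ ≤ ‖f‖ * ‖e‖ :=
  (BoundedContinuousFunction.norm_le (by positivity)).2 fun x => by
    rw [tensor_apply, norm_smul]
    exact mul_le_mul_of_nonneg_right (f.norm_coe_le_norm x) (norm_nonneg _)

lemma continuous_tensor (κ : Ker) (g : Fn E) : Continuous fun z => tensor (κ z) (g z) :=
  (tensor.continuous.comp κ.continuous).clm_apply g.continuous

lemma norm_tensor_ker_le (κ : Ker) (g : Fn E) (z : ℝ) :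
    ‖tensor (κ z) (g z)‖ ≤ ‖κ‖ * ‖g‖ :=
  (norm_tensor_le _ _).trans
    (mul_le_mul (κ.norm_coe_le_norm z) (g.norm_coe_le_norm z) (norm_nonneg _) (norm_nonneg _))

/-- The integral operator with kernel `κ` on the interval with endpoints `a`. -/
def op (κ : Ker) (a : Fin 2 → ℝ) : Fn E →L[ℝ] Fn E :=
  LinearMap.mkContinuous
    { toFun := fun g => ∫ z in (a 0)..(a 1), tensor (κ z) (g z)
      map_add' := fun f g => by
        rw [← intervalIntegral.integral_add ((continuous_tensor κ f).intervalIntegrable _ _)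
          ((continuous_tensor κ g).intervalIntegrable _ _)]
        simp
      map_smul' := fun c g => by
        rw [RingHom.id_apply, ← intervalIntegral.integral_smul]
        simp }
    (‖κ‖ * |a 1 - a 0|) (fun g => by
      refine (intervalIntegral.norm_integral_le_of_norm_le_const
        (fun z _ => norm_tensor_ker_le κ g z)).trans (le_of_eq (by ring)))

lemma op_def (κ : Ker) (a : Fin 2 → ℝ) (g : Fn E) :
    op κ a g = ∫ z in (a 0)..(a 1), tensor (κ z) (g z) := rfl

lemma norm_op_le (κ : Ker) (a : Fin 2 → ℝ) :
    ‖(op κ a : Fn E →L[ℝ] Fn E)‖ ≤ ‖κ‖ * |a 1 - a 0| :=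
  LinearMap.mkContinuous_norm_le _ (by positivity) _

lemma norm_op_sub_le (κ κ' : Ker) (a b : Fin 2 → ℝ) :
    ‖(op κ' b - op κ a : Fn E →L[ℝ] Fn E)‖ ≤
      ‖κ' - κ‖ * |b 1 - b 0| + ‖κ‖ * (|b 1 - a 1| + |b 0 - a 0|) := by
  refine ContinuousLinearMap.opNorm_le_bound _ (by positivity) fun g => ?_
  have h1 : (op κ' b - op κ a : Fn E →L[ℝ] Fn E) g = op (κ' - κ) b g + (op κ b g - op κ a g) := by
    have : op (κ' - κ) b g = op κ' b g - op κ b g := by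
      simp only [op_def]
      rw [← intervalIntegral.integral_sub ((continuous_tensor κ' g).intervalIntegrable _ _)
        ((continuous_tensor κ g).intervalIntegrable _ _)]
      simp
    rw [this]; simp
  have h2 : op κ b g - op κ a g =
      (∫ z in (a 1)..(b 1), tensor (κ z) (g z)) - ∫ z in (a 0)..(b 0), tensor (κ z) (g z) := by
    have hi : ∀ s t, IntervalIntegrable (fun z => tensor (κ z) (g z)) volume s t :=
      fun s t => (continuous_tensor κ g).intervalIntegrable _ _
    simp only [op_def]
    rw [intervalIntegral.integral_interval_sub_interval_comm (hi _ _) (hi _ _) (hi _ _),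
      intervalIntegral.integral_symm (a 0) (b 0),
      intervalIntegral.integral_symm (a 1) (b 1)]
    abel
  rw [h1, h2, add_mul]
  refine (norm_add_le _ _).trans (add_le_add ?_ ?_)
  · exact (ContinuousLinearMap.le_opNorm _ g).trans
      (mul_le_mul_of_nonneg_right (norm_op_le _ _) (norm_nonneg _))
  · refine (norm_sub_le _ _).trans ?_
    have h3 := intervalIntegral.norm_integral_le_of_norm_le_const (a := a 1) (b := b 1)
      (fun z _ => norm_tensor_ker_le κ g z)
    have h4 := intervalIntegral.norm_integral_le_of_norm_le_const (a := a 0) (b := b 0)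
      (fun z _ => norm_tensor_ker_le κ g z)
    refine (add_le_add h3 h4).trans (le_of_eq (by ring))

lemma continuous_op : Continuous fun p : Ker × (Fin 2 → ℝ) => (op p.1 p.2 : Fn E →L[ℝ] Fn E) := by
  refine continuous_iff_continuousAt.2 fun ⟨κ, a⟩ => ?_
  rw [ContinuousAt, tendsto_iff_norm_sub_tendsto_zero]
  refine squeeze_zero (fun _ => norm_nonneg _) (fun p => norm_op_sub_le κ p.1 a p.2) ?_
  have : ContinuousAt (fun p : Ker × (Fin 2 → ℝ) => ‖p.1 - κ‖ * |p.2 1 - p.2 0|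
      + ‖κ‖ * (|p.2 1 - a 1| + |p.2 0 - a 0|)) (κ, a) := by fun_prop
  simpa [ContinuousAt] using this

variable [CompleteSpace E]

lemma op_apply (κ : Ker) (a : Fin 2 → ℝ) (g : Fn E) (x : ℝ) :
    op κ a g x = ∫ z in (a 0)..(a 1), κ z x • g z := by
  rw [op_def]
  exact ((BoundedContinuousFunction.evalCLM (β := E) ℝ x).intervalIntegral_comp_comm
    ((continuous_tensor κ g).intervalIntegrable (a 0) (a 1))).symm

/-- A bounded operator commuting with evaluation of tensors passes under the integral. -/
lemma clm_op (κ : Ker) (a : Fin 2 → ℝ) (g : Fn E) {F : Type*} [NormedAddCommGroup F]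
    [NormedSpace ℝ F] [CompleteSpace F] (L : Fn E →L[ℝ] F) :
    L (op κ a g) = ∫ z in (a 0)..(a 1), L (tensor (κ z) (g z)) := by
  rw [op_def]
  exact (L.intervalIntegral_comp_comm ((continuous_tensor κ g).intervalIntegrable _ _)).symm

lemma kernelIter_eq (κ : Ker) (a : Fin 2 → ℝ) (f : Fn E) (n : ℕ) (x : ℝ) :
    kernelIter (fun x z => κ z x) a f n x = ((op κ a) ^ n) f x := by
  induction n generalizing x with
  | zero => rfl
  | succ n ih =>
    rw [pow_succ', mul_apply_eq_comp, op_apply]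
    simp only [kernelIter, ih]

lemma op_tensor (κ : Ker) (a : Fin 2 → ℝ) (f : Fn ℝ) (e : E) :
    op κ a (tensor f e) = tensor (op κ a f) e := by
  ext x
  rw [op_apply, tensor_apply, op_apply, ← intervalIntegral.integral_smul_const]
  simp [mul_smul]

lemma op_pow_tensor (κ : Ker) (a : Fin 2 → ℝ) (n : ℕ) (f : Fn ℝ) (e : E) :
    ((op κ a) ^ n) (tensor f e) = tensor (((op κ a) ^ n) f) e := by
  induction n with
  | zero => rfl
  | succ n ih => rw [pow_succ', pow_succ', mul_apply_eq_comp, ih, op_tensor]; rfl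

/-- Composition of a function on the line with a bounded linear map. -/
lemma op_comp {F : Type*} [NormedAddCommGroup F] [NormedSpace ℝ F] [CompleteSpace F]
    (κ : Ker) (a : Fin 2 → ℝ) (L : E →L[ℝ] F) (g : Fn E) :
    op κ a (L.compLeftContinuousBounded ℝ g) = L.compLeftContinuousBounded ℝ (op κ a g) := by
  ext x
  rw [op_apply, ContinuousLinearMap.compLeftContinuousBounded_apply, op_apply,
    ← L.intervalIntegral_comp_comm]
  · simp
  · refine Continuous.intervalIntegrable ?_ _ _
    exact ((BoundedContinuousFunction.evalCLM ℝ x).continuous.comp κ.continuous).smul g.continuous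

lemma op_pow_comp {F : Type*} [NormedAddCommGroup F] [NormedSpace ℝ F] [CompleteSpace F]
    (κ : Ker) (a : Fin 2 → ℝ) (L : E →L[ℝ] F) (n : ℕ) (g : Fn E) :
    ((op κ a) ^ n) (L.compLeftContinuousBounded ℝ g) =
      L.compLeftContinuousBounded ℝ (((op κ a) ^ n) g) := by
  induction n with
  | zero => rfl
  | succ n ih => rw [pow_succ', pow_succ', mul_apply_eq_comp, ih, op_comp]; rfl

/-- Hahn–Banach reduces vector values to scalars: a norming functional of norm at most one commutes
with the operator because the kernel is real. All smallness conditions can thus be imposed on the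
scalar operator alone. -/
lemma norm_op_pow_le (κ : Ker) (a : Fin 2 → ℝ) (n : ℕ) :
    ‖(op κ a : Fn E →L[ℝ] Fn E) ^ n‖ ≤ ‖(op κ a : Fn ℝ →L[ℝ] Fn ℝ) ^ n‖ := by
  refine ContinuousLinearMap.opNorm_le_bound _ (norm_nonneg _) fun g => ?_
  refine (BoundedContinuousFunction.norm_le (by positivity)).2 fun x => ?_
  obtain ⟨L, hL, hLx⟩ := exists_dual_vector'' ℝ ((((op κ a : Fn E →L[ℝ] Fn E)) ^ n) g x)
  have h := op_pow_comp κ a L n g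
  have h' := congrArg (fun f : Fn ℝ => f x) h
  simp only [ContinuousLinearMap.compLeftContinuousBounded_apply] at h'
  rw [hLx] at h'
  have h2 : ‖L.compLeftContinuousBounded ℝ g‖ ≤ ‖g‖ := by
    refine (BoundedContinuousFunction.norm_le (norm_nonneg _)).2 fun y => ?_
    rw [ContinuousLinearMap.compLeftContinuousBounded_apply]
    refine (L.le_opNorm _).trans ?_
    calc ‖L‖ * ‖g y‖ ≤ 1 * ‖g‖ :=
          mul_le_mul hL (g.norm_coe_le_norm y) (norm_nonneg _) zero_le_one
      _ = ‖g‖ := one_mul _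
  calc ‖((op κ a) ^ n) g x‖ = ((op κ a) ^ n) (L.compLeftContinuousBounded ℝ g) x := by
        rw [h']; rfl
    _ ≤ ‖((op κ a) ^ n) (L.compLeftContinuousBounded ℝ g)‖ :=
        (Real.le_norm_self _).trans (BoundedContinuousFunction.norm_coe_le_norm _ x)
    _ ≤ ‖(op κ a : Fn ℝ →L[ℝ] Fn ℝ) ^ n‖ * ‖L.compLeftContinuousBounded ℝ g‖ :=
        ContinuousLinearMap.le_opNorm _ _
    _ ≤ _ := mul_le_mul_of_nonneg_left h2 (norm_nonneg _)

end Operator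

/-! ### The resolvent -/

/-- Some power of the integral operator is a strict contraction. -/
def Good (κ : Ker) (a : Fin 2 → ℝ) : Prop := ∃ n : ℕ, ‖(op κ a : Fn ℝ →L[ℝ] Fn ℝ) ^ n‖ < 1

/-- Local uniform geometric bounds for the powers of a family of operators. -/
lemma exists_geometric_bound {R P : Type*} [NormedRing R] [TopologicalSpace P]
    {A : P → R} {p : P} (hA : ContinuousAt A p) {n : ℕ} (hn : ‖A p ^ n‖ < 1) :
    ∃ C θ : ℝ, 0 ≤ C ∧ 0 ≤ θ ∧ θ < 1 ∧ ∀ᶠ p' in 𝓝 p, ∀ m, 1 ≤ m → ‖A p' ^ m‖ ≤ C * θ ^ m := by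
  obtain ⟨θ₁, h1, h1'⟩ := exists_between hn
  have hθ₁ : 0 < θ₁ := (norm_nonneg _).trans_lt h1
  rcases Nat.eq_zero_or_pos n with rfl | hn0
  -- For n = 0 the hypothesis is ‖1‖ < 1; since ‖1‖ ≤ ‖1‖², this forces the zero ring.
  · refine ⟨0, 0, le_rfl, le_rfl, zero_lt_one, Eventually.of_forall fun p' m _ => ?_⟩
    rw [pow_zero] at hn
    have h0 : ∀ x : R, x = 0 := by
      have h10 : (1 : R) = 0 := by
        by_contra hne
        have : ‖(1 : R)‖ ≤ ‖(1 : R)‖ * ‖(1 : R)‖ := by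
          simpa using norm_mul_le (1 : R) 1
        have hpos : 0 < ‖(1 : R)‖ := norm_pos_iff.2 hne
        nlinarith
      intro x
      rw [← mul_one x, h10, mul_zero]
    rw [h0 (A p' ^ m)]; simp
  -- The rate θ is the n-th root of a number θ₁ between ‖A p ^ n‖ and 1. Writing m = n(m/n) + m%n,
  -- the first factor decays like θ^m and the second stays below B^n. Factors ‖1‖ + 1 appear since
  -- ‖1‖ = 1 is not assumed.
  · have hθe : ((θ₁ ^ ((1 : ℝ) / n)) : ℝ) ^ n = θ₁ := by
      rw [← Real.rpow_natCast, ← Real.rpow_mul hθ₁.le]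
      have : (n : ℝ) ≠ 0 := by positivity
      field_simp
      simp
    set θ : ℝ := θ₁ ^ ((1 : ℝ) / n) with hθ
    have hθ0 : 0 < θ := Real.rpow_pos_of_pos hθ₁ _
    have hθ1 : θ < 1 := Real.rpow_lt_one hθ₁.le h1' (by positivity)
    set B : ℝ := max 1 (‖A p‖ + 1) with hB
    have hB1 : 1 ≤ B := le_max_left _ _
    refine ⟨(‖(1 : R)‖ + 1) * B ^ n * (θ ^ n)⁻¹, θ, by positivity, hθ0.le, hθ1, ?_⟩
    have e1 : ∀ᶠ p' in 𝓝 p, ‖A p' ^ n‖ < θ₁ := (hA.pow n).norm.eventually_lt_const h1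
    have e2 : ∀ᶠ p' in 𝓝 p, ‖A p'‖ < ‖A p‖ + 1 := hA.norm.eventually_lt_const (lt_add_one _)
    filter_upwards [e1, e2] with p' h3 h4 m hm
    have h5 : ‖A p'‖ ≤ B := h4.le.trans (le_max_right _ _)
    have hdm : m = n * (m / n) + m % n := (Nat.div_add_mod m n).symm
    have hmod : m % n < n := Nat.mod_lt _ hn0
    have k1 : ‖A p' ^ (n * (m / n))‖ ≤ (‖(1 : R)‖ + 1) * θ ^ (n * (m / n)) := by
      rw [pow_mul, pow_mul, hθe]
      rcases Nat.eq_zero_or_pos (m / n) with h0 | h0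
      · rw [h0]; simp
      · refine (norm_pow_le' _ h0).trans ?_
        calc ‖A p' ^ n‖ ^ (m / n) ≤ θ₁ ^ (m / n) := by gcongr
          _ = 1 * θ₁ ^ (m / n) := (one_mul _).symm
          _ ≤ _ := by gcongr; linarith [norm_nonneg (1 : R)]
    have k2 : θ ^ (n * (m / n)) ≤ (θ ^ n)⁻¹ * θ ^ m := by
      rw [le_inv_mul_iff₀ (by positivity), ← pow_add]
      refine pow_le_pow_of_le_one hθ0.le hθ1.le ?_
      omega
    rcases Nat.eq_zero_or_pos (m % n) with h0 | h0
    · have hm' : m = n * (m / n) := by omega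
      have k1' : ‖A p' ^ m‖ ≤ (‖(1 : R)‖ + 1) * θ ^ (n * (m / n)) := by
        rw [← hm'] at k1 ⊢; exact k1
      refine k1'.trans ?_
      calc (‖(1 : R)‖ + 1) * θ ^ (n * (m / n))
          ≤ (‖(1 : R)‖ + 1) * 1 * ((θ ^ n)⁻¹ * θ ^ m) := by
            rw [mul_one]; gcongr
        _ ≤ (‖(1 : R)‖ + 1) * B ^ n * ((θ ^ n)⁻¹ * θ ^ m) := by
            gcongr; exact one_le_pow₀ hB1
        _ = _ := by ring
    · have k3 : ‖A p' ^ (m % n)‖ ≤ B ^ n := by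
        refine (norm_pow_le' _ h0).trans ?_
        calc ‖A p'‖ ^ (m % n) ≤ B ^ (m % n) := by gcongr
          _ ≤ B ^ n := pow_le_pow_right₀ hB1 hmod.le
      calc ‖A p' ^ m‖ = ‖A p' ^ (n * (m / n)) * A p' ^ (m % n)‖ := by rw [← pow_add, ← hdm]
        _ ≤ ‖A p' ^ (n * (m / n))‖ * ‖A p' ^ (m % n)‖ := norm_mul_le _ _
        _ ≤ ((‖(1 : R)‖ + 1) * θ ^ (n * (m / n))) * B ^ n := by gcongr
        _ ≤ ((‖(1 : R)‖ + 1) * ((θ ^ n)⁻¹ * θ ^ m)) * B ^ n := by gcongr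
        _ = _ := by ring

/-- Allowing the exponent to vary makes the set a union of open conditions, one for each power. -/
lemma isOpen_good : IsOpen {p : Ker × (Fin 2 → ℝ) | Good p.1 p.2} := by
  have : {p : Ker × (Fin 2 → ℝ) | Good p.1 p.2} =
      ⋃ n : ℕ, {p | ‖(op p.1 p.2 : Fn ℝ →L[ℝ] Fn ℝ) ^ n‖ < 1} := by
    ext p; simp [Good]
  rw [this]
  exact isOpen_iUnion fun n => isOpen_lt ((continuous_op.pow n).norm) continuous_const

section Resolvent

variable {E : Type*} [NormedAddCommGroup E] [NormedSpace ℝ E] [CompleteSpace E]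

lemma good_bound {κ : Ker} {a : Fin 2 → ℝ} (h : Good κ a) :
    ∃ C θ : ℝ, 0 ≤ C ∧ 0 ≤ θ ∧ θ < 1 ∧ ∀ᶠ p : Ker × (Fin 2 → ℝ) in 𝓝 (κ, a), ∀ m,
      ‖(op p.1 p.2 : Fn ℝ →L[ℝ] Fn ℝ) ^ m‖ ≤ C * θ ^ m := by
  obtain ⟨n, hn⟩ := h
  obtain ⟨C, θ, hC, hθ, hθ1, he⟩ := exists_geometric_bound
    (A := fun p : Ker × (Fin 2 → ℝ) => (op p.1 p.2 : Fn ℝ →L[ℝ] Fn ℝ)) (p := (κ, a))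
    continuous_op.continuousAt hn
  -- The bound held for m ≥ 1 only; the extra 1 covers m = 0, the identity having operator norm at
  -- most one.
  refine ⟨C + 1, θ, by positivity, hθ, hθ1, ?_⟩
  filter_upwards [he] with p hp m
  rcases Nat.eq_zero_or_pos m with rfl | hm
  · have h1 : ‖(1 : Fn ℝ →L[ℝ] Fn ℝ)‖ ≤ 1 := ContinuousLinearMap.norm_id_le
    rw [pow_zero, pow_zero]; linarith
  · refine (hp m hm).trans ?_
    gcongr; linarith

lemma summable_norm_op_pow {κ : Ker} {a : Fin 2 → ℝ} (h : Good κ a) :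
    Summable fun n => ‖(op κ a : Fn E →L[ℝ] Fn E) ^ n‖ := by
  obtain ⟨C, θ, hC, hθ, hθ1, he⟩ := good_bound h
  exact Summable.of_nonneg_of_le (fun _ => norm_nonneg _)
    (fun n => (norm_op_pow_le κ a n).trans (he.self_of_nhds n))
    ((summable_geometric_of_lt_one hθ hθ1).mul_left C)

lemma summable_op_pow {κ : Ker} {a : Fin 2 → ℝ} (h : Good κ a) :
    Summable fun n => (op κ a : Fn E →L[ℝ] Fn E) ^ n :=
  Summable.of_norm (summable_norm_op_pow (E := E) h)

/-- `𝕀 - 𝕂` as a unit. -/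
def unitOf {κ : Ker} {a : Fin 2 → ℝ} (h : Good κ a) : (Fn E →L[ℝ] Fn E)ˣ where
  val := 1 - op κ a
  inv := ∑' n, (op κ a) ^ n
  val_inv := by
    have := (summable_op_pow (E := E) h)
    exact this.one_sub_mul_tsum_pow
  inv_val := by
    have := (summable_op_pow (E := E) h)
    exact this.tsum_pow_mul_one_sub

/-- The resolvent operator `(𝕀 - 𝕂)⁻¹`. -/
def res (κ : Ker) (a : Fin 2 → ℝ) : Fn E →L[ℝ] Fn E := Ring.inverse (1 - op κ a)

lemma res_eq {κ : Ker} {a : Fin 2 → ℝ} (h : Good κ a) :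
    (res κ a : Fn E →L[ℝ] Fn E) = ∑' n, (op κ a) ^ n :=
  Ring.inverse_unit (unitOf h)

lemma res_mul {κ : Ker} {a : Fin 2 → ℝ} (h : Good κ a) :
    (res κ a : Fn E →L[ℝ] Fn E) * (1 - op κ a) = 1 := by
  rw [res_eq h]; exact (unitOf h).inv_val

lemma mul_res {κ : Ker} {a : Fin 2 → ℝ} (h : Good κ a) :
    (1 - op κ a) * (res κ a : Fn E →L[ℝ] Fn E) = 1 := by
  rw [res_eq h]; exact (unitOf h).val_inv

lemma res_sub_op {κ : Ker} {a : Fin 2 → ℝ} (h : Good κ a) (f : Fn E) :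
    res κ a f - op κ a (res κ a f) = f := by
  have := congrArg (fun L : Fn E →L[ℝ] Fn E => L f) (mul_res (E := E) h)
  simpa using this

lemma eq_res {κ : Ker} {a : Fin 2 → ℝ} (h : Good κ a) {f g : Fn E} (hg : g - op κ a g = f) :
    g = res κ a f := by
  have := congrArg (fun L : Fn E →L[ℝ] Fn E => L g) (res_mul (E := E) h)
  rw [← hg]
  simpa using this.symm

/-- Inversion in a Banach algebra is continuous at units. This is the source of every later joint
continuity statement. -/
lemma continuousAt_res {κ : Ker} {a : Fin 2 → ℝ} (h : Good κ a) :
    ContinuousAt (fun p : Ker × (Fin 2 → ℝ) => (res p.1 p.2 : Fn E →L[ℝ] Fn E)) (κ, a) := by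
  have h1 : ContinuousAt Ring.inverse (1 - op κ a : Fn E →L[ℝ] Fn E) :=
    NormedRing.inverse_continuousAt (unitOf (E := E) h)
  have h2 : ContinuousAt (fun p : Ker × (Fin 2 → ℝ) => (1 - op p.1 p.2 : Fn E →L[ℝ] Fn E)) (κ, a) :=
    (continuous_const.sub continuous_op).continuousAt
  exact ContinuousAt.comp (f := fun p : Ker × (Fin 2 → ℝ) => (1 - op p.1 p.2 : Fn E →L[ℝ] Fn E))
    (g := Ring.inverse) h1 h2

lemma hasSum_res {κ : Ker} {a : Fin 2 → ℝ} (h : Good κ a) (f : Fn E) (x : ℝ) :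
    HasSum (fun n => ((op κ a) ^ n) f x) (res κ a f x) := by
  have h1 := (summable_op_pow (E := E) h).hasSum
  rw [← res_eq h] at h1
  have h2 := h1.mapL ((BoundedContinuousFunction.evalCLM ℝ x).comp
    (ContinuousLinearMap.apply ℝ (Fn E) f))
  simpa using h2

lemma resolvent_eq {κ : Ker} {a : Fin 2 → ℝ} (h : Good κ a) (f : Fn E) (x : ℝ) :
    resolvent (fun x z => κ z x) a f x = res κ a f x := by
  rw [resolvent, ← (hasSum_res h f x).tsum_eq]
  simp only [kernelIter_eq]

lemma res_tensor {κ : Ker} {a : Fin 2 → ℝ} (h : Good κ a) (f : Fn ℝ) (e : E) :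
    res κ a (tensor f e) = tensor (res κ a f) e := by
  symm
  apply eq_res h
  rw [op_tensor]
  conv_rhs => rw [← res_sub_op h f]
  simp

end Resolvent

end CUEJanossy
end

noncomputable section
namespace CUEJanossy
open MeasureTheory

/-! ### Iterated and resolvent kernels -/

section Kernels

variable {E : Type*} [NormedAddCommGroup E] [NormedSpace ℝ E] [CompleteSpace E]

/-- The kernel of `𝕂^(n+1)`. -/
def iter (κ : Ker) (a : Fin 2 → ℝ) (n : ℕ) (x y : ℝ) : ℝ := ((op κ a) ^ n) (κ y) x

/-- The resolvent kernel, the kernel of `𝕂(𝕀 - 𝕂)⁻¹`. -/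
def Rk (κ : Ker) (a : Fin 2 → ℝ) (x y : ℝ) : ℝ := res κ a (κ y) x

lemma op_pow_succ_apply (κ : Ker) (a : Fin 2 → ℝ) (n : ℕ) (g : Fn E) (x : ℝ) :
    ((op κ a) ^ (n + 1)) g x = ∫ z in (a 0)..(a 1), iter κ a n x z • g z := by
  rw [pow_succ, mul_apply_eq_comp]
  have := clm_op κ a g ((BoundedContinuousFunction.evalCLM (β := E) ℝ x).comp ((op κ a) ^ n))
  simp only [ContinuousLinearMap.comp_apply, BoundedContinuousFunction.evalCLM_apply,
    op_pow_tensor, tensor_apply] at this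
  exact this

/-- A factor of κ can be split off either on the right or on the left of the iterated kernel;
symmetry of κ exchanges the two. -/
lemma iter_symm {κ : Ker} (hs : ∀ x y, κ x y = κ y x) (a : Fin 2 → ℝ) (n : ℕ) (x y : ℝ) :
    iter κ a n x y = iter κ a n y x := by
  induction n generalizing x y with
  | zero => exact hs y x
  | succ n ih =>
    have h1 : iter κ a (n + 1) x y = ∫ z in (a 0)..(a 1), iter κ a n x z • κ y z := by
      exact op_pow_succ_apply κ a n (κ y) x
    have h2 : iter κ a (n + 1) y x = ∫ z in (a 0)..(a 1), κ z y • iter κ a n z x := by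
      rw [iter, pow_succ', mul_apply_eq_comp, op_apply]; rfl
    rw [h1, h2]
    congr 1
    ext z
    rw [ih x z, hs y z, smul_eq_mul, smul_eq_mul, mul_comm]

lemma hasSum_Rk {κ : Ker} {a : Fin 2 → ℝ} (h : Good κ a) (x y : ℝ) :
    HasSum (fun n => iter κ a n x y) (Rk κ a x y) := hasSum_res h (κ y) x

lemma Rk_symm {κ : Ker} {a : Fin 2 → ℝ} (h : Good κ a) (hs : ∀ x y, κ x y = κ y x) (x y : ℝ) :
    Rk κ a x y = Rk κ a y x := by
  rw [← (hasSum_Rk h x y).tsum_eq, ← (hasSum_Rk h y x).tsum_eq]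
  simp only [iter_symm hs a _ x y]

/-- From (𝕀-𝕂)⁻¹ = 𝕀 + (𝕀-𝕂)⁻¹𝕂: the resolvent passes under the integral defining 𝕂f and acts on the
columns of κ. -/
lemma res_apply_eq {κ : Ker} {a : Fin 2 → ℝ} (h : Good κ a) (f : Fn E) (x : ℝ) :
    res κ a f x = f x + ∫ z in (a 0)..(a 1), Rk κ a x z • f z := by
  have h1 : res κ a f = f + res κ a (op κ a f) := by
    symm
    apply eq_res h
    have := res_sub_op h (op κ a f)
    rw [map_add, ← sub_sub]
    calc f + res κ a (op κ a f) - op κ a f - op κ a (res κ a (op κ a f))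
        = f + (res κ a (op κ a f) - op κ a (res κ a (op κ a f))) - op κ a f := by abel
      _ = f := by rw [this]; abel
  have h2 := clm_op κ a f ((BoundedContinuousFunction.evalCLM (β := E) ℝ x).comp (res κ a))
  simp only [ContinuousLinearMap.comp_apply, BoundedContinuousFunction.evalCLM_apply,
    res_tensor h, tensor_apply] at h2
  conv_lhs => rw [h1]
  rw [BoundedContinuousFunction.add_apply, h2]
  rfl

end Kernels

/-! ### Dependence on the endpoints -/

section Endpoints

variable {E : Type*} [NormedAddCommGroup E] [NormedSpace ℝ E]

/-- The `k`-th coordinate of the endpoints. -/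
abbrev coordL (k : Fin 2) : (Fin 2 → ℝ) →L[ℝ] ℝ := ContinuousLinearMap.proj k

/-- The linear map `h ↦ ∑ k, sgn k * h k • c k`. -/
def edgeDeriv (c : Fin 2 → E) : (Fin 2 → ℝ) →L[ℝ] E :=
  ∑ k, (coordL k).smulRight (sgn k • c k)

@[simp] lemma edgeDeriv_apply (c : Fin 2 → E) (h : Fin 2 → ℝ) :
    edgeDeriv c h = ∑ k, h k • sgn k • c k := by
  simp [edgeDeriv]

lemma abs_sgn (k : Fin 2) : |sgn k| = 1 := by
  fin_cases k <;> simp [sgn]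

lemma pd_of_hasFDerivAt {F : (Fin 2 → ℝ) → E} {F' : (Fin 2 → ℝ) →L[ℝ] E} {a : Fin 2 → ℝ}
    (h : HasFDerivAt F F' a) (k : Fin 2) : pd F k a = F' (Pi.single k 1) := by
  have h1 : HasFDerivAt F F' (Function.update a k (a k)) := by simpa using h
  have := h1.comp_hasDerivAt (a k) (hasDerivAt_update a k (a k))
  exact this.deriv

lemma edgeDeriv_single (c : Fin 2 → E) (k : Fin 2) :
    edgeDeriv c (Pi.single k 1) = sgn k • c k := by
  rw [edgeDeriv_apply, Fin.sum_univ_two]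
  fin_cases k <;> simp

lemma pd_of_edgeDeriv {F : (Fin 2 → ℝ) → E} {c : Fin 2 → E} {a : Fin 2 → ℝ}
    (h : HasFDerivAt F (edgeDeriv c) a) (k : Fin 2) : pd F k a = sgn k • c k := by
  rw [pd_of_hasFDerivAt h, edgeDeriv_single]

lemma clm_comp_edgeDeriv {F : Type*} [NormedAddCommGroup F] [NormedSpace ℝ F] (L : E →L[ℝ] F)
    (c : Fin 2 → E) : L.comp (edgeDeriv c) = edgeDeriv fun k => L (c k) := by
  ext h
  simp

lemma edgeDeriv_add (c d : Fin 2 → E) : edgeDeriv c + edgeDeriv d = edgeDeriv fun k => c k + d k := by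
  ext h
  simp [Finset.sum_add_distrib]

lemma hasFDerivAt_integral_endpoints [CompleteSpace E] {f : ℝ → E} (hf : Continuous f)
    (a : Fin 2 → ℝ) :
    HasFDerivAt (fun b : Fin 2 → ℝ => ∫ z in (b 0)..(b 1), f z) (edgeDeriv fun k => f (a k)) a := by
  have h1 := (intervalIntegral.integral_hasStrictFDerivAt (a := a 0) (b := a 1)
    (hf.intervalIntegrable _ _) (hf.stronglyMeasurableAtFilter _ _)
    (hf.stronglyMeasurableAtFilter _ _) hf.continuousAt hf.continuousAt).hasFDerivAt
  have h2 : HasFDerivAt (fun b : Fin 2 → ℝ => (b 0, b 1))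
      ((coordL 0).prod
        (coordL 1)) a :=
    (coordL 0).hasFDerivAt.prodMk
      (coordL 1).hasFDerivAt
  have h3 := HasFDerivAt.comp a (f := fun b : Fin 2 → ℝ => (b 0, b 1)) h1 h2
  refine h3.congr_fderiv ?_
  ext h
  simp only [ContinuousLinearMap.comp_apply, ContinuousLinearMap.prod_apply,
    ContinuousLinearMap.proj_apply, sub_apply, ContinuousLinearMap.smulRight_apply,
    ContinuousLinearMap.coe_fst', ContinuousLinearMap.coe_snd', edgeDeriv_apply, Fin.sum_univ_two]
  simp [sgn, sub_eq_add_neg, add_comm]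

/-- Product rule for a norm-continuous family of operators that is only strongly
differentiable. -/
lemma hasFDerivAt_family {P X Y : Type*} [NormedAddCommGroup P] [NormedSpace ℝ P]
    [NormedAddCommGroup X] [NormedSpace ℝ X] [NormedAddCommGroup Y] [NormedSpace ℝ Y]
    {A : P → X →L[ℝ] Y} {G : P → X} {G' : P →L[ℝ] X} {D : P →L[ℝ] Y} {a : P}
    (hA : ContinuousAt A a) (hD : HasFDerivAt (fun b => A b (G a)) D a) (hG : HasFDerivAt G G' a) :
    HasFDerivAt (fun b => A b (G b)) ((A a).comp G' + D) a := by
  have h1 : HasFDerivAt (fun b => A a (G b)) ((A a).comp G') a := (A a).hasFDerivAt.comp a hG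
  have h2 : HasFDerivAt (fun b => (A b - A a) (G b - G a)) (0 : P →L[ℝ] Y) a := by
    refine HasFDerivAt.of_isLittleO ?_
    have hO : (fun b => G b - G a) =O[𝓝 a] fun b => b - a := hG.isBigO_sub
    have ho : (fun b => A b - A a) =o[𝓝 a] (fun _ => (1 : ℝ)) := by
      rw [Asymptotics.isLittleO_one_iff]
      simpa using (hA.tendsto.sub_const (A a))
    have h3 : (fun b => (A b - A a) (G b - G a)) =O[𝓝 a]
        fun b => ‖A b - A a‖ * ‖G b - G a‖ :=
      Asymptotics.IsBigO.of_bound 1 (Eventually.of_forall fun b => by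
        rw [Real.norm_of_nonneg (by positivity), one_mul]
        exact ContinuousLinearMap.le_opNorm _ _)
    have h4 : (fun b => ‖A b - A a‖ * ‖G b - G a‖) =o[𝓝 a] fun b => (1 : ℝ) * ‖b - a‖ :=
      ho.norm_left.mul_isBigO hO.norm_norm
    have h5 := h3.trans_isLittleO h4
    simp only [one_mul] at h5
    simpa using h5.of_norm_right
  have h6 := (h1.add hD).add h2
  rw [add_zero] at h6
  refine (h6.sub_const (A a (G a))).congr_of_eventuallyEq (Eventually.of_forall fun b => ?_)
  simp only [Pi.add_apply, sub_apply, map_sub]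
  abel

lemma hasFDerivAt_coord_smul {v : (Fin 2 → ℝ) → E} {a : Fin 2 → ℝ} (hv : ContinuousAt v a)
    (k : Fin 2) : HasFDerivAt (fun b => (b k - a k) • v b)
      ((coordL k).smulRight (v a)) a := by
  have hG : HasFDerivAt (fun b : Fin 2 → ℝ => b k - a k)
      (coordL k) a :=
    ((coordL k).hasFDerivAt).sub_const _
  have hA : ContinuousAt (fun b => ContinuousLinearMap.toSpanSingleton ℝ (v b)) a := by
    exact (ContinuousLinearMap.toSpanSingletonLIE (𝕜 := ℝ) (E := E)).continuous.continuousAt.comp hv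
  have h := hasFDerivAt_family (A := fun b => ContinuousLinearMap.toSpanSingleton ℝ (v b))
    (D := 0) hA (by simpa using hasFDerivAt_const (0 : E) a) hG
  simp only [ContinuousLinearMap.toSpanSingleton_apply, add_zero] at h
  refine h.congr_fderiv ?_
  ext; simp

/-- Evaluation of a moving function at a moving endpoint. -/
lemma hasFDerivAt_eval {F : (Fin 2 → ℝ) → Fn E} {c : Fin 2 → Fn E} {a : Fin 2 → ℝ}
    (hF : HasFDerivAt F (edgeDeriv c) a) (j : Fin 2) {e : E} (he : HasDerivAt (F a) e (a j)) :
    HasFDerivAt (fun b => F b (b j)) (edgeDeriv (fun k => c k (a j)) +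
      (coordL j).smulRight e) a := by
  have hj : HasFDerivAt (fun b : Fin 2 → ℝ => b j)
      (coordL j) a :=
    (coordL j).hasFDerivAt
  -- The linearisation error is small in sup norm, so evaluating it at the moving point `b j` costs
  -- nothing.
  have h1 : HasFDerivAt (fun b => (F b - F a - edgeDeriv c (b - a)) (b j))
      (0 : (Fin 2 → ℝ) →L[ℝ] E) a := by
    refine HasFDerivAt.of_isLittleO ?_
    have := hF.isLittleO
    refine Asymptotics.IsBigO.trans_isLittleO (Asymptotics.IsBigO.of_bound 1 ?_) this
    refine Eventually.of_forall fun b => ?_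
    simp only [sub_self, map_zero, BoundedContinuousFunction.coe_zero, Pi.zero_apply, sub_zero,
      zero_apply, one_mul]
    exact BoundedContinuousFunction.norm_coe_le_norm _ _
  have h2 : HasFDerivAt (fun b => F a (b j))
      ((coordL j).smulRight e) a := by
    have := HasFDerivAt.comp a he.hasFDerivAt hj
    refine this.congr_fderiv ?_
    ext; simp
  have h3 : HasFDerivAt (fun b : Fin 2 → ℝ => ∑ k, (b k - a k) • (sgn k • c k (b j)))
      (edgeDeriv (fun k => c k (a j))) a := by
    refine HasFDerivAt.fun_sum fun k _ => ?_
    refine hasFDerivAt_coord_smul (v := fun b => sgn k • c k (b j)) ?_ k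
    exact (((c k).continuous.comp (continuous_apply j)).const_smul (sgn k)).continuousAt
  have h4 := (h1.add h2).add h3
  rw [zero_add, add_comm (ContinuousLinearMap.smulRight _ _)] at h4
  refine h4.congr_of_eventuallyEq (Eventually.of_forall fun b => ?_)
  simp only [Pi.add_apply, edgeDeriv_apply, Fin.sum_univ_two, BoundedContinuousFunction.sub_apply,
    BoundedContinuousFunction.add_apply, BoundedContinuousFunction.smul_apply, Pi.sub_apply]
  abel

end Endpoints

end CUEJanossy
end

/-! ### Endpoint derivatives of the resolvent and of its bilinear forms -/

noncomputable section
namespace CUEJanossy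
open MeasureTheory

section Derivatives

variable {E : Type*} [NormedAddCommGroup E] [NormedSpace ℝ E]

lemma continuousAt_op_endpoints (κ : Ker) (a : Fin 2 → ℝ) :
    ContinuousAt (fun b => (op κ b : Fn E →L[ℝ] Fn E)) a :=
  (continuous_op.comp (Continuous.prodMk_right κ)).continuousAt

/-- Integration over the interval with endpoints `a`. -/
def intL (a : Fin 2 → ℝ) : Fn E →L[ℝ] E :=
  LinearMap.mkContinuous
    { toFun := fun g => ∫ z in (a 0)..(a 1), g z
      map_add' := fun f g => by
        rw [← intervalIntegral.integral_add (f.continuous.intervalIntegrable _ _)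
          (g.continuous.intervalIntegrable _ _)]
        simp
      map_smul' := fun c g => by
        rw [RingHom.id_apply, ← intervalIntegral.integral_smul]
        simp }
    |a 1 - a 0| (fun g => by
      refine (intervalIntegral.norm_integral_le_of_norm_le_const
        (fun z _ => g.norm_coe_le_norm z)).trans (le_of_eq (by ring)))

lemma intL_apply (a : Fin 2 → ℝ) (g : Fn E) : intL a g = ∫ z in (a 0)..(a 1), g z := rfl

lemma norm_intL_sub_le (a b : Fin 2 → ℝ) :
    ‖(intL b - intL a : Fn E →L[ℝ] E)‖ ≤ |b 1 - a 1| + |b 0 - a 0| := by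
  refine ContinuousLinearMap.opNorm_le_bound _ (by positivity) fun g => ?_
  have hi : ∀ s t, IntervalIntegrable g volume s t :=
    fun s t => g.continuous.intervalIntegrable _ _
  have h2 : (intL b - intL a : Fn E →L[ℝ] E) g =
      (∫ z in (a 1)..(b 1), g z) - ∫ z in (a 0)..(b 0), g z := by
    simp only [sub_apply, intL_apply]
    rw [intervalIntegral.integral_interval_sub_interval_comm (hi _ _) (hi _ _) (hi _ _),
      intervalIntegral.integral_symm (a 0) (b 0),
      intervalIntegral.integral_symm (a 1) (b 1)]
    abel
  rw [h2]
  refine (norm_sub_le _ _).trans ?_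
  have h3 := intervalIntegral.norm_integral_le_of_norm_le_const (a := a 1) (b := b 1)
    (fun z _ => g.norm_coe_le_norm z)
  have h4 := intervalIntegral.norm_integral_le_of_norm_le_const (a := a 0) (b := b 0)
    (fun z _ => g.norm_coe_le_norm z)
  refine (add_le_add h3 h4).trans (le_of_eq (by ring))

lemma continuous_intL : Continuous fun a : Fin 2 → ℝ => (intL a : Fn E →L[ℝ] E) := by
  refine continuous_iff_continuousAt.2 fun a => ?_
  rw [ContinuousAt, tendsto_iff_norm_sub_tendsto_zero]
  refine squeeze_zero (fun _ => norm_nonneg _) (fun b => norm_intL_sub_le a b) ?_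
  have : ContinuousAt (fun b : Fin 2 → ℝ => |b 1 - a 1| + |b 0 - a 0|) a := by fun_prop
  simpa [ContinuousAt] using this

variable [CompleteSpace E]

lemma hasFDerivAt_op (κ : Ker) (a : Fin 2 → ℝ) (g : Fn E) :
    HasFDerivAt (fun b => op κ b g) (edgeDeriv fun k => tensor (κ (a k)) (g (a k))) a :=
  hasFDerivAt_integral_endpoints (continuous_tensor κ g) a

lemma hasFDerivAt_op_family (κ : Ker) {a : Fin 2 → ℝ} {G : (Fin 2 → ℝ) → Fn E} {c : Fin 2 → Fn E}
    (hG : HasFDerivAt G (edgeDeriv c) a) :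
    HasFDerivAt (fun b => op κ b (G b))
      (edgeDeriv fun k => op κ a (c k) + tensor (κ (a k)) (G a (a k))) a := by
  have := hasFDerivAt_family (continuousAt_op_endpoints κ a) (hasFDerivAt_op κ a (G a)) hG
  rwa [clm_comp_edgeDeriv, edgeDeriv_add] at this

lemma hasFDerivAt_intL_family {a : Fin 2 → ℝ} {G : (Fin 2 → ℝ) → Fn E} {c : Fin 2 → Fn E}
    (hG : HasFDerivAt G (edgeDeriv c) a) :
    HasFDerivAt (fun b => ∫ z in (b 0)..(b 1), G b z)
      (edgeDeriv fun k => (∫ z in (a 0)..(a 1), c k z) + G a (a k)) a := by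
  have := hasFDerivAt_family (A := intL) continuous_intL.continuousAt
    (hasFDerivAt_integral_endpoints (G a).continuous a) hG
  rwa [clm_comp_edgeDeriv, edgeDeriv_add] at this

lemma eventually_good {κ : Ker} {a : Fin 2 → ℝ} (h : Good κ a) : ∀ᶠ b in 𝓝 a, Good κ b :=
  (Continuous.prodMk_right κ).continuousAt.eventually (isOpen_good.mem_nhds h)

/-- Second resolvent identity: res_b f = res_a f + res_b(𝕂_b - 𝕂_a)res_a f. The vector to which
res_b is applied vanishes at b = a, so norm continuity of res_b together with strong
differentiability of 𝕂_b is enough. -/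
lemma hasFDerivAt_res {κ : Ker} {a : Fin 2 → ℝ} (h : Good κ a) (f : Fn E) :
    HasFDerivAt (fun b => res κ b f)
      (edgeDeriv fun k => tensor (res κ a (κ (a k))) (res κ a f (a k))) a := by
  have hA : ContinuousAt (fun b => (res κ b : Fn E →L[ℝ] Fn E)) a :=
    ContinuousAt.comp (f := fun b => (κ, b)) (continuousAt_res h)
      (Continuous.prodMk_right κ).continuousAt
  have hG := (hasFDerivAt_op κ a (res κ a f)).sub_const (op κ a (res κ a f))
  have h1 := hasFDerivAt_family (D := 0) hA
    (by simpa using hasFDerivAt_const (0 : Fn E) a) hG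
  rw [add_zero, clm_comp_edgeDeriv] at h1
  simp only [res_tensor h] at h1
  refine (h1.const_add (res κ a f)).congr_of_eventuallyEq ?_
  filter_upwards [eventually_good h] with b hb
  symm
  apply eq_res hb
  have h2 := res_sub_op hb (op κ b (res κ a f) - op κ a (res κ a f))
  have h3 := res_sub_op h f
  rw [map_add]
  calc _ = (res κ b (op κ b (res κ a f) - op κ a (res κ a f)) -
        op κ b (res κ b (op κ b (res κ a f) - op κ a (res κ a f)))) + res κ a f
        - op κ b (res κ a f) := by abel
    _ = res κ a f - op κ a (res κ a f) := by rw [h2]; abel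
    _ = f := h3

lemma integral_mul_Rk {κ : Ker} {a : Fin 2 → ℝ} (h : Good κ a) (hs : ∀ x y, κ x y = κ y x)
    (f : Fn ℂ) (y : ℝ) :
    f y + ∫ x in (a 0)..(a 1), f x * (res κ a (κ y) x : ℝ) = res κ a f y := by
  rw [res_apply_eq h f y]
  congr 2
  ext x
  have : res κ a (κ y) x = Rk κ a y x := by rw [Rk_symm h hs]; rfl
  rw [this, mul_comm, Complex.real_smul]

/-- Moving an endpoint gives a boundary value f(a_k) and an interior term ∫ f R(·,a_k), both
multiplied by (𝕀-𝕂)⁻¹g at a_k. By symmetry of R the two add up to (𝕀-𝕂)⁻¹f at a_k. -/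
lemma hasFDerivAt_bilinear {κ : Ker} {a : Fin 2 → ℝ} (h : Good κ a) (hs : ∀ x y, κ x y = κ y x)
    (f g : Fn ℂ) :
    HasFDerivAt (fun b => ∫ x in (b 0)..(b 1), f x * res κ b g x)
      (edgeDeriv fun k => res κ a f (a k) * res κ a g (a k)) a := by
  have h1 := (ContinuousLinearMap.mul ℝ (Fn ℂ) f).hasFDerivAt.comp a (hasFDerivAt_res h g)
  rw [clm_comp_edgeDeriv] at h1
  have h2 := hasFDerivAt_intL_family h1
  refine h2.congr_fderiv ?_
  congr 1
  ext k
  have e1 : ∀ z, (ContinuousLinearMap.mul ℝ (Fn ℂ) f)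
      (tensor (res κ a (κ (a k))) (res κ a g (a k))) z =
      (f z * (res κ a (κ (a k)) z : ℝ)) * res κ a g (a k) := by
    intro z
    simp only [ContinuousLinearMap.mul_apply', BoundedContinuousFunction.mul_apply, tensor_apply,
      Complex.real_smul]
    ring
  simp only [e1, intervalIntegral.integral_mul_const]
  rw [← integral_mul_Rk h hs f (a k)]
  simp only [Function.comp_apply, ContinuousLinearMap.mul_apply', BoundedContinuousFunction.mul_apply]
  ring

end Derivatives

/-! ### The Fredholm determinant -/

section Determinant

/-- The coefficients of the endpoint derivative of `𝕂^n κ`. -/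
def powCoeff (κ : Ker) (a : Fin 2 → ℝ) : ℕ → Fin 2 → Fn (Fn ℝ)
  | 0, _ => 0
  | n + 1, k => op κ a (powCoeff κ a n k) + tensor (κ (a k)) (((op κ a) ^ n) κ (a k))

lemma hasFDerivAt_op_pow (κ : Ker) (a : Fin 2 → ℝ) (n : ℕ) :
    HasFDerivAt (fun b => ((op κ b : Fn (Fn ℝ) →L[ℝ] Fn (Fn ℝ)) ^ n) κ)
      (edgeDeriv (powCoeff κ a n)) a := by
  induction n with
  | zero =>
    refine (hasFDerivAt_const κ a).congr_fderiv ?_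
    ext1 h
    simp [powCoeff]
  | succ n ih =>
    have := hasFDerivAt_op_family κ ih
    refine (this.congr_of_eventuallyEq (Eventually.of_forall fun b => ?_))
    simp only [pow_succ', mul_apply_eq_comp]

/-- Evaluation at `y` of the values of a kernel. -/
lemma op_pow_eval (κ : Ker) (a : Fin 2 → ℝ) (n : ℕ) (G : Fn (Fn ℝ)) (x y : ℝ) :
    ((op κ a) ^ n) G x y =
      ((op κ a) ^ n) ((BoundedContinuousFunction.evalCLM (β := ℝ) ℝ y).compLeftContinuousBounded ℝ G)
        x := by
  rw [op_pow_comp]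
  rfl

lemma op_pow_ker {κ : Ker} (hs : ∀ x y, κ x y = κ y x) (a : Fin 2 → ℝ) (n : ℕ) (x y : ℝ) :
    ((op κ a) ^ n) κ x y = iter κ a n x y := by
  rw [op_pow_eval, iter]
  congr 2
  ext z
  exact hs z y

lemma iter_comp (κ : Ker) (a : Fin 2 → ℝ) (i j : ℕ) (x y : ℝ) :
    ∫ z in (a 0)..(a 1), iter κ a i x z * iter κ a j z y = iter κ a (i + 1 + j) x y := by
  have := op_pow_succ_apply κ a i (((op κ a) ^ j) (κ y)) x
  rw [← mul_apply_eq_comp, ← pow_add] at this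
  exact this.symm

/-- Cyclicity of the trace: each of the n integration variables contributes the same term. The free
power i is needed for the induction, which moves one factor of 𝕂 from the coefficient into 𝕂^i. -/
lemma integral_op_pow_powCoeff {κ : Ker} (hs : ∀ x y, κ x y = κ y x) (a : Fin 2 → ℝ)
    (n i : ℕ) (k : Fin 2) :
    ∫ x in (a 0)..(a 1), ((op κ a) ^ i) (powCoeff κ a n k) x x =
      n * iter κ a (n + i) (a k) (a k) := by
  induction n generalizing i with
  | zero => simp [powCoeff]
  | succ n ih =>
    have hi : ∀ G : Fn (Fn ℝ), IntervalIntegrable (fun x => G x x) volume (a 0) (a 1) := by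
      intro G
      refine Continuous.intervalIntegrable ?_ _ _
      exact G.continuous.eval continuous_id
    have e1 : ∀ x, ((op κ a) ^ i) (powCoeff κ a (n + 1) k) x x =
        ((op κ a) ^ (i + 1)) (powCoeff κ a n k) x x +
          ((op κ a) ^ i) (tensor (κ (a k)) (((op κ a) ^ n) κ (a k))) x x := by
      intro x
      simp only [powCoeff, map_add, BoundedContinuousFunction.add_apply]
      rw [pow_succ, mul_apply_eq_comp]
    simp only [e1]
    rw [intervalIntegral.integral_add (hi _) (hi _), ih]
    have e2 : ∀ x, ((op κ a) ^ i) (tensor (κ (a k)) (((op κ a) ^ n) κ (a k))) x x =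
        iter κ a n (a k) x * iter κ a i x (a k) := by
      intro x
      rw [op_pow_tensor, tensor_apply, BoundedContinuousFunction.smul_apply, op_pow_ker hs,
        smul_eq_mul, mul_comm]
      rfl
    simp only [e2]
    rw [iter_comp, show n + (i + 1) = n + 1 + i by ring]
    push_cast
    ring

lemma traceSucc_eq (κ : Ker) (a : Fin 2 → ℝ) (n : ℕ) :
    traceSucc (fun x z => κ z x) a n = ∫ x in (a 0)..(a 1), iter κ a n x x := by
  rw [traceSucc]
  congr 1
  ext x
  exact kernelIter_eq κ a (κ x) n x

/-- Of the n + 1 integrations in the trace, n contribute through the iterated kernel and one through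
the outer integral; the sum n + 1 cancels the denominator. -/
lemma hasFDerivAt_traceSucc {κ : Ker} (hs : ∀ x y, κ x y = κ y x) (a : Fin 2 → ℝ) (n : ℕ) :
    HasFDerivAt (fun b => traceSucc (fun x z => κ z x) b n / ((n : ℝ) + 1))
      (edgeDeriv fun k => iter κ a n (a k) (a k)) a := by
  let diag : Fn (Fn ℝ) →L[ℝ] Fn ℝ := LinearMap.mkContinuous
    { toFun := fun G => BoundedContinuousFunction.ofNormedAddCommGroup (fun x => G x x)
        (G.continuous.eval continuous_id) ‖G‖
        (fun x => ((G x).norm_coe_le_norm x).trans (G.norm_coe_le_norm x))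
      map_add' := fun f g => by ext x; simp
      map_smul' := fun c g => by ext x; simp }
    1 (fun G => by
      rw [one_mul]
      exact (BoundedContinuousFunction.norm_le (norm_nonneg _)).2
        fun x => ((G x).norm_coe_le_norm x).trans (G.norm_coe_le_norm x))
  have hdiag : ∀ G x, diag G x = G x x := fun _ _ => rfl
  have h1 := diag.hasFDerivAt.comp a (hasFDerivAt_op_pow κ a n)
  rw [clm_comp_edgeDeriv] at h1
  have h2 := (hasFDerivAt_intL_family h1).mul_const (((n : ℝ) + 1)⁻¹)
  have h3 := by
    refine h2.congr_of_eventuallyEq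
      (f₁ := fun b => traceSucc (fun x z => κ z x) b n / ((n : ℝ) + 1))
      (Eventually.of_forall fun b => ?_)
    simp only [traceSucc_eq, Function.comp_apply, hdiag, op_pow_ker hs, div_eq_mul_inv]
  refine h3.congr_fderiv ?_
  ext h
  have hn : (n : ℝ) + 1 ≠ 0 := by positivity
  have e0 := fun k => integral_op_pow_powCoeff hs a n 0 k
  simp only [pow_zero, one_apply_eq_self, add_zero] at e0
  simp only [smul_apply, edgeDeriv_apply, hdiag, Function.comp_apply, op_pow_ker hs, e0,
    Fin.sum_univ_two, smul_eq_mul]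
  field_simp

lemma abs_iter_le (κ : Ker) (a : Fin 2 → ℝ) (n : ℕ) (x y : ℝ) :
    |iter κ a n x y| ≤ ‖(op κ a : Fn ℝ →L[ℝ] Fn ℝ) ^ n‖ * ‖κ‖ := by
  refine (BoundedContinuousFunction.norm_coe_le_norm (((op κ a) ^ n) (κ y)) x).trans ?_
  refine (ContinuousLinearMap.le_opNorm _ _).trans ?_
  exact mul_le_mul_of_nonneg_left (κ.norm_coe_le_norm y) (norm_nonneg _)

lemma norm_traceTerm_le (κ : Ker) (a : Fin 2 → ℝ) (n : ℕ) :
    ‖traceSucc (fun x z => κ z x) a n / ((n : ℝ) + 1)‖ ≤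
      ‖(op κ a : Fn ℝ →L[ℝ] Fn ℝ) ^ n‖ * (‖κ‖ * |a 1 - a 0|) := by
  rw [norm_div, traceSucc_eq]
  have h1 : ‖∫ x in (a 0)..(a 1), iter κ a n x x‖ ≤
      (‖(op κ a : Fn ℝ →L[ℝ] Fn ℝ) ^ n‖ * ‖κ‖) * |a 1 - a 0| :=
    intervalIntegral.norm_integral_le_of_norm_le_const fun x _ => abs_iter_le κ a n x x
  have h2 : ‖((n : ℝ) + 1)‖ = (n : ℝ) + 1 := Real.norm_of_nonneg (by positivity)
  rw [h2]
  refine (div_le_self (norm_nonneg _) (by linarith [Nat.cast_nonneg (α := ℝ) n])).trans ?_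
  refine h1.trans (le_of_eq (by ring))

lemma summable_traceTerm {κ : Ker} {a : Fin 2 → ℝ} (h : Good κ a) :
    Summable fun n : ℕ => traceSucc (fun x z => κ z x) a n / ((n : ℝ) + 1) :=
  Summable.of_norm_bounded ((summable_norm_op_pow h).mul_right _) (norm_traceTerm_le κ a)

/-- The logarithm of the Fredholm determinant. -/
def logDet (κ : Ker) (a : Fin 2 → ℝ) : ℝ :=
  -∑' n : ℕ, traceSucc (fun x z => κ z x) a n / ((n : ℝ) + 1)

/-- Termwise differentiation: the derivatives of tr 𝕂^(n+1)/(n+1) are diagonal values of iterated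
kernels, which sum to the resolvent kernel. -/
lemma hasFDerivAt_logDet {κ : Ker} {a : Fin 2 → ℝ} (h : Good κ a) (hs : ∀ x y, κ x y = κ y x) :
    HasFDerivAt (logDet κ) (edgeDeriv fun k => -Rk κ a (a k) (a k)) a := by
  obtain ⟨C, θ, hC, hθ, hθ1, he⟩ := good_bound h
  have he' : ∀ᶠ b in 𝓝 a, ∀ m, ‖(op κ b : Fn ℝ →L[ℝ] Fn ℝ) ^ m‖ ≤ C * θ ^ m :=
    (Continuous.prodMk_right κ).continuousAt.eventually he
  obtain ⟨ε, hε, hball⟩ := Metric.eventually_nhds_iff_ball.1 he'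
  -- The factor 2 counts the two endpoints.
  have hsum : Summable fun n => C * θ ^ n * ‖κ‖ * 2 :=
    (((summable_geometric_of_lt_one hθ hθ1).mul_left C).mul_right _).mul_right _
  have hbd : ∀ n, ∀ b ∈ Metric.ball a ε,
      ‖edgeDeriv fun k => iter κ b n (b k) (b k)‖ ≤ C * θ ^ n * ‖κ‖ * 2 := by
    intro n b hb
    refine ContinuousLinearMap.opNorm_le_bound _ (by positivity) fun v => ?_
    rw [edgeDeriv_apply, Fin.sum_univ_two]
    have e : ∀ k : Fin 2, ‖v k • sgn k • iter κ b n (b k) (b k)‖ ≤ C * θ ^ n * ‖κ‖ * ‖v‖ := by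
      intro k
      rw [norm_smul, norm_smul, Real.norm_eq_abs (sgn k), abs_sgn, one_mul, mul_comm]
      refine mul_le_mul ?_ (norm_le_pi_norm v k) (norm_nonneg _) (by positivity)
      exact (abs_iter_le κ b n _ _).trans
        (mul_le_mul_of_nonneg_right (hball b hb n) (norm_nonneg _))
    refine (norm_add_le _ _).trans ((add_le_add (e 0) (e 1)).trans (le_of_eq (by ring)))
  have hmain := hasFDerivAt_tsum_of_isPreconnected hsum Metric.isOpen_ball
    (convex_ball a ε).isPreconnected
    (fun n b _ => hasFDerivAt_traceSucc hs b n) hbd (Metric.mem_ball_self hε)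
    (summable_traceTerm h) (Metric.mem_ball_self hε)
  refine hmain.neg.congr_fderiv ?_
  ext v
  have hs1 : HasSum (fun n => edgeDeriv (fun k => iter κ a n (a k) (a k)) v)
      (edgeDeriv (fun k => Rk κ a (a k) (a k)) v) := by
    simp only [edgeDeriv_apply, Fin.sum_univ_two, smul_eq_mul]
    exact (((hasSum_Rk h _ _).mul_left _).mul_left _).add (((hasSum_Rk h _ _).mul_left _).mul_left _)
  have hs2 : HasSum (fun n => edgeDeriv (fun k => iter κ a n (a k) (a k)))
      (∑' n, edgeDeriv (fun k => iter κ a n (a k) (a k))) :=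
    (Summable.of_norm_bounded hsum fun n => hbd n a (Metric.mem_ball_self hε)).hasSum
  have hs3 := hs2.mapL (ContinuousLinearMap.apply ℝ ℝ v)
  have e := hs3.unique hs1
  simp only [ContinuousLinearMap.apply_apply] at e
  rw [neg_apply, e]
  simp only [edgeDeriv_apply, Fin.sum_univ_two, smul_eq_mul]
  ring

lemma continuous_integral_endpoints {P : Type*} [TopologicalSpace P] [FirstCountableTopology P]
    {F : P → ℝ → ℝ} (hF : Continuous fun q : P × ℝ => F q.1 q.2) :
    Continuous fun p : P × (Fin 2 → ℝ) => ∫ x in (p.2 0)..(p.2 1), F p.1 x := by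
  have h := intervalIntegral.continuous_parametric_primitive_of_continuous (μ := volume)
    (a₀ := (0 : ℝ)) (f := F) hF
  have h2 : Continuous fun p : P × (Fin 2 → ℝ) =>
      (∫ x in (0 : ℝ)..(p.2 1), F p.1 x) - ∫ x in (0 : ℝ)..(p.2 0), F p.1 x :=
    (h.comp (continuous_fst.prodMk ((continuous_apply 1).comp continuous_snd))).sub
      (h.comp (continuous_fst.prodMk ((continuous_apply 0).comp continuous_snd)))
  refine h2.congr fun p => ?_
  have hp : Continuous (F p.1) := hF.comp (Continuous.prodMk_right p.1)
  exact intervalIntegral.integral_interval_sub_left (hp.intervalIntegrable _ _)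
    (hp.intervalIntegrable _ _)

/-- Joint continuity of the logarithm of the Fredholm determinant. -/
lemma continuousAt_logDet {κ : Ker} {a : Fin 2 → ℝ} (h : Good κ a) :
    ContinuousAt (fun p : Ker × (Fin 2 → ℝ) => logDet p.1 p.2) (κ, a) := by
  obtain ⟨C, θ, hC, hθ, hθ1, he⟩ := good_bound h
  have e1 : ∀ᶠ p : Ker × (Fin 2 → ℝ) in 𝓝 (κ, a), ‖p.1‖ * |p.2 1 - p.2 0| < ‖κ‖ * |a 1 - a 0| + 1 := by
    have : ContinuousAt (fun p : Ker × (Fin 2 → ℝ) => ‖p.1‖ * |p.2 1 - p.2 0|) (κ, a) := by fun_prop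
    exact this.eventually_lt_const (lt_add_one _)
  refine Tendsto.neg ?_
  refine tendsto_tsum_of_dominated_convergence
    (bound := fun n => C * θ ^ n * (‖κ‖ * |a 1 - a 0| + 1))
    (((summable_geometric_of_lt_one hθ hθ1).mul_left C).mul_right _) ?_ ?_
  · intro n
    refine Tendsto.div_const ?_ _
    simp only [traceSucc_eq]
    have h1 : Continuous fun q : (Ker × (Fin 2 → ℝ)) × ℝ =>
        ((op q.1.1 q.1.2 : Fn ℝ →L[ℝ] Fn ℝ) ^ n) (q.1.1 q.2) :=
      ((continuous_op.pow n).comp continuous_fst).clm_apply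
        (continuous_fst.fst.eval continuous_snd)
    exact ((continuous_integral_endpoints (F := fun (p : Ker × (Fin 2 → ℝ)) x => iter p.1 p.2 n x x)
      (h1.eval continuous_snd)).comp (continuous_id.prodMk continuous_snd)).tendsto (κ, a)
  · filter_upwards [he, e1] with p hp hp1 n
    refine (norm_traceTerm_le p.1 p.2 n).trans ?_
    exact mul_le_mul (hp n) hp1.le (by positivity) (by positivity)

end Determinant

end CUEJanossy
end

noncomputable section
namespace CUEJanossy
open MeasureTheory

/-! ### Clamping to a compact interval -/

section Clamp

/-- The retraction of the line onto a compact interval. -/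
def clampMap (M : ℝ) : C(ℝ, Icc (-|M|) |M|) where
  toFun := projIcc _ _ (neg_le_self (abs_nonneg M))
  continuous_toFun := continuous_projIcc

lemma clampMap_coe {M x : ℝ} (hx : |x| ≤ M) : (clampMap M x : ℝ) = x := by
  have hM : |M| = M := abs_of_nonneg ((abs_nonneg x).trans hx)
  have : x ∈ Icc (-|M|) |M| := by rw [hM]; exact abs_le.1 hx
  exact congrArg Subtype.val (projIcc_of_mem (neg_le_self (abs_nonneg M)) this)

variable {E : Type*} [NormedAddCommGroup E]

/-- A continuous function, made bounded by clamping its argument. -/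
def cfn (M : ℝ) (f : C(ℝ, E)) : Fn E :=
  (ContinuousMap.equivBoundedOfCompact (Icc (-|M|) |M|) E
    (f.comp ⟨Subtype.val, continuous_subtype_val⟩)).compContinuous (clampMap M)

lemma cfn_apply (M : ℝ) (f : C(ℝ, E)) (x : ℝ) : cfn M f x = f (clampMap M x) := rfl

lemma cfn_of_le {M x : ℝ} (hx : |x| ≤ M) (f : C(ℝ, E)) : cfn M f x = f x := by
  rw [cfn_apply, clampMap_coe hx]

/-- Clamping turns the compact-open topology into the sup norm, so locally uniform convergence of
kernels and functions becomes norm convergence. -/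
lemma continuous_cfn (M : ℝ) : Continuous (cfn M : C(ℝ, E) → Fn E) := by
  refine (BoundedContinuousFunction.continuous_compContinuous (clampMap M)).comp ?_
  refine (ContinuousMap.isUniformEmbedding_equivBoundedOfCompact _ E).uniformContinuous.continuous.comp
    ?_
  exact ContinuousMap.continuous_precomp _

/-- A continuous kernel, made bounded by clamping its arguments. -/
def clampKer (M : ℝ) (K : C(ℝ × ℝ, ℝ)) : Ker :=
  cfn M ((⟨cfn M, continuous_cfn M⟩ : C(C(ℝ, ℝ), Fn ℝ)).comp (K.comp ContinuousMap.prodSwap).curry)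

lemma clampKer_apply (M : ℝ) (K : C(ℝ × ℝ, ℝ)) (x z : ℝ) :
    clampKer M K z x = K ((clampMap M x : ℝ), (clampMap M z : ℝ)) := rfl

lemma clampKer_of_le {M x z : ℝ} (hx : |x| ≤ M) (hz : |z| ≤ M) (K : C(ℝ × ℝ, ℝ)) :
    clampKer M K z x = K (x, z) := by
  rw [clampKer_apply, clampMap_coe hx, clampMap_coe hz]

lemma continuous_clampKer (M : ℝ) : Continuous (clampKer M) := by
  refine (continuous_cfn M).comp ((ContinuousMap.continuous_postcomp _).comp ?_)
  exact ContinuousMap.continuous_curry.comp (ContinuousMap.continuous_precomp _)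

lemma clampKer_symm {K : C(ℝ × ℝ, ℝ)} (hs : ∀ x y, K (x, y) = K (y, x)) (M x y : ℝ) :
    clampKer M K x y = clampKer M K y x := by
  rw [clampKer_apply, clampKer_apply, hs]

end Clamp

/-! ### The quantities depend only on the values on the interval -/

section Congr

variable {E : Type*} [NormedAddCommGroup E] [NormedSpace ℝ E]

/-- The iterates integrate over I only; the set s may be larger, so that values outside I can also
be compared. -/
lemma kernelIter_congr {K K' : ℝ → ℝ → ℝ} {a : Fin 2 → ℝ} {f f' : ℝ → E} {s : Set ℝ}
    (hs : uIcc (a 0) (a 1) ⊆ s) (hK : ∀ x ∈ s, ∀ z ∈ uIcc (a 0) (a 1), K x z = K' x z)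
    (hf : ∀ x ∈ s, f x = f' x) (n : ℕ) :
    ∀ x ∈ s, kernelIter K a f n x = kernelIter K' a f' n x := by
  induction n with
  | zero => exact hf
  | succ n ih =>
    intro x hx
    refine intervalIntegral.integral_congr fun z hz => ?_
    rw [hK x hx z hz, ih z (hs hz)]

lemma resolvent_congr {K K' : ℝ → ℝ → ℝ} {a : Fin 2 → ℝ} {f f' : ℝ → E} {s : Set ℝ}
    (hs : uIcc (a 0) (a 1) ⊆ s) (hK : ∀ x ∈ s, ∀ z ∈ uIcc (a 0) (a 1), K x z = K' x z)
    (hf : ∀ x ∈ s, f x = f' x) : ∀ x ∈ s, resolvent K a f x = resolvent K' a f' x := by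
  intro x hx
  simp only [resolvent, kernelIter_congr hs hK hf _ x hx]

lemma traceSucc_congr {K K' : ℝ → ℝ → ℝ} {a : Fin 2 → ℝ}
    (hK : ∀ x ∈ uIcc (a 0) (a 1), ∀ z ∈ uIcc (a 0) (a 1), K x z = K' x z) (n : ℕ) :
    traceSucc K a n = traceSucc K' a n := by
  refine intervalIntegral.integral_congr fun x hx => ?_
  exact kernelIter_congr Subset.rfl hK (fun z hz => hK z hz x hx) n x hx

end Congr

/-! ### Contractions -/

section Contraction

/-- The integral operator is a strict contraction of `L²(I)`. -/
def Contractive (K : ℝ → ℝ → ℝ) (a : Fin 2 → ℝ) : Prop :=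
  ∃ r : ℝ, 0 ≤ r ∧ r < 1 ∧ ∀ f : ℝ → ℝ, Continuous f →
    ∫ x in (a 0)..(a 1), (∫ z in (a 0)..(a 1), K x z * f z) ^ 2 ≤ r * ∫ x in (a 0)..(a 1), f x ^ 2

/-- The quadratic polynomial t ↦ ∫ (f + tg)² is nonnegative, so its discriminant is at most zero. -/
lemma sq_integral_mul_le {a b : ℝ} (hab : a ≤ b) {f g : ℝ → ℝ} (hf : Continuous f)
    (hg : Continuous g) :
    (∫ x in a..b, f x * g x) ^ 2 ≤ (∫ x in a..b, f x ^ 2) * ∫ x in a..b, g x ^ 2 := by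
  have h := discrim_le_zero (a := ∫ x in a..b, g x ^ 2) (b := 2 * ∫ x in a..b, f x * g x)
    (c := ∫ x in a..b, f x ^ 2) (fun t => by
      have h0 : 0 ≤ ∫ x in a..b, (f x + t * g x) ^ 2 :=
        intervalIntegral.integral_nonneg hab fun x _ => sq_nonneg _
      have h1 : ∫ x in a..b, (f x + t * g x) ^ 2 =
          (∫ x in a..b, g x ^ 2) * (t * t) + (2 * ∫ x in a..b, f x * g x) * t
            + ∫ x in a..b, f x ^ 2 := by
        rw [show (2 * ∫ x in a..b, f x * g x) * t = ∫ x in a..b, 2 * (f x * g x) * t by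
            rw [intervalIntegral.integral_mul_const, intervalIntegral.integral_const_mul],
          ← intervalIntegral.integral_mul_const, ← intervalIntegral.integral_add,
          ← intervalIntegral.integral_add]
        · congr 1; ext x; ring
        all_goals exact Continuous.intervalIntegrable (by fun_prop) _ _
      rwa [h1] at h0)
  rw [discrim] at h
  nlinarith

/-- n applications of 𝕂 contract the L² norm by √r^n; one further application converts L² into sup
norm by Cauchy–Schwarz. The resulting bound ‖κ‖·l·√r^n, with l the length of I, tends to zero. -/
lemma good_of_contractive {K : C(ℝ × ℝ, ℝ)} {a : Fin 2 → ℝ} (hab : a 0 ≤ a 1)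
    (h : Contractive (fun x z => K (x, z)) a) {M : ℝ} (hM : ∀ j, |a j| ≤ M) :
    Good (clampKer M K) a := by
  obtain ⟨r, hr0, hr1, hr⟩ := h
  set κ := clampKer M K with hκ
  have hI : ∀ x ∈ uIcc (a 0) (a 1), |x| ≤ M := by
    intro x hx
    rw [uIcc_of_le hab] at hx
    have h0 := abs_le.1 (hM 0)
    have h1 := abs_le.1 (hM 1)
    exact abs_le.2 ⟨h0.1.trans hx.1, hx.2.trans h1.2⟩
  have hstep : ∀ f : Fn ℝ, ∫ x in (a 0)..(a 1), (op κ a f x) ^ 2 ≤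
      r * ∫ x in (a 0)..(a 1), f x ^ 2 := by
    intro f
    refine le_trans (le_of_eq ?_) (hr f f.continuous)
    refine intervalIntegral.integral_congr fun x hx => ?_
    simp only [op_apply, smul_eq_mul]
    congr 1
    refine intervalIntegral.integral_congr fun z hz => ?_
    simp only [hκ, clampKer_of_le (hI x hx) (hI z hz)]
  have hpow : ∀ (n : ℕ) (f : Fn ℝ), ∫ x in (a 0)..(a 1), (((op κ a) ^ n) f x) ^ 2 ≤
      r ^ n * ∫ x in (a 0)..(a 1), f x ^ 2 := by
    intro n f
    induction n with
    | zero => simp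
    | succ n ih =>
      rw [pow_succ', mul_apply_eq_comp]
      refine (hstep _).trans ?_
      rw [pow_succ', mul_assoc]
      exact mul_le_mul_of_nonneg_left ih hr0
  set l := a 1 - a 0 with hl
  have hl0 : 0 ≤ l := sub_nonneg.2 hab
  have hsq : ∀ f : Fn ℝ, ∫ x in (a 0)..(a 1), f x ^ 2 ≤ ‖f‖ ^ 2 * l := by
    intro f
    have := intervalIntegral.integral_mono_on hab
      ((by fun_prop : Continuous fun x => f x ^ 2).intervalIntegrable (μ := volume) _ _)
      (continuous_const.intervalIntegrable (a 0) (a 1) : IntervalIntegrable (fun _ => ‖f‖ ^ 2) volume _ _)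
      (fun x _ => by
        rw [← sq_abs]
        exact pow_le_pow_left₀ (abs_nonneg _) (f.norm_coe_le_norm x) 2)
    refine this.trans (le_of_eq ?_)
    rw [intervalIntegral.integral_const, smul_eq_mul, mul_comm]
  have hbound : ∀ (n : ℕ) (f : Fn ℝ), ‖((op κ a) ^ (n + 1)) f‖ ≤
      (‖κ‖ * l * Real.sqrt r ^ n) * ‖f‖ := by
    intro n f
    refine (BoundedContinuousFunction.norm_le (by positivity)).2 fun x => ?_
    rw [pow_succ', mul_apply_eq_comp, op_apply]
    refine abs_le_of_sq_le_sq ?_ (by positivity)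
    have hc : Continuous fun z => κ z x := κ.continuous.eval_const x
    refine (sq_integral_mul_le hab hc (((op κ a) ^ n) f).continuous).trans ?_
    have hk : ∫ z in (a 0)..(a 1), κ z x ^ 2 ≤ ‖κ‖ ^ 2 * l := by
      have := intervalIntegral.integral_mono_on hab
        ((by fun_prop : Continuous fun z => κ z x ^ 2).intervalIntegrable (μ := volume) _ _)
        (continuous_const.intervalIntegrable (a 0) (a 1) :
          IntervalIntegrable (fun _ => ‖κ‖ ^ 2) volume _ _)
        (fun z _ => by
          rw [← sq_abs]
          exact pow_le_pow_left₀ (abs_nonneg _)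
            (((κ z).norm_coe_le_norm x).trans (κ.norm_coe_le_norm z)) 2)
      refine this.trans (le_of_eq ?_)
      rw [intervalIntegral.integral_const, smul_eq_mul, mul_comm]
    have h2 := (hpow n f).trans (mul_le_mul_of_nonneg_left (hsq f) (pow_nonneg hr0 n))
    have h3 : (Real.sqrt r ^ n) ^ 2 = r ^ n := by
      rw [← pow_mul, mul_comm, pow_mul, Real.sq_sqrt hr0]
    calc _ ≤ (‖κ‖ ^ 2 * l) * (r ^ n * (‖f‖ ^ 2 * l)) :=
          mul_le_mul hk h2 (intervalIntegral.integral_nonneg hab fun _ _ => sq_nonneg _)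
            (by positivity)
      _ = (‖κ‖ * l * Real.sqrt r ^ n * ‖f‖) ^ 2 := by
          rw [mul_pow, mul_pow, h3]; ring
  have hlim : Tendsto (fun n : ℕ => ‖κ‖ * l * Real.sqrt r ^ n) atTop (𝓝 (‖κ‖ * l * 0)) :=
    (tendsto_pow_atTop_nhds_zero_of_lt_one (Real.sqrt_nonneg r)
      ((Real.sqrt_lt' one_pos).2 (by simpa using hr1))).const_mul _
  rw [mul_zero] at hlim
  obtain ⟨n, hn⟩ := (hlim.eventually_lt_const one_pos).exists
  refine ⟨n + 1, lt_of_le_of_lt ?_ hn⟩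
  exact ContinuousLinearMap.opNorm_le_bound _ (by positivity) (hbound n)

end Contraction

end CUEJanossy
end

noncomputable section
namespace CUEJanossy
open MeasureTheory

/-! ### Continuous kernels on the plane -/

/-- A continuous function on the plane, as a kernel. -/
abbrev ker (K : C(ℝ × ℝ, ℝ)) (x z : ℝ) : ℝ := K (x, z)

/-- The column `K(·,y)` of a kernel. -/
def col (K : C(ℝ × ℝ, ℝ)) (y : ℝ) : C(ℝ, ℝ) := ⟨fun z => K (z, y), by fun_prop⟩

@[simp] lemma col_apply (K : C(ℝ × ℝ, ℝ)) (y z : ℝ) : col K y z = K (z, y) := rfl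

lemma cfn_col {M y : ℝ} (hy : |y| ≤ M) (K : C(ℝ × ℝ, ℝ)) : cfn M (col K y) = clampKer M K y := by
  ext x
  rw [cfn_apply, clampKer_apply, clampMap_coe hy, col_apply]

lemma uIcc_subset_abs_le {a : Fin 2 → ℝ} {M : ℝ} (hM : ∀ j, |a j| ≤ M) :
    uIcc (a 0) (a 1) ⊆ {x | |x| ≤ M} := by
  intro x hx
  have h0 := abs_le.1 (hM 0)
  have h1 := abs_le.1 (hM 1)
  rw [mem_uIcc] at hx
  rw [Set.mem_ofPred_eq, abs_le]
  rcases hx with hx | hx <;> constructor <;> linarith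

/-- The strict inequalities keep the endpoints and the point inside the clamping range under small
perturbations, so local statements for clamped data transfer to the original ones. -/
lemma exists_radius (a : Fin 2 → ℝ) (x : ℝ) : ∃ M : ℝ, (∀ j, |a j| < M) ∧ |x| < M := by
  have h0 := abs_nonneg (a 0)
  have h1 := abs_nonneg (a 1)
  have h2 := abs_nonneg x
  refine ⟨|a 0| + |a 1| + |x| + 1, fun j => ?_, ?_⟩
  · fin_cases j
    · simp only [Fin.zero_eta]; linarith
    · simp only [Fin.mk_one]; linarith
  · linarith

section Raw

variable {E : Type*} [NormedAddCommGroup E] [NormedSpace ℝ E] [CompleteSpace E]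

lemma kernelIter_clamp {K : C(ℝ × ℝ, ℝ)} {a : Fin 2 → ℝ} {M x : ℝ} (hM : ∀ j, |a j| ≤ M)
    (hx : |x| ≤ M) (f : C(ℝ, E)) (n : ℕ) :
    kernelIter (ker K) a f n x = ((op (clampKer M K) a) ^ n) (cfn M f) x := by
  rw [← kernelIter_eq]
  exact kernelIter_congr (uIcc_subset_abs_le hM)
    (fun x hx z hz => (clampKer_of_le hx (uIcc_subset_abs_le hM hz) K).symm)
    (fun x hx => (cfn_of_le hx f).symm) n x hx

lemma resolvent_clamp {K : C(ℝ × ℝ, ℝ)} {a : Fin 2 → ℝ} {M x : ℝ} (hM : ∀ j, |a j| ≤ M)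
    (hg : Good (clampKer M K) a) (hx : |x| ≤ M) (f : C(ℝ, E)) :
    resolvent (ker K) a f x = res (clampKer M K) a (cfn M f) x := by
  rw [← resolvent_eq hg, resolvent, resolvent]
  simp only [kernelIter_clamp hM hx, kernelIter_eq]

lemma fredholmDet_clamp {K : C(ℝ × ℝ, ℝ)} {a : Fin 2 → ℝ} {M : ℝ} (hM : ∀ j, |a j| ≤ M) :
    fredholmDet (ker K) a = Real.exp (logDet (clampKer M K) a) := by
  have hs := uIcc_subset_abs_le hM
  rw [fredholmDet, logDet]
  simp only [traceSucc_congr (K := ker K) (K' := fun x z => clampKer M K z x)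
    (fun x hx z hz => (clampKer_of_le (hs hx) (hs hz) K).symm)]

variable {K : C(ℝ × ℝ, ℝ)} {a : Fin 2 → ℝ}

lemma summable_kernelIter (hab : a 0 ≤ a 1) (hc : Contractive (ker K) a) (f : C(ℝ, E)) (x : ℝ) :
    Summable fun n => kernelIter (ker K) a f n x := by
  obtain ⟨M, hM, hx⟩ := exists_radius a x
  have hM' := fun j => (hM j).le
  simp only [kernelIter_clamp hM' hx.le]
  exact (hasSum_res (good_of_contractive hab hc hM') (cfn M f) x).summable

lemma summable_traceSucc (hab : a 0 ≤ a 1) (hc : Contractive (ker K) a) :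
    Summable fun n : ℕ => traceSucc (ker K) a n / ((n : ℝ) + 1) := by
  obtain ⟨M, hM, -⟩ := exists_radius a 0
  have hM' := fun j => (hM j).le
  have hs := uIcc_subset_abs_le hM'
  simp only [traceSucc_congr (K := ker K) (K' := fun x z => clampKer M K z x)
    (fun x hx z hz => (clampKer_of_le (hs hx) (hs hz) K).symm)]
  exact summable_traceTerm (good_of_contractive hab hc hM')

lemma resolvent_sub (hab : a 0 ≤ a 1) (hc : Contractive (ker K) a) (f : C(ℝ, E)) (x : ℝ) :
    resolvent (ker K) a f x - (∫ z in (a 0)..(a 1), K (x, z) • resolvent (ker K) a f z) = f x := by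
  obtain ⟨M, hM, hx⟩ := exists_radius a x
  have hM' := fun j => (hM j).le
  have hg := good_of_contractive hab hc hM'
  have h := congrArg (fun g : Fn E => g x) (res_sub_op hg (cfn M f))
  simp only [BoundedContinuousFunction.sub_apply, op_apply, cfn_of_le hx.le] at h
  rw [← h, resolvent_clamp hM' hg hx.le]
  congr 1
  refine intervalIntegral.integral_congr fun z hz => ?_
  have hz' := uIcc_subset_abs_le hM' hz
  simp only [resolvent_clamp hM' hg hz', clampKer_of_le hx.le hz']

lemma continuous_resolvent (hab : a 0 ≤ a 1) (hc : Contractive (ker K) a) (f : C(ℝ, E)) :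
    Continuous (resolvent (ker K) a f) := by
  refine continuous_iff_continuousAt.2 fun x => ?_
  obtain ⟨M, hM, hx⟩ := exists_radius a x
  have hM' := fun j => (hM j).le
  have hg := good_of_contractive hab hc hM'
  refine ((res (clampKer M K) a (cfn M f)).continuous.continuousAt (x := x)).congr ?_
  filter_upwards [(isOpen_lt continuous_abs continuous_const).mem_nhds hx] with y hy
  exact (resolvent_clamp hM' hg (le_of_lt hy) f).symm

lemma eqOn_resolvent (hab : a 0 ≤ a 1) (hc : Contractive (ker K) a) (f : C(ℝ, E)) {g : ℝ → E}
    (hg : ContinuousOn g (Icc (a 0) (a 1)))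
    (h : ∀ x ∈ Icc (a 0) (a 1), g x - (∫ z in (a 0)..(a 1), K (x, z) • g z) = f x) :
    ∀ x ∈ Icc (a 0) (a 1), g x = resolvent (ker K) a f x := by
  obtain ⟨M, hM, -⟩ := exists_radius a 0
  have hM' := fun j => (hM j).le
  have hgood := good_of_contractive hab hc hM'
  have hI : ∀ x ∈ Icc (a 0) (a 1), |x| ≤ M := fun x hx =>
    uIcc_subset_abs_le hM' (by rwa [uIcc_of_le hab])
  let g' : C(ℝ, E) := ⟨IccExtend hab ((Icc (a 0) (a 1)).domRestrict g),
    (continuousOn_iff_continuous_domRestrict.1 hg).Icc_extend'⟩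
  have hg' : ∀ x ∈ Icc (a 0) (a 1), cfn M g' x = g x := by
    intro x hx
    rw [cfn_of_le (hI x hx)]
    exact IccExtend_of_mem hab ((Icc (a 0) (a 1)).domRestrict g) hx
  set κ := clampKer M K
  -- g is only known on I. The right-hand side f + 𝕂g of its equation is defined everywhere, agrees
  -- with g on I, and solves the equation globally, so uniqueness applies to it.
  let G : Fn E := cfn M f + op κ a (cfn M g')
  have hG : ∀ x ∈ Icc (a 0) (a 1), G x = g x := by
    intro x hx
    have h1 : op κ a (cfn M g') x = ∫ z in (a 0)..(a 1), K (x, z) • g z := by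
      rw [op_apply]
      refine intervalIntegral.integral_congr fun z hz => ?_
      rw [uIcc_of_le hab] at hz
      simp only [hg' z hz, κ, clampKer_of_le (hI x hx) (hI z hz)]
    change cfn M f x + op κ a (cfn M g') x = g x
    rw [h1, cfn_of_le (hI x hx), ← h x hx]
    abel
  have hop : op κ a G = op κ a (cfn M g') := by
    ext x
    rw [op_apply, op_apply]
    refine intervalIntegral.integral_congr fun z hz => ?_
    rw [uIcc_of_le hab] at hz
    simp only [hG z hz, hg' z hz]
  have hfin : G = res κ a (cfn M f) := by
    apply eq_res hgood
    rw [hop]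
    exact add_sub_cancel_right _ _
  intro x hx
  rw [← hG x hx, hfin, resolvent_clamp hM' hgood (hI x hx)]

/-- On I this is `eqOn_resolvent`; elsewhere both functions are determined by f and their values on
I. -/
lemma eq_resolvent (hab : a 0 ≤ a 1) (hc : Contractive (ker K) a) (f : C(ℝ, E)) {g : ℝ → E}
    (hg : Continuous g)
    (h : ∀ x, g x - (∫ z in (a 0)..(a 1), K (x, z) • g z) = f x) (x : ℝ) :
    g x = resolvent (ker K) a f x := by
  have h1 := eqOn_resolvent hab hc f hg.continuousOn fun x _ => h x
  have h2 := resolvent_sub hab hc f x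
  rw [← h x] at h2
  have h3 : ∫ z in (a 0)..(a 1), K (x, z) • g z =
      ∫ z in (a 0)..(a 1), K (x, z) • resolvent (ker K) a f z := by
    refine intervalIntegral.integral_congr fun z hz => ?_
    rw [uIcc_of_le hab] at hz
    simp only [h1 z hz]
  rw [h3] at h2
  exact (sub_left_inj.1 h2).symm

lemma neumannInverts_of_contractive {K' : ℝ → ℝ → ℝ} (hab : a 0 ≤ a 1)
    (hK : ∀ x ∈ Icc (a 0) (a 1), ∀ z ∈ Icc (a 0) (a 1), K' x z = K (x, z))
    (hc : Contractive (ker K) a) : NeumannInverts E K' a := by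
  intro f hf
  let f' : C(ℝ, E) := ⟨IccExtend hab ((Icc (a 0) (a 1)).domRestrict f),
    (continuousOn_iff_continuous_domRestrict.1 hf).Icc_extend'⟩
  have hf' : ∀ x ∈ Icc (a 0) (a 1), f x = f' x :=
    fun x hx => (IccExtend_of_mem hab ((Icc (a 0) (a 1)).domRestrict f) hx).symm
  have hu : uIcc (a 0) (a 1) = Icc (a 0) (a 1) := uIcc_of_le hab
  have hK' : ∀ x ∈ Icc (a 0) (a 1), ∀ z ∈ uIcc (a 0) (a 1), K' x z = ker K x z := by
    rw [hu]; exact hK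
  have hr := resolvent_congr hu.subset hK' hf'
  have hint : ∀ (g : ℝ → E), ∀ x ∈ Icc (a 0) (a 1), ∫ z in (a 0)..(a 1), K' x z • g z =
      ∫ z in (a 0)..(a 1), K (x, z) • g z := by
    intro g x hx
    refine intervalIntegral.integral_congr fun z hz => ?_
    simp only [hK' x hx z hz]
  refine ⟨fun x hx => ?_, ?_, fun g hg => ⟨fun h x hx => ?_, fun h x hx => ?_⟩⟩
  · simp only [kernelIter_congr hu.subset hK' hf' _ x hx]
    exact summable_kernelIter hab hc f' x
  · exact (continuous_resolvent hab hc f').continuousOn.congr hr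
  · rw [hr x hx]
    refine eqOn_resolvent hab hc f' hg (fun y hy => ?_) x hx
    rw [← hint g y hy, h y hy, hf' y hy]
  · rw [hint g x hx, h x hx, hr x hx, hf' x hx, ← resolvent_sub hab hc f' x]
    congr 1
    refine intervalIntegral.integral_congr fun z hz => ?_
    rw [hu] at hz
    simp only [h z hz, hr z hz]

lemma integral_mul_resolvent_col (hab : a 0 ≤ a 1) (hc : Contractive (ker K) a)
    (hs : ∀ x y, K (x, y) = K (y, x)) (f : C(ℝ, ℂ)) (y : ℝ) :
    f y + ∫ x in (a 0)..(a 1), f x * (resolvent (ker K) a (col K y) x : ℝ) =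
      resolvent (ker K) a f y := by
  obtain ⟨M, hM, hy⟩ := exists_radius a y
  have hM' := fun j => (hM j).le
  have hg := good_of_contractive hab hc hM'
  rw [resolvent_clamp hM' hg hy.le, ← integral_mul_Rk hg (clampKer_symm hs M), cfn_of_le hy.le]
  congr 1
  refine intervalIntegral.integral_congr fun z hz => ?_
  have hz' := uIcc_subset_abs_le hM' hz
  simp only [resolvent_clamp hM' hg hz', cfn_col hy.le, cfn_of_le hz']

lemma eventually_abs_lt {M : ℝ} (hM : ∀ j, |a j| < M) : ∀ᶠ b in 𝓝 a, ∀ j, |b j| < M := by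
  rw [eventually_all]
  intro j
  exact (continuous_abs.comp (continuous_apply j)).continuousAt.eventually_lt_const (hM j)

/-- The endpoint a_j plays two roles, as limit of integration and as point of evaluation; the last
summand is the contribution of the second. -/
lemma hasFDerivAt_resolvent (hab : a 0 ≤ a 1) (hc : Contractive (ker K) a) (f : C(ℝ, E))
    (j : Fin 2) {e : E} (he : HasDerivAt (resolvent (ker K) a f) e (a j)) :
    HasFDerivAt (fun b => resolvent (ker K) b f (b j))
      (edgeDeriv (fun k => resolvent (ker K) a (col K (a k)) (a j) • resolvent (ker K) a f (a k))
        + (coordL j).smulRight e) a := by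
  obtain ⟨M, hM, -⟩ := exists_radius a 0
  have hM' := fun j => (hM j).le
  have hg := good_of_contractive hab hc hM'
  have he' : HasDerivAt (res (clampKer M K) a (cfn M f)) e (a j) := by
    refine he.congr_of_eventuallyEq ?_
    filter_upwards [(isOpen_lt continuous_abs continuous_const).mem_nhds (hM j)] with y hy
    exact (resolvent_clamp hM' hg (le_of_lt hy) f).symm
  have h := hasFDerivAt_eval (hasFDerivAt_res hg (cfn M f)) j he'
  have h2 := by
    refine h.congr_of_eventuallyEq (f₁ := fun b => resolvent (ker K) b f (b j)) ?_
    filter_upwards [eventually_good hg, eventually_abs_lt hM] with b hb hbM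
    exact resolvent_clamp (fun j => (hbM j).le) hb (hbM j).le f
  refine h2.congr_fderiv ?_
  congr 2
  ext k
  rw [resolvent_clamp hM' hg (hM' j), resolvent_clamp hM' hg (hM' k), cfn_col (hM' k),
    tensor_apply]

lemma hasFDerivAt_integral_resolvent (hab : a 0 ≤ a 1) (hc : Contractive (ker K) a)
    (hs : ∀ x y, K (x, y) = K (y, x)) (f g : C(ℝ, ℂ)) :
    HasFDerivAt (fun b => ∫ x in (b 0)..(b 1), f x * resolvent (ker K) b g x)
      (edgeDeriv fun k => resolvent (ker K) a f (a k) * resolvent (ker K) a g (a k)) a := by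
  obtain ⟨M, hM, -⟩ := exists_radius a 0
  have hM' := fun j => (hM j).le
  have hg := good_of_contractive hab hc hM'
  have h := hasFDerivAt_bilinear hg (clampKer_symm hs M) (cfn M f) (cfn M g)
  have h2 := by
    refine h.congr_of_eventuallyEq (f₁ := fun b => ∫ x in (b 0)..(b 1), f x * resolvent (ker K) b g x) ?_
    filter_upwards [eventually_good hg, eventually_abs_lt hM] with b hb hbM
    refine intervalIntegral.integral_congr fun z hz => ?_
    have hz' := uIcc_subset_abs_le (fun j => (hbM j).le) hz
    simp only [resolvent_clamp (fun j => (hbM j).le) hb hz', cfn_of_le hz']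
  refine h2.congr_fderiv ?_
  congr 1
  ext k
  rw [resolvent_clamp hM' hg (hM' k), resolvent_clamp hM' hg (hM' k)]

lemma hasFDerivAt_log_fredholmDet (hab : a 0 ≤ a 1) (hc : Contractive (ker K) a)
    (hs : ∀ x y, K (x, y) = K (y, x)) :
    HasFDerivAt (fun b => Real.log (fredholmDet (ker K) b))
      (edgeDeriv fun k => -resolvent (ker K) a (col K (a k)) (a k)) a := by
  obtain ⟨M, hM, -⟩ := exists_radius a 0
  have hM' := fun j => (hM j).le
  have hg := good_of_contractive hab hc hM'
  have h := hasFDerivAt_logDet hg (clampKer_symm hs M)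
  have h2 := by
    refine h.congr_of_eventuallyEq (f₁ := fun b => Real.log (fredholmDet (ker K) b)) ?_
    filter_upwards [eventually_abs_lt hM] with b hbM
    rw [fredholmDet_clamp (fun j => (hbM j).le), Real.log_exp]
  refine h2.congr_fderiv ?_
  congr 1
  ext k
  rw [resolvent_clamp hM' hg (hM' k), cfn_col (hM' k)]
  rfl

lemma fredholmDet_pos (K : ℝ → ℝ → ℝ) (a : Fin 2 → ℝ) : 0 < fredholmDet K a := Real.exp_pos _

lemma hasFDerivAt_fredholmDet (hab : a 0 ≤ a 1) (hc : Contractive (ker K) a)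
    (hs : ∀ x y, K (x, y) = K (y, x)) :
    DifferentiableAt ℝ (fredholmDet (ker K)) a := by
  have h := (hasFDerivAt_log_fredholmDet hab hc hs).exp.differentiableAt
  simp only [Real.exp_log (fredholmDet_pos _ _)] at h
  exact h

end Raw


end CUEJanossy
end

noncomputable section
namespace CUEJanossy
open MeasureTheory

/-! ### Joint continuity -/

section Continuity

variable {E : Type*} [NormedAddCommGroup E] [NormedSpace ℝ E] [CompleteSpace E]
  {ι : Type*} {l : Filter ι} {Ks : ι → C(ℝ × ℝ, ℝ)} {K : C(ℝ × ℝ, ℝ)}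
  {b : ι → Fin 2 → ℝ} {a : Fin 2 → ℝ}

/-- Common start of the convergence proofs: one clamping radius serves the limit and, eventually,
all members of the family. -/
lemma tendsto_clamp_good (hab : a 0 ≤ a 1) (hc : Contractive (ker K) a)
    (hK : Tendsto Ks l (𝓝 K)) (hb : Tendsto b l (𝓝 a)) {M : ℝ} (hM : ∀ j, |a j| < M) :
    Tendsto (fun i => (clampKer M (Ks i), b i)) l (𝓝 (clampKer M K, a)) ∧
    ∀ᶠ i in l, Good (clampKer M (Ks i)) (b i) ∧ ∀ j, |b i j| < M := by
  have h1 : Tendsto (fun i => (clampKer M (Ks i), b i)) l (𝓝 (clampKer M K, a)) :=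
    (((continuous_clampKer M).tendsto K).comp hK).prodMk_nhds hb
  have hg := good_of_contractive hab hc fun j => (hM j).le
  exact ⟨h1, (h1.eventually (isOpen_good.mem_nhds hg)).and
    (hb.eventually (eventually_abs_lt hM))⟩

lemma tendsto_res {κ : Ker} (hg : Good κ a) {p : ι → Ker × (Fin 2 → ℝ)}
    (hp : Tendsto p l (𝓝 (κ, a))) :
    Tendsto (fun i => (res (p i).1 (p i).2 : Fn E →L[ℝ] Fn E)) l (𝓝 (res κ a)) :=
  Tendsto.comp (g := fun p : Ker × (Fin 2 → ℝ) => (res p.1 p.2 : Fn E →L[ℝ] Fn E))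
    (continuousAt_res hg) hp

lemma tendsto_clm_apply {X Y : Type*} [NormedAddCommGroup X] [NormedSpace ℝ X]
    [NormedAddCommGroup Y] [NormedSpace ℝ Y] {Ls : ι → X →L[ℝ] Y} {L : X →L[ℝ] Y} {fs : ι → X}
    {f : X} (hL : Tendsto Ls l (𝓝 L)) (hf : Tendsto fs l (𝓝 f)) :
    Tendsto (fun i => Ls i (fs i)) l (𝓝 (L f)) :=
  ((isBoundedBilinearMap_apply (𝕜 := ℝ) (E := X) (F := Y)).continuous.tendsto (L, f)).comp
    (hL.prodMk_nhds hf)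

omit [NormedSpace ℝ E] [CompleteSpace E] in
lemma tendsto_fn_eval {fs : ι → Fn E} {f : Fn E} (hf : Tendsto fs l (𝓝 f)) {xs : ι → ℝ} {x : ℝ}
    (hx : Tendsto xs l (𝓝 x)) : Tendsto (fun i => fs i (xs i)) l (𝓝 (f x)) :=
  ((continuous_eval (F := Fn E)).tendsto (f, x)).comp (hf.prodMk_nhds hx)

lemma tendsto_resolvent (hab : a 0 ≤ a 1) (hc : Contractive (ker K) a)
    (hK : Tendsto Ks l (𝓝 K)) (hb : Tendsto b l (𝓝 a)) {fs : ι → C(ℝ, E)} {f : C(ℝ, E)}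
    (hf : Tendsto fs l (𝓝 f)) {xs : ι → ℝ} {x : ℝ} (hx : Tendsto xs l (𝓝 x)) :
    Tendsto (fun i => resolvent (ker (Ks i)) (b i) (fs i) (xs i)) l
      (𝓝 (resolvent (ker K) a f x)) := by
  obtain ⟨M, hM, hxM⟩ := exists_radius a x
  have hM' := fun j => (hM j).le
  have hg := good_of_contractive hab hc hM'
  obtain ⟨h1, h2⟩ := tendsto_clamp_good hab hc hK hb hM
  have h3 := tendsto_res (E := E) hg h1
  have h4 : Tendsto (fun i => cfn M (fs i)) l (𝓝 (cfn M f)) :=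
    ((continuous_cfn M).tendsto f).comp hf
  have h5 : Tendsto (fun i => res (clampKer M (Ks i)) (b i) (cfn M (fs i)) (xs i)) l
      (𝓝 (res (clampKer M K) a (cfn M f) x)) := tendsto_fn_eval (tendsto_clm_apply h3 h4) hx
  rw [resolvent_clamp hM' hg hxM.le]
  refine h5.congr' ?_
  filter_upwards [h2, hx.eventually ((isOpen_lt continuous_abs continuous_const).mem_nhds hxM)]
    with i hi hxi
  exact (resolvent_clamp (fun j => (hi.2 j).le) hi.1 (le_of_lt hxi) _).symm

lemma tendsto_integral_resolvent (hab : a 0 ≤ a 1) (hc : Contractive (ker K) a)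
    (hK : Tendsto Ks l (𝓝 K)) (hb : Tendsto b l (𝓝 a)) {fs gs : ι → C(ℝ, ℂ)} {f g : C(ℝ, ℂ)}
    (hf : Tendsto fs l (𝓝 f)) (hgs : Tendsto gs l (𝓝 g)) :
    Tendsto (fun i => ∫ x in (b i 0)..(b i 1), fs i x * resolvent (ker (Ks i)) (b i) (gs i) x) l
      (𝓝 (∫ x in (a 0)..(a 1), f x * resolvent (ker K) a g x)) := by
  obtain ⟨M, hM, -⟩ := exists_radius a 0
  have hM' := fun j => (hM j).le
  have hg := good_of_contractive hab hc hM'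
  obtain ⟨h1, h2⟩ := tendsto_clamp_good hab hc hK hb hM
  have h3 := tendsto_res (E := ℂ) hg h1
  have h4 : ∀ {hs : ι → C(ℝ, ℂ)} {h : C(ℝ, ℂ)}, Tendsto hs l (𝓝 h) →
      Tendsto (fun i => cfn M (hs i)) l (𝓝 (cfn M h)) :=
    fun hh => ((continuous_cfn M).tendsto _).comp hh
  have h5 := (h4 hf).mul (tendsto_clm_apply h3 (h4 hgs))
  have h6 := ((continuous_intL (E := ℂ)).tendsto a).comp hb
  have h7 := tendsto_clm_apply h6 h5
  have hlim : ∫ x in (a 0)..(a 1), f x * resolvent (ker K) a g x =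
      intL a (cfn M f * res (clampKer M K) a (cfn M g)) := by
    rw [intL_apply]
    refine intervalIntegral.integral_congr fun z hz => ?_
    have hz' := uIcc_subset_abs_le hM' hz
    simp only [resolvent_clamp hM' hg hz', cfn_of_le hz', BoundedContinuousFunction.mul_apply]
  rw [hlim]
  refine h7.congr' ?_
  filter_upwards [h2] with i hi
  simp only [Function.comp_apply, intL_apply]
  refine intervalIntegral.integral_congr fun z hz => ?_
  have hz' := uIcc_subset_abs_le (fun j => (hi.2 j).le) hz
  simp only [resolvent_clamp (fun j => (hi.2 j).le) hi.1 hz', cfn_of_le hz',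
    BoundedContinuousFunction.mul_apply]

lemma tendsto_fredholmDet (hab : a 0 ≤ a 1) (hc : Contractive (ker K) a)
    (hK : Tendsto Ks l (𝓝 K)) (hb : Tendsto b l (𝓝 a)) :
    Tendsto (fun i => fredholmDet (ker (Ks i)) (b i)) l (𝓝 (fredholmDet (ker K) a)) := by
  obtain ⟨M, hM, -⟩ := exists_radius a 0
  have hM' := fun j => (hM j).le
  have hg := good_of_contractive hab hc hM'
  obtain ⟨h1, h2⟩ := tendsto_clamp_good hab hc hK hb hM
  rw [fredholmDet_clamp hM']
  refine ((Real.continuous_exp.tendsto _).comp ((continuousAt_logDet hg).tendsto.comp h1)).congr' ?_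
  filter_upwards [h2] with i hi
  exact (fredholmDet_clamp fun j => (hi.2 j).le).symm

lemma tendsto_col {ys : ι → ℝ} {y : ℝ} (hK : Tendsto Ks l (𝓝 K)) (hy : Tendsto ys l (𝓝 y)) :
    Tendsto (fun i => col (Ks i) (ys i)) l (𝓝 (col K y)) := by
  have h : Continuous fun p : C(ℝ × ℝ, ℝ) × ℝ => (p.1.comp ContinuousMap.prodSwap).curry p.2 :=
    (ContinuousMap.continuous_curry.comp
      ((ContinuousMap.continuous_precomp _).comp continuous_fst)).eval continuous_snd
  exact (h.tendsto (K, y)).comp (hK.prodMk_nhds hy)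

end Continuity

end CUEJanossy
end

noncomputable section
namespace CUEJanossy
open MeasureTheory

/-! ### Integrals depending on a parameter -/

/-- On a closed ball of radius one times the interval F' is bounded by compactness, which supplies
the dominating constant. Real parameters are used for spatial derivatives, complex ones for entire
extensions. -/
lemma hasDerivAt_integral_of_continuous {𝕜 E : Type*} [RCLike 𝕜] [NormedAddCommGroup E]
    [NormedSpace ℝ E] [NormedSpace 𝕜 E] {F F' : 𝕜 → ℝ → E}
    (hF : Continuous fun p : 𝕜 × ℝ => F p.1 p.2) (hF' : Continuous fun p : 𝕜 × ℝ => F' p.1 p.2)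
    (h : ∀ x z, HasDerivAt (fun s => F s z) (F' x z) x) (a b : ℝ) (x : 𝕜) :
    HasDerivAt (fun s => ∫ z in a..b, F s z) (∫ z in a..b, F' x z) x := by
  have hcomp : IsCompact (Metric.closedBall x 1 ×ˢ uIcc a b) :=
    (isCompact_closedBall x 1).prod isCompact_uIcc
  obtain ⟨C, hC⟩ := hcomp.exists_bound_of_continuousOn hF'.continuousOn
  have h1 : ∀ y, Continuous (F y) := fun y => hF.comp (Continuous.prodMk_right y)
  have h2 : ∀ y, Continuous (F' y) := fun y => hF'.comp (Continuous.prodMk_right y)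
  refine (intervalIntegral.hasDerivAt_integral_of_dominated_loc_of_deriv_le (bound := fun _ => C)
    (Metric.closedBall_mem_nhds x one_pos)
    (Eventually.of_forall fun y => (h1 y).aestronglyMeasurable)
    ((h1 x).intervalIntegrable _ _) (h2 x).aestronglyMeasurable ?_ (by simp)
    (ae_of_all _ fun z _ y _ => h y z)).2
  exact ae_of_all _ fun z hz y hy => hC (y, z) ⟨hy, uIoc_subset_uIcc hz⟩

lemma integral_integral_swap_of_continuous {E : Type*} [NormedAddCommGroup E]
    [NormedSpace ℝ E] {F : ℝ → ℝ → E} (hF : Continuous fun p : ℝ × ℝ => F p.1 p.2) (a b c d : ℝ) :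
    ∫ x in a..b, ∫ y in c..d, F x y = ∫ y in c..d, ∫ x in a..b, F x y := by
  have hint : Integrable (Function.uncurry F)
      ((volume.restrict (uIoc a b)).prod (volume.restrict (uIoc c d))) := by
    rw [Measure.prod_restrict]
    exact (hF.continuousOn.integrableOn_compact (isCompact_uIcc.prod isCompact_uIcc)).mono_set
      (prod_mono uIoc_subset_uIcc uIoc_subset_uIcc)
  simp only [intervalIntegral.intervalIntegral_eq_integral_uIoc, integral_smul]
  rw [MeasureTheory.integral_integral_swap hint, smul_comm]

/-! ### Integrable kernels -/

/-- Integration over the interval, as a linear functional on continuous functions. -/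
def integ (a : Fin 2 → ℝ) : C(ℝ, ℂ) →ₗ[ℂ] ℂ where
  toFun f := ∫ z in (a 0)..(a 1), f z
  map_add' f g := by
    rw [← intervalIntegral.integral_add (f.continuous.intervalIntegrable _ _)
      (g.continuous.intervalIntegrable _ _)]
    rfl
  map_smul' c f := by
    rw [RingHom.id_apply, smul_eq_mul, ← intervalIntegral.integral_const_mul]
    rfl

lemma integ_apply (a : Fin 2 → ℝ) (f : C(ℝ, ℂ)) : integ a f = ∫ z in (a 0)..(a 1), f z := rfl

/-- The row `K(x,·)` of a kernel. -/
def row (K : C(ℝ × ℝ, ℝ)) (x : ℝ) : C(ℝ, ℂ) := ⟨fun z => (K (x, z) : ℂ), by fun_prop⟩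

@[simp] lemma row_apply (K : C(ℝ × ℝ, ℝ)) (x z : ℝ) : row K x z = K (x, z) := rfl

lemma integ_row (K : C(ℝ × ℝ, ℝ)) (a : Fin 2 → ℝ) (x : ℝ) (f : C(ℝ, ℂ)) :
    integ a (row K x * f) = ∫ z in (a 0)..(a 1), K (x, z) • f z := by
  rw [integ_apply]
  congr 1

/-- A symmetric kernel of integrable form, `(e(x) - e(y)) K(x,y) = φ(x)ψ(y) - ψ(x)φ(y)`,
together with a derivation `m d/dx` under which `K`, `φ`, `ψ` transform by constants. -/
structure IntegrableKernel where
  K : C(ℝ × ℝ, ℝ)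
  K₁ : C(ℝ × ℝ, ℝ)
  φ : C(ℝ, ℂ)
  ψ : C(ℝ, ℂ)
  φ' : C(ℝ, ℂ)
  ψ' : C(ℝ, ℂ)
  e : C(ℝ, ℂ)
  e' : C(ℝ, ℂ)
  m : C(ℝ, ℂ)
  m' : C(ℝ, ℂ)
  α : ℂ
  β : ℂ
  c₀ : ℂ
  c₁ : ℂ
  c₂ : ℂ
  d₀ : ℂ
  d₁ : ℂ
  d₂ : ℂ
  symm : ∀ x y, K (x, y) = K (y, x)
  hasDeriv_K : ∀ x y, HasDerivAt (fun s => K (s, y)) (K₁ (x, y)) x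
  hasDeriv_φ : ∀ x, HasDerivAt φ (φ' x) x
  hasDeriv_ψ : ∀ x, HasDerivAt ψ (ψ' x) x
  hasDeriv_e : ∀ x, HasDerivAt e (e' x) x
  hasDeriv_m : ∀ x, HasDerivAt m (m' x) x
  commutator : ∀ x y, (e x - e y) * K (x, y) = φ x * ψ y - ψ x * φ y
  -- By symmetry K₁(y,x) = ∂K(x,y)/∂y, so the left side is m(x)∂_xK + ∂_y(m(y)K): the kernel of the
  -- commutator of m d/dx with 𝕂, apart from boundary terms.
  dilation : ∀ x y, m x * K₁ (x, y) + m' y * K (x, y) + m y * K₁ (y, x) =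
    α * φ x * ψ y + β * ψ x * φ y
  deriv_φ : ∀ x, m x * φ' x = c₀ * φ x + c₁ * e x * φ x + c₂ * ψ x
  deriv_ψ : ∀ x, m x * ψ' x = d₀ * ψ x + d₁ * e x * ψ x + d₂ * φ x

/-! ### Identities for the resolvent functions and the uniqueness principle -/

section Resolvents

variable {K : C(ℝ × ℝ, ℝ)} {a : Fin 2 → ℝ}

/-- The function `(𝕀 - 𝕂)⁻¹ f`, bundled as a continuous function. -/
def rs (hab : a 0 ≤ a 1) (hc : Contractive (ker K) a) (f : C(ℝ, ℂ)) : C(ℝ, ℂ) :=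
  ⟨resolvent (ker K) a f, continuous_resolvent hab hc f⟩

lemma rs_apply (hab : a 0 ≤ a 1) (hc : Contractive (ker K) a) (f : C(ℝ, ℂ)) (x : ℝ) :
    rs hab hc f x = resolvent (ker K) a f x := rfl

lemma integ_row_rs (hab : a 0 ≤ a 1) (hc : Contractive (ker K) a) (f : C(ℝ, ℂ)) (x : ℝ) :
    integ a (row K x * rs hab hc f) = rs hab hc f x - f x := by
  rw [integ_row, rs_apply, ← resolvent_sub hab hc f x, sub_sub_cancel]
  rfl

/-- The resolvent kernel `R(·,y)`, as a complex continuous function. -/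
def rcol (hab : a 0 ≤ a 1) (hc : Contractive (ker K) a) (y : ℝ) : C(ℝ, ℂ) :=
  ⟨fun x => ((resolvent (ker K) a (col K y) x : ℝ) : ℂ),
    Complex.continuous_ofReal.comp (continuous_resolvent hab hc (col K y))⟩

lemma rcol_apply (hab : a 0 ≤ a 1) (hc : Contractive (ker K) a) (x y : ℝ) :
    rcol hab hc y x = ((resolvent (ker K) a (col K y) x : ℝ) : ℂ) := rfl

lemma integ_row_rcol (hab : a 0 ≤ a 1) (hc : Contractive (ker K) a) (x y : ℝ) :
    integ a (row K x * rcol hab hc y) = rcol hab hc y x - K (x, y) := by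
  have h := congrArg (fun t : ℝ => (t : ℂ)) (resolvent_sub hab hc (col K y) x)
  simp only [Complex.ofReal_sub, ← intervalIntegral.integral_ofReal, col_apply] at h
  rw [integ_row, rcol_apply, ← h, sub_sub_cancel]
  refine intervalIntegral.integral_congr fun z _ => ?_
  simp [rcol_apply]

lemma integ_mul_rcol (hab : a 0 ≤ a 1) (hc : Contractive (ker K) a)
    (hs : ∀ x y, K (x, y) = K (y, x)) (f : C(ℝ, ℂ)) (y : ℝ) :
    integ a (f * rcol hab hc y) = rs hab hc f y - f y := by
  rw [rs_apply, ← integral_mul_resolvent_col hab hc hs f y, add_sub_cancel_left]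
  rfl

/-- 𝕀 - 𝕂 is injective. Identities between resolvent functions are proved by checking that the
difference of their sides is fixed by 𝕂. -/
lemma eq_zero_of_fixed (hab : a 0 ≤ a 1) (hc : Contractive (ker K) a) (g : C(ℝ, ℂ))
    (h : ∀ x, integ a (row K x * g) = g x) (x : ℝ) : g x = 0 := by
  have h1 := eq_resolvent hab hc (0 : C(ℝ, ℂ)) g.continuous
    (fun y => by rw [← integ_row, h y, sub_self]; rfl) x
  have h2 := eq_resolvent hab hc (0 : C(ℝ, ℂ)) (g := fun _ => (0 : ℂ)) continuous_const
    (fun y => by simp) x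
  rw [h1, ← h2]

/-- (𝕀-𝕂)⁻¹ is symmetric since 𝕂 is: substitute f = F - 𝕂F and g = G - 𝕂G and exchange the order of
integration. This identifies the two possible definitions of v. -/
lemma integ_mul_rs_comm (hab : a 0 ≤ a 1) (hc : Contractive (ker K) a)
    (hs : ∀ x y, K (x, y) = K (y, x)) (f g : C(ℝ, ℂ)) :
    integ a (f * rs hab hc g) = integ a (g * rs hab hc f) := by
  set F := rs hab hc f with hF
  set G := rs hab hc g with hG
  have h1 : ∀ x, f x = F x - ∫ z in (a 0)..(a 1), K (x, z) • F z := fun x =>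
    (resolvent_sub hab hc f x).symm
  have h2 : ∀ x, g x = G x - ∫ z in (a 0)..(a 1), K (x, z) • G z := fun x =>
    (resolvent_sub hab hc g x).symm
  have hcF : ∀ H : C(ℝ, ℂ), Continuous fun x => ∫ z in (a 0)..(a 1), K (x, z) • H z := fun H =>
    intervalIntegral.continuous_parametric_intervalIntegral_of_continuous' (by fun_prop) _ _
  have key : ∫ x in (a 0)..(a 1), (∫ z in (a 0)..(a 1), K (x, z) • F z) * G x =
      ∫ x in (a 0)..(a 1), (∫ z in (a 0)..(a 1), K (x, z) • G z) * F x := by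
    simp only [← intervalIntegral.integral_mul_const]
    rw [integral_integral_swap_of_continuous (by fun_prop)]
    refine intervalIntegral.integral_congr fun z _ => intervalIntegral.integral_congr fun x _ => ?_
    simp only [Complex.real_smul, hs x z]
    ring
  have e1 : integ a (f * G) = (∫ x in (a 0)..(a 1), F x * G x) -
      ∫ x in (a 0)..(a 1), (∫ z in (a 0)..(a 1), K (x, z) • F z) * G x := by
    rw [integ_apply, ← intervalIntegral.integral_sub]
    · refine intervalIntegral.integral_congr fun x _ => ?_
      simp only [ContinuousMap.mul_apply, h1 x]
      ring
    · exact (F.continuous.mul G.continuous).intervalIntegrable _ _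
    · exact ((hcF F).mul G.continuous).intervalIntegrable _ _
  have e2 : integ a (g * F) = (∫ x in (a 0)..(a 1), F x * G x) -
      ∫ x in (a 0)..(a 1), (∫ z in (a 0)..(a 1), K (x, z) • G z) * F x := by
    rw [integ_apply, ← intervalIntegral.integral_sub]
    · refine intervalIntegral.integral_congr fun x _ => ?_
      simp only [ContinuousMap.mul_apply, h2 x]
      ring
    · exact (F.continuous.mul G.continuous).intervalIntegrable _ _
    · exact ((hcF G).mul F.continuous).intervalIntegrable _ _
  rw [e1, e2, key]

/-- The derivative of `(𝕀 - 𝕂)⁻¹ f` inside the interval and out. -/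
lemma hasDerivAt_resolvent {E : Type*} [NormedAddCommGroup E] [NormedSpace ℝ E] [CompleteSpace E]
    {K₁ : C(ℝ × ℝ, ℝ)} (hK₁ : ∀ x y, HasDerivAt (fun s => K (s, y)) (K₁ (x, y)) x)
    (hab : a 0 ≤ a 1) (hc : Contractive (ker K) a) {f : C(ℝ, E)} {f' : E} {x : ℝ}
    (hf : HasDerivAt f f' x) :
    HasDerivAt (resolvent (ker K) a f)
      (f' + ∫ z in (a 0)..(a 1), K₁ (x, z) • resolvent (ker K) a f z) x := by
  have hr := continuous_resolvent hab hc f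
  have h1 := hasDerivAt_integral_of_continuous
    (F := fun s z => K (s, z) • resolvent (ker K) a f z)
    (F' := fun s z => K₁ (s, z) • resolvent (ker K) a f z)
    (by fun_prop) (by fun_prop) (fun s z => (hK₁ s z).smul_const _) (a 0) (a 1) x
  refine (hf.add h1).congr_of_eventuallyEq (Eventually.of_forall fun y => ?_)
  simp only [Pi.add_apply, ← resolvent_sub hab hc f y, sub_add_cancel]

end Resolvents

/-! ### Commutators of the resolvent with e and with m d/dx -/

namespace IntegrableKernel

variable (D : IntegrableKernel) {a : Fin 2 → ℝ}

/-- The rank-two commutator [e, 𝕂], written for a single row of the kernel. -/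
lemma row_mul_e (x : ℝ) : row D.K x * D.e = D.e x • row D.K x - D.φ x • D.ψ + D.ψ x • D.φ := by
  ext z
  have := D.commutator x z
  simp only [ContinuousMap.mul_apply, row_apply, ContinuousMap.add_apply, ContinuousMap.sub_apply,
    ContinuousMap.smul_apply, smul_eq_mul]
  linear_combination -this

lemma integ_row_e (x : ℝ) (f : C(ℝ, ℂ)) : integ a (row D.K x * (D.e * f)) =
    D.e x * integ a (row D.K x * f) - D.φ x * integ a (D.ψ * f) + D.ψ x * integ a (D.φ * f) := by
  rw [← mul_assoc, row_mul_e, add_mul, sub_mul, map_add, map_sub]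
  simp only [smul_mul_assoc, map_smul, smul_eq_mul]

/-- The resolvent kernel inherits the integrable form. -/
lemma commutator_resolvent (hab : a 0 ≤ a 1) (hc : Contractive (ker D.K) a) (x y : ℝ) :
    (D.e x - D.e y) * rcol hab hc y x =
      rs hab hc D.φ x * rs hab hc D.ψ y - rs hab hc D.ψ x * rs hab hc D.φ y := by
  set Q := rs hab hc D.φ with hQ
  set P := rs hab hc D.ψ with hP
  set R := rcol hab hc y with hR
  -- As functions of x: the terms of K(x,y) produced by applying 𝕂 to eR - e(y)R are absorbed by the
  -- inhomogeneities φ, ψ in the equations of Q and P, leaving exactly the commutator relation of K.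
  have h := eq_zero_of_fixed hab hc (D.e * R - D.e y • R - P y • Q + Q y • P) (fun x => by
    have h1 := D.commutator x y
    rw [mul_add, mul_sub, mul_sub, map_add, map_sub, map_sub, integ_row_e]
    simp only [mul_smul_comm, map_smul, smul_eq_mul, hQ, hP, hR, integ_row_rs, integ_row_rcol]
    simp only [integ_mul_rcol hab hc D.symm, smul_eq_mul, ContinuousMap.mul_apply, ContinuousMap.add_apply,
      ContinuousMap.sub_apply, ContinuousMap.smul_apply]
    linear_combination -h1) x
  simp only [ContinuousMap.mul_apply, ContinuousMap.add_apply, ContinuousMap.sub_apply,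
      ContinuousMap.smul_apply, smul_eq_mul] at h
  linear_combination h

/-- The derivation `m d/dx` applied to `(𝕀 - 𝕂)⁻¹ f`. -/
lemma derivation_resolvent (hab : a 0 ≤ a 1) (hc : Contractive (ker D.K) a) {f h f' : C(ℝ, ℂ)}
    (hf' : ∀ x, HasDerivAt f (f' x) x) {c₀ c₁ c₂ : ℂ}
    (hf : ∀ x, D.m x * f' x = c₀ * f x + c₁ * D.e x * f x + c₂ * h x) {F' : ℝ → ℂ}
    (hF' : ∀ x, HasDerivAt (resolvent (ker D.K) a f) (F' x) x) (x : ℝ) :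
    D.m x * F' x = c₀ * rs hab hc f x
      + c₁ * (D.e x * rs hab hc f x - integ a (D.ψ * rs hab hc f) * rs hab hc D.φ x
          + integ a (D.φ * rs hab hc f) * rs hab hc D.ψ x)
      + c₂ * rs hab hc h x
      + D.α * integ a (D.ψ * rs hab hc f) * rs hab hc D.φ x
      + D.β * integ a (D.φ * rs hab hc f) * rs hab hc D.ψ x
      - (D.m (a 1) * rs hab hc f (a 1) * rcol hab hc (a 1) x
          - D.m (a 0) * rs hab hc f (a 0) * rcol hab hc (a 0) x) := by
  set F := rs hab hc f with hF
  have hFc : Continuous F' := by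
    have : F' = fun x => f' x + ∫ z in (a 0)..(a 1), D.K₁ (x, z) • F z :=
      funext fun x => (hF' x).unique (hasDerivAt_resolvent D.hasDeriv_K hab hc (hf' x))
    rw [this]
    exact f'.continuous.add
      (intervalIntegral.continuous_parametric_intervalIntegral_of_continuous' (by fun_prop) _ _)
  let G : C(ℝ, ℂ) := ⟨F', hFc⟩
  have hG : ∀ x, G x = f' x + integ a (row D.K₁ x * F) := by
    intro x
    rw [integ_row]
    exact (hF' x).unique (hasDerivAt_resolvent D.hasDeriv_K hab hc (hf' x))
  -- Integration by parts moves the derivative from F onto K(x,z)m(z). The dilation relation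
  -- exchanges the result for m(x)∂_xK and two rank-one terms; the integrated terms carry the
  -- endpoints.
  have hparts : ∀ x, integ a (row D.K x * (D.m * G)) =
      D.K (x, a 1) * D.m (a 1) * F (a 1) - D.K (x, a 0) * D.m (a 0) * F (a 0)
        + D.m x * integ a (row D.K₁ x * F) - D.α * D.φ x * integ a (D.ψ * F)
        - D.β * D.ψ x * integ a (D.φ * F) := by
    intro x
    have hu : ∀ z, HasDerivAt (fun z => (D.K (x, z) : ℂ) * D.m z)
        ((D.K₁ (z, x) : ℂ) * D.m z + D.K (x, z) * D.m' z) z := by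
      intro z
      have h1 : HasDerivAt (fun s => (D.K (x, s) : ℂ)) (D.K₁ (z, x) : ℂ) z := by
        have := (D.hasDeriv_K z x).ofReal_comp
        simp only [D.symm _ x] at this
        exact this
      exact h1.mul (D.hasDeriv_m z)
    have h1 := intervalIntegral.integral_mul_deriv_eq_deriv_mul (a := a 0) (b := a 1)
      (fun z _ => hu z) (fun z _ => hF' z)
      (Continuous.intervalIntegrable (by fun_prop) _ _) (hFc.intervalIntegrable _ _)
    have h2 : integ a (row D.K x * (D.m * G)) =
        ∫ z in (a 0)..(a 1), (D.K (x, z) : ℂ) * D.m z * F' z := by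
      rw [integ_apply]
      refine intervalIntegral.integral_congr fun z _ => ?_
      simp only [ContinuousMap.mul_apply, row_apply, G, ContinuousMap.coe_mk]
      ring
    have h3 : ∫ z in (a 0)..(a 1), ((D.K₁ (z, x) : ℂ) * D.m z + D.K (x, z) * D.m' z) *
        resolvent (ker D.K) a f z =
        integ a ((D.α * D.φ x) • (D.ψ * F) + (D.β * D.ψ x) • (D.φ * F)
          - D.m x • (row D.K₁ x * F)) := by
      rw [integ_apply]
      refine intervalIntegral.integral_congr fun z _ => ?_
      have := D.dilation x z
      simp only [ContinuousMap.mul_apply, row_apply, ContinuousMap.add_apply,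
        ContinuousMap.sub_apply, ContinuousMap.smul_apply, smul_eq_mul, hF, rs_apply]
      linear_combination (resolvent (ker D.K) a f z) * this
    rw [h2, h1, h3, map_sub, map_add]
    simp only [map_smul, smul_eq_mul, hF, rs_apply]
    ring
  set Q := rs hab hc D.φ with hQ
  set P := rs hab hc D.ψ with hP
  -- After `hparts` and the equations of the resolvent functions, invariance under 𝕂 reduces to the
  -- given expression for m f'.
  have hz := eq_zero_of_fixed hab hc
    (D.m * G - (c₀ • F + c₁ • (D.e * F - integ a (D.ψ * F) • Q + integ a (D.φ * F) • P)
      + c₂ • rs hab hc h + (D.α * integ a (D.ψ * F)) • Q + (D.β * integ a (D.φ * F)) • P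
      - ((D.m (a 1) * F (a 1)) • rcol hab hc (a 1) - (D.m (a 0) * F (a 0)) • rcol hab hc (a 0))))
    (fun x => by
      have h1 := hf x
      simp only [mul_add, mul_sub, map_add, map_sub, mul_smul_comm, map_smul, smul_eq_mul,
        integ_row_e, hparts, hQ, hP, integ_row_rcol]
      simp only [hF, integ_row_rs]
      simp only [← hF, ContinuousMap.mul_apply, ContinuousMap.add_apply,
        ContinuousMap.sub_apply, ContinuousMap.smul_apply, hG, smul_eq_mul]
      linear_combination -h1) x
  simp only [ContinuousMap.mul_apply, ContinuousMap.add_apply, ContinuousMap.sub_apply,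
    ContinuousMap.smul_apply, smul_eq_mul] at hz
  have : G x = F' x := rfl
  rw [this] at hz
  linear_combination hz

end IntegrableKernel

end CUEJanossy
end

/-! ### The differential system of an integrable kernel -/

noncomputable section
namespace CUEJanossy
open MeasureTheory

namespace IntegrableKernel

variable (D : IntegrableKernel) {a : Fin 2 → ℝ}

/-- The quantities belonging to an integrable kernel. -/
def quant : Quantities := quantitiesOf (ker D.K) D.φ D.ψ

/-- The system of equations satisfied by the quantities of an integrable kernel. -/
structure System (a : Fin 2 → ℝ) : Prop where
  regular : Regular D.quant a
  dq (j k : Fin 2) : j ≠ k → D.m (a j) * pd (D.quant.q j) j a =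
    D.c₀ * D.quant.q j a
      + D.c₁ * (D.e (a j) * D.quant.q j a - D.quant.v a * D.quant.q j a
          + D.quant.u a * D.quant.p j a)
      + D.c₂ * D.quant.p j a + D.α * D.quant.v a * D.quant.q j a
      + D.β * D.quant.u a * D.quant.p j a
      - sgn k * D.m (a k) * D.quant.R j k a * D.quant.q k a
  dp (j k : Fin 2) : j ≠ k → D.m (a j) * pd (D.quant.p j) j a =
    D.d₀ * D.quant.p j a
      + D.d₁ * (D.e (a j) * D.quant.p j a - D.quant.w a * D.quant.q j a
          + D.quant.v a * D.quant.p j a)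
      + D.d₂ * D.quant.q j a + D.α * D.quant.w a * D.quant.q j a
      + D.β * D.quant.v a * D.quant.p j a
      - sgn k * D.m (a k) * D.quant.R j k a * D.quant.p k a
  dq_off (j k : Fin 2) : j ≠ k → pd (D.quant.q j) k a = sgn k * D.quant.R j k a * D.quant.q k a
  dp_off (j k : Fin 2) : j ≠ k → pd (D.quant.p j) k a = sgn k * D.quant.R j k a * D.quant.p k a
  du (j : Fin 2) : pd D.quant.u j a = sgn j * D.quant.q j a ^ 2
  dw (j : Fin 2) : pd D.quant.w j a = sgn j * D.quant.p j a ^ 2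
  dv (j : Fin 2) : pd D.quant.v j a = sgn j * (D.quant.q j a * D.quant.p j a)
  dlogJ (j : Fin 2) : pd (fun b => Real.log (D.quant.J b)) j a = -sgn j * D.quant.R j j a
  R_off (j k : Fin 2) : (D.e (a j) - D.e (a k)) * D.quant.R j k a =
    D.quant.q j a * D.quant.p k a - D.quant.p j a * D.quant.q k a
  R_diag (j : Fin 2) : D.e' (a j) * D.quant.R j j a =
    D.quant.p j a * pd (D.quant.q j) j a - D.quant.q j a * pd (D.quant.p j) j a

lemma pd_resolvent {K : C(ℝ × ℝ, ℝ)} (hab : a 0 ≤ a 1) (hc : Contractive (ker K) a)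
    (f : C(ℝ, ℂ)) (j k : Fin 2) {e : ℂ} (he : HasDerivAt (resolvent (ker K) a f) e (a j)) :
    pd (fun b => resolvent (ker K) b f (b j)) k a =
      sgn k * resolvent (ker K) a (col K (a k)) (a j) * resolvent (ker K) a f (a k)
        + if j = k then e else 0 := by
  rw [pd_of_hasFDerivAt (hasFDerivAt_resolvent hab hc f j he), add_apply, edgeDeriv_single]
  congr 1
  · rw [Complex.real_smul, Complex.real_smul]; ring
  · simp [Pi.single_apply]

theorem system (hab : a 0 ≤ a 1) (hc : Contractive (ker D.K) a) : D.System a := by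
  have hφ := fun x => hasDerivAt_resolvent D.hasDeriv_K hab hc (D.hasDeriv_φ x)
  have hψ := fun x => hasDerivAt_resolvent D.hasDeriv_K hab hc (D.hasDeriv_ψ x)
  set Q' : ℝ → ℂ := fun x =>
    D.φ' x + ∫ z in (a 0)..(a 1), D.K₁ (x, z) • resolvent (ker D.K) a D.φ z with hQ'
  set P' : ℝ → ℂ := fun x =>
    D.ψ' x + ∫ z in (a 0)..(a 1), D.K₁ (x, z) • resolvent (ker D.K) a D.ψ z with hP'
  have mQ := D.derivation_resolvent hab hc D.hasDeriv_φ D.deriv_φ (F' := Q') hφ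
  have mP := D.derivation_resolvent hab hc D.hasDeriv_ψ D.deriv_ψ (F' := P') hψ
  have hvv := integ_mul_rs_comm hab hc D.symm D.φ D.ψ
  have hu : integ a (D.φ * rs hab hc D.φ) = D.quant.u a := rfl
  have hv : integ a (D.ψ * rs hab hc D.φ) = D.quant.v a := rfl
  have hw : integ a (D.ψ * rs hab hc D.ψ) = D.quant.w a := rfl
  rw [hv] at hvv
  have hq : ∀ j, rs hab hc D.φ (a j) = D.quant.q j a := fun _ => rfl
  have hp : ∀ j, rs hab hc D.ψ (a j) = D.quant.p j a := fun _ => rfl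
  have hR : ∀ j k, rcol hab hc (a k) (a j) = (D.quant.R j k a : ℂ) := fun _ _ => rfl
  have pq : ∀ j k, pd (D.quant.q j) k a =
      sgn k * D.quant.R j k a * D.quant.q k a + if j = k then Q' (a j) else 0 :=
    fun j k => pd_resolvent hab hc D.φ j k (hφ (a j))
  have pp : ∀ j k, pd (D.quant.p j) k a =
      sgn k * D.quant.R j k a * D.quant.p k a + if j = k then P' (a j) else 0 :=
    fun j k => pd_resolvent hab hc D.ψ j k (hψ (a j))
  refine ⟨⟨fun j => ?_, fun j => ?_, ?_, ?_, ?_, ?_, ?_⟩, ?_, ?_, ?_, ?_, ?_, ?_, ?_, ?_, ?_, ?_⟩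
  · exact (hasFDerivAt_resolvent hab hc D.φ j (hφ (a j))).differentiableAt
  · exact (hasFDerivAt_resolvent hab hc D.ψ j (hψ (a j))).differentiableAt
  · exact (hasFDerivAt_integral_resolvent hab hc D.symm D.φ D.φ).differentiableAt
  · exact (hasFDerivAt_integral_resolvent hab hc D.symm D.ψ D.ψ).differentiableAt
  · exact (hasFDerivAt_integral_resolvent hab hc D.symm D.ψ D.φ).differentiableAt
  · exact hasFDerivAt_fredholmDet hab hc D.symm
  · exact fredholmDet_pos _ _
  · intro j k hjk
    -- The term sgn j · m(a_j) R_jj q_j from moving the limit of integration cancels the boundary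
    -- term of `derivation_resolvent` at a_j, so only the other endpoint remains.
    have h := mQ (a j)
    rw [hu, hv, hq, hp, hq, hq, hR, hR] at h
    rw [pq, if_pos rfl, mul_add, h]
    fin_cases j <;> fin_cases k <;> first | exact absurd rfl hjk | (simp [sgn]; ring)
  · intro j k hjk
    have h := mP (a j)
    rw [hvv, hw, hq, hp, hp, hp, hR, hR] at h
    rw [pp, if_pos rfl, mul_add, h]
    fin_cases j <;> fin_cases k <;> first | exact absurd rfl hjk | (simp [sgn]; ring)
  · intro j k hjk
    rw [pq, if_neg hjk, add_zero]
  · intro j k hjk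
    rw [pp, if_neg hjk, add_zero]
  · intro j
    have := pd_of_edgeDeriv (hasFDerivAt_integral_resolvent hab hc D.symm D.φ D.φ) j
    rw [Complex.real_smul] at this
    rw [sq]
    exact this
  · intro j
    have := pd_of_edgeDeriv (hasFDerivAt_integral_resolvent hab hc D.symm D.ψ D.ψ) j
    rw [Complex.real_smul] at this
    rw [sq]
    exact this
  · intro j
    have := pd_of_edgeDeriv (hasFDerivAt_integral_resolvent hab hc D.symm D.ψ D.φ) j
    rw [Complex.real_smul] at this
    rw [mul_comm (D.quant.q j a)]
    exact this
  · intro j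
    have := pd_of_edgeDeriv (hasFDerivAt_log_fredholmDet hab hc D.symm) j
    rw [smul_eq_mul, mul_neg, ← neg_mul] at this
    exact this
  · intro j k
    exact D.commutator_resolvent hab hc (a j) (a k)
  · intro j
    -- The diagonal value of R is read off by differentiating (e(x)-e(a_j))R(x,a_j) = Q(x)p_j -
    -- P(x)q_j at x = a_j. Replacing spatial by partial derivatives is harmless, as the R_jj terms
    -- cancel in p∂q - q∂p.
    have h1 : HasDerivAt (fun x => (D.e x - D.e (a j)) *
        ((resolvent (ker D.K) a (col D.K (a j)) x : ℝ) : ℂ)) _ (a j) :=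
      ((D.hasDeriv_e (a j)).sub_const (D.e (a j))).mul
        (hasDerivAt_resolvent D.hasDeriv_K hab hc (D.hasDeriv_K (a j) (a j)) :
          HasDerivAt (resolvent (ker D.K) a (col D.K (a j))) _ (a j)).ofReal_comp
    have h2 : HasDerivAt (fun x => resolvent (ker D.K) a D.φ x * D.quant.p j a -
        resolvent (ker D.K) a D.ψ x * D.quant.q j a) _ (a j) :=
      ((hφ (a j)).mul_const (D.quant.p j a)).sub ((hψ (a j)).mul_const (D.quant.q j a))
    have h3 : (fun x => (D.e x - D.e (a j)) *
        ((resolvent (ker D.K) a (col D.K (a j)) x : ℝ) : ℂ)) =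
        fun x => resolvent (ker D.K) a D.φ x * D.quant.p j a -
          resolvent (ker D.K) a D.ψ x * D.quant.q j a :=
      funext fun x => D.commutator_resolvent hab hc x (a j)
    rw [h3] at h1
    have h4 := h1.unique h2
    rw [sub_self, zero_mul, add_zero] at h4
    rw [pq, pp, if_pos rfl, if_pos rfl]
    have h5 : ((resolvent (ker D.K) a (col D.K (a j)) (a j) : ℝ) : ℂ) = D.quant.R j j a := rfl
    rw [h5] at h4
    rw [h4]
    ring

end IntegrableKernel

end CUEJanossy
end

noncomputable section
namespace CUEJanossy
open MeasureTheory

/-! ### A criterion for strict contraction -/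

section Criterion

variable {K : C(ℝ × ℝ, ℝ)} {a : Fin 2 → ℝ}

/-- The real integral operator on the interval. -/
def rop (K : C(ℝ × ℝ, ℝ)) (a : Fin 2 → ℝ) (f : ℝ → ℝ) (x : ℝ) : ℝ :=
  ∫ z in (a 0)..(a 1), K (x, z) * f z

lemma continuous_rop {f : ℝ → ℝ} (hf : Continuous f) : Continuous (rop K a f) :=
  intervalIntegral.continuous_parametric_intervalIntegral_of_continuous' (by fun_prop) _ _

lemma rop_sub {f g : ℝ → ℝ} (hf : Continuous f) (hg : Continuous g) (x : ℝ) :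
    rop K a (fun z => f z - g z) x = rop K a f x - rop K a g x := by
  rw [rop, rop, rop, ← intervalIntegral.integral_sub]
  · simp only [mul_sub]
  all_goals exact Continuous.intervalIntegrable (by fun_prop) _ _

lemma rop_const_mul (c : ℝ) (f : ℝ → ℝ) (x : ℝ) :
    rop K a (fun z => c * f z) x = c * rop K a f x := by
  rw [rop, rop, ← intervalIntegral.integral_const_mul]
  congr 1; ext z; ring

/-- The functions `𝕂 f` with `‖f‖₂ ≤ 1`, as functions on the compact interval. -/
def unitImage (K : C(ℝ × ℝ, ℝ)) (a : Fin 2 → ℝ) :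
    Set (BoundedContinuousFunction (Icc (a 0) (a 1)) ℝ) :=
  {g | ∃ f : ℝ → ℝ, Continuous f ∧ ∫ x in (a 0)..(a 1), f x ^ 2 ≤ 1 ∧ ∀ x, g x = rop K a f x}

/-- Arzelà–Ascoli: Cauchy–Schwarz bounds 𝕂f and its increments by L² norms of rows and of
differences of rows, uniformly for ‖f‖₂ ≤ 1. -/
lemma isCompact_closure_unitImage (hab : a 0 ≤ a 1) : IsCompact (closure (unitImage K a)) := by
  have hk : ∀ {x y : ℝ} {f : ℝ → ℝ}, Continuous f → ∫ z in (a 0)..(a 1), f z ^ 2 ≤ 1 →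
      (rop K a f x - rop K a f y) ^ 2 ≤ ∫ z in (a 0)..(a 1), (K (x, z) - K (y, z)) ^ 2 := by
    intro x y f hf h1
    have h2 : rop K a f x - rop K a f y = ∫ z in (a 0)..(a 1), (K (x, z) - K (y, z)) * f z := by
      rw [rop, rop, ← intervalIntegral.integral_sub]
      · simp only [sub_mul]
      all_goals exact Continuous.intervalIntegrable (by fun_prop) _ _
    rw [h2]
    refine (sq_integral_mul_le hab (by fun_prop) hf).trans ?_
    exact mul_le_of_le_one_right (intervalIntegral.integral_nonneg hab fun _ _ => sq_nonneg _) h1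
  have hb : ∀ {x : ℝ} {f : ℝ → ℝ}, Continuous f → ∫ z in (a 0)..(a 1), f z ^ 2 ≤ 1 →
      (rop K a f x) ^ 2 ≤ ∫ z in (a 0)..(a 1), K (x, z) ^ 2 := by
    intro x f hf h1
    refine (sq_integral_mul_le hab (by fun_prop) hf).trans ?_
    exact mul_le_of_le_one_right (intervalIntegral.integral_nonneg hab fun _ _ => sq_nonneg _) h1
  have hc1 : Continuous fun x => ∫ z in (a 0)..(a 1), K (x, z) ^ 2 :=
    intervalIntegral.continuous_parametric_intervalIntegral_of_continuous' (by fun_prop) _ _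
  obtain ⟨C, hC⟩ := (isCompact_Icc (a := a 0) (b := a 1)).exists_bound_of_continuousOn
    hc1.continuousOn
  refine BoundedContinuousFunction.arzela_ascoli (Icc (-(C + 1)) (C + 1)) isCompact_Icc _ ?_ ?_
  · rintro g x ⟨f, hf, h1, hg⟩
    rw [hg]
    have h2 := hb (x := x) hf h1
    have h3 := (le_abs_self _).trans (hC x x.2)
    refine abs_le.1 (abs_le_of_sq_le_sq ?_ ?_)
    · nlinarith [sq_nonneg (rop K a f x)]
    · nlinarith [sq_nonneg (rop K a f x)]
  · intro x
    rw [Metric.equicontinuousAt_iff_right]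
    intro ε hε
    have hc2 : Continuous fun y : ℝ => ∫ z in (a 0)..(a 1), (K ((x : ℝ), z) - K (y, z)) ^ 2 :=
      intervalIntegral.continuous_parametric_intervalIntegral_of_continuous' (by fun_prop) _ _
    have h0 : (fun y : ℝ => ∫ z in (a 0)..(a 1), (K ((x : ℝ), z) - K (y, z)) ^ 2) x < ε ^ 2 := by
      simp; positivity
    have h1 := ((hc2.comp continuous_subtype_val).continuousAt (x := x)).eventually_lt_const h0
    filter_upwards [h1] with y hy
    rintro ⟨g, f, hf, hf1, hg⟩
    change dist (g x) (g y) < ε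
    rw [hg, hg, Real.dist_eq]
    exact abs_lt_of_sq_lt_sq ((hk hf hf1).trans_lt hy) hε.le

/-- The compression of a positive contraction that cannot concentrate on the interval is a
strict contraction. -/
lemma contractive_of_unique_continuation (hab : a 0 ≤ a 1) {B : ℝ} (hB : a 1 < B)
    (hkey : ∀ f : ℝ → ℝ, Continuous f →
      ∫ x in (a 0)..B, rop K a f x ^ 2 ≤ ∫ x in (a 0)..(a 1), f x * rop K a f x)
    (huc : ∀ f : ℝ → ℝ, Continuous f → (∀ x ∈ Ioo (a 1) B, rop K a f x = 0) →
      ∀ x, rop K a f x = 0) : Contractive (ker K) a := by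
  have hsplit : ∀ f : ℝ → ℝ, Continuous f → ∫ x in (a 0)..B, rop K a f x ^ 2 =
      (∫ x in (a 0)..(a 1), rop K a f x ^ 2) + ∫ x in (a 1)..B, rop K a f x ^ 2 := by
    intro f hf
    have hc := (continuous_rop (K := K) (a := a) hf).pow 2
    exact (intervalIntegral.integral_add_adjacent_intervals (hc.intervalIntegrable _ _)
      (hc.intervalIntegrable _ _)).symm
  have hkey' : ∀ f : ℝ → ℝ, Continuous f →
      ∫ x in (a 0)..(a 1), rop K a f x ^ 2 ≤ ∫ x in (a 0)..(a 1), f x * rop K a f x := by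
    intro f hf
    have h1 := hkey f hf
    rw [hsplit f hf] at h1
    have h2 : 0 ≤ ∫ x in (a 1)..B, rop K a f x ^ 2 :=
      intervalIntegral.integral_nonneg hB.le fun _ _ => sq_nonneg _
    linarith
  by_contra hcon
  -- Failure of every constant 1 - 1/(n+1) gives unit vectors almost preserved in norm.
  -- Normalisation needs ‖f‖₂ ≠ 0: otherwise Cauchy–Schwarz gives ⟨f,𝕂f⟩ = 0, hence 𝕂f = 0 in L²(I),
  -- against the strict inequality.
  have hex : ∀ n : ℕ, ∃ f : ℝ → ℝ, Continuous f ∧ ∫ x in (a 0)..(a 1), f x ^ 2 = 1 ∧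
      1 - 1 / ((n : ℝ) + 1) < ∫ x in (a 0)..(a 1), rop K a f x ^ 2 := by
    intro n
    have hn : (0 : ℝ) < 1 / ((n : ℝ) + 1) := by positivity
    have hn1 : 1 / ((n : ℝ) + 1) ≤ 1 := by
      rw [div_le_one (by positivity)]; linarith [Nat.cast_nonneg (α := ℝ) n]
    have h1 : ∃ f : ℝ → ℝ, Continuous f ∧ (1 - 1 / ((n : ℝ) + 1)) * ∫ x in (a 0)..(a 1), f x ^ 2 <
        ∫ x in (a 0)..(a 1), rop K a f x ^ 2 := by
      by_contra h
      push Not at h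
      exact hcon ⟨1 - 1 / ((n : ℝ) + 1), by linarith, by linarith, fun f hf => h f hf⟩
    obtain ⟨f, hf, hlt⟩ := h1
    set t := ∫ x in (a 0)..(a 1), f x ^ 2 with ht
    have ht0 : 0 ≤ t := intervalIntegral.integral_nonneg hab fun _ _ => sq_nonneg _
    have htpos : 0 < t := by
      rcases ht0.lt_or_eq with h | h
      · exact h
      · exfalso
        have h2 := sq_integral_mul_le hab hf (continuous_rop (K := K) (a := a) hf)
        rw [← ht, ← h, zero_mul] at h2
        have h3 := hkey' f hf
        rw [← h, mul_zero] at hlt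
        nlinarith
    have hsq : (√t)⁻¹ ^ 2 = t⁻¹ := by rw [inv_pow, Real.sq_sqrt ht0]
    refine ⟨fun z => (√t)⁻¹ * f z, by fun_prop, ?_, ?_⟩
    · simp only [mul_pow, intervalIntegral.integral_const_mul, hsq]
      exact inv_mul_cancel₀ htpos.ne'
    · simp only [rop_const_mul, mul_pow, intervalIntegral.integral_const_mul, hsq]
      rwa [lt_inv_mul_iff₀ htpos, mul_comm]
  choose f hf hf1 hfr using hex
  let res : (ℝ → ℝ) → ℝ → ℝ := fun f => rop K a f
  let g : ℕ → BoundedContinuousFunction (Icc (a 0) (a 1)) ℝ := fun n =>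
    BoundedContinuousFunction.mkOfCompact
      ⟨fun x => rop K a (f n) x, (continuous_rop (hf n)).comp continuous_subtype_val⟩
  have hgA : ∀ n, g n ∈ closure (unitImage K a) := fun n =>
    subset_closure ⟨f n, hf n, (hf1 n).le, fun _ => rfl⟩
  obtain ⟨G, -, φ, hφ, hG⟩ := (isCompact_closure_unitImage hab).tendsto_subseq hgA
  let pr : C(ℝ, Icc (a 0) (a 1)) := ⟨projIcc _ _ hab, continuous_projIcc⟩
  have hG' : Tendsto (fun n => (g (φ n)).compContinuous pr) atTop (𝓝 (G.compContinuous pr)) :=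
    ((BoundedContinuousFunction.continuous_compContinuous pr).tendsto G).comp hG
  set h : Fn ℝ := G.compContinuous pr with hh
  have hgr : ∀ n, ∀ x ∈ Icc (a 0) (a 1), (g n).compContinuous pr x = rop K a (f n) x := by
    intro n x hx
    have : projIcc _ _ hab x = ⟨x, hx⟩ := projIcc_of_mem hab hx
    change rop K a (f n) (projIcc _ _ hab x : ℝ) = _
    rw [this]
  have hnorm : Tendsto (fun n => ∫ x in (a 0)..(a 1), rop K a (f (φ n)) x ^ 2) atTop
      (𝓝 (∫ x in (a 0)..(a 1), h x ^ 2)) := by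
    have h1 := ((intL (E := ℝ) a).continuous.tendsto _).comp (hG'.mul hG')
    have e1 : intL a (h * h) = ∫ x in (a 0)..(a 1), h x ^ 2 := by
      rw [intL_apply]; simp only [BoundedContinuousFunction.mul_apply, sq]
    rw [e1] at h1
    refine h1.congr fun n => ?_
    simp only [Function.comp_apply, intL_apply]
    refine intervalIntegral.integral_congr fun x hx => ?_
    rw [uIcc_of_le hab] at hx
    simp only [BoundedContinuousFunction.mul_apply, hgr _ x hx, sq]
  have hto1 : Tendsto (fun n : ℕ => 1 / (((φ n : ℕ) : ℝ) + 1)) atTop (𝓝 0) :=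
    tendsto_one_div_add_atTop_nhds_zero_nat.comp hφ.tendsto_atTop
  have hge : 1 ≤ ∫ x in (a 0)..(a 1), h x ^ 2 := by
    have h2 : Tendsto (fun n : ℕ => 1 - 1 / (((φ n : ℕ) : ℝ) + 1)) atTop (𝓝 (1 - 0)) :=
      hto1.const_sub 1
    rw [sub_zero] at h2
    exact le_of_tendsto_of_tendsto' h2 hnorm fun n => (hfr (φ n)).le
  -- ‖f-𝕂f‖² = 1 - 2⟨f,𝕂f⟩ + ‖𝕂f‖² ≤ 1 - ‖𝕂f‖², by ‖𝕂f‖² ≤ ⟨f,𝕂f⟩.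
  have hdiff : ∀ n, ∫ x in (a 0)..(a 1), (f n x - rop K a (f n) x) ^ 2 ≤ 1 / ((n : ℝ) + 1) := by
    intro n
    have hc := continuous_rop (K := K) (a := a) (hf n)
    have e : ∫ x in (a 0)..(a 1), (f n x - rop K a (f n) x) ^ 2 =
        (∫ x in (a 0)..(a 1), f n x ^ 2) - 2 * (∫ x in (a 0)..(a 1), f n x * rop K a (f n) x)
          + ∫ x in (a 0)..(a 1), rop K a (f n) x ^ 2 := by
      have hfn := hf n
      rw [← intervalIntegral.integral_const_mul, ← intervalIntegral.integral_sub,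
        ← intervalIntegral.integral_add]
      · congr 1; ext x; ring
      all_goals exact Continuous.intervalIntegrable (by fun_prop) _ _
    rw [e, hf1 n]
    linarith [hkey' (f n) (hf n), hfr n]
  -- 𝕂f_n - 𝕂²f_n tends to zero because f_n - 𝕂f_n does in L², while 𝕂²f_n → 𝕂h because 𝕂f_n → h
  -- uniformly. Hence h = 𝕂h on I.
  have hlim : ∀ x, Tendsto (fun n => rop K a (f (φ n)) x) atTop (𝓝 (rop K a h x)) := by
    intro x
    have h1 : Tendsto (fun n => rop K a (rop K a (f (φ n))) x) atTop (𝓝 (rop K a h x)) := by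
      let kr : Fn ℝ := (BoundedContinuousFunction.mkOfCompact
        (⟨fun z => K (x, z), by fun_prop⟩ : C(Icc (a 0) (a 1), ℝ))).compContinuous pr
      have hkr : ∀ z ∈ Icc (a 0) (a 1), kr z = K (x, z) := by
        intro z hz
        have : projIcc _ _ hab z = ⟨z, hz⟩ := projIcc_of_mem hab hz
        change K (x, (projIcc _ _ hab z : ℝ)) = _
        rw [this]
      have h2 := ((intL (E := ℝ) a).continuous.tendsto _).comp
        ((tendsto_const_nhds (x := kr)).mul hG')
      have e1 : intL a (kr * h) = rop K a h x := by
        rw [intL_apply, rop]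
        refine intervalIntegral.integral_congr fun z hz => ?_
        rw [uIcc_of_le hab] at hz
        simp only [BoundedContinuousFunction.mul_apply, hkr z hz]
      rw [e1] at h2
      refine h2.congr fun n => ?_
      simp only [Function.comp_apply, intL_apply]
      refine intervalIntegral.integral_congr fun z hz => ?_
      rw [uIcc_of_le hab] at hz
      simp only [BoundedContinuousFunction.mul_apply, hkr z hz, hgr _ z hz]
    have h3 : Tendsto (fun n => rop K a (f (φ n)) x - rop K a (rop K a (f (φ n))) x) atTop
        (𝓝 0) := by
      set C := ∫ z in (a 0)..(a 1), K (x, z) ^ 2 with hC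
      have hsq : Tendsto (fun n => √(C * (1 / (((φ n : ℕ) : ℝ) + 1)))) atTop (𝓝 0) := by
        have := (Real.continuous_sqrt.tendsto _).comp (hto1.const_mul C)
        simpa [Function.comp_def] using this
      refine squeeze_zero_norm (fun n => ?_) hsq
      have hc := continuous_rop (K := K) (a := a) (hf (φ n))
      rw [← rop_sub (hf _) hc]
      refine Real.abs_le_sqrt ?_
      refine (sq_integral_mul_le hab (by fun_prop) ((hf _).sub hc)).trans ?_
      exact mul_le_mul_of_nonneg_left (hdiff _)
        (intervalIntegral.integral_nonneg hab fun _ _ => sq_nonneg _)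
    simpa using h3.add h1
  have hfix : ∀ x ∈ Icc (a 0) (a 1), h x = rop K a h x := by
    intro x hx
    have h1 : Tendsto (fun n => (g (φ n)).compContinuous pr x) atTop (𝓝 (h x)) :=
      (continuous_eval_const (F := Fn ℝ) x).continuousAt.tendsto.comp hG'
    simp only [hgr _ x hx] at h1
    exact tendsto_nhds_unique h1 (hlim x)
  -- Since 𝕂h = h on I, the inequality on the larger interval leaves no mass for 𝕂h beyond a₂;
  -- unique continuation then contradicts ‖h‖₂ ≥ 1.
  have hzero : ∫ x in (a 1)..B, rop K a h x ^ 2 ≤ 0 := by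
    have h1 := hkey h h.continuous
    rw [hsplit h h.continuous] at h1
    have h2 : ∫ x in (a 0)..(a 1), h x * rop K a h x = ∫ x in (a 0)..(a 1), rop K a h x ^ 2 := by
      refine intervalIntegral.integral_congr fun x hx => ?_
      rw [uIcc_of_le hab] at hx
      simp only [hfix x hx, sq]
    linarith
  have hvan : ∀ x ∈ Ioo (a 1) B, rop K a h x = 0 := by
    intro x hx
    by_contra hne
    have hc := (continuous_rop (K := K) (a := a) h.continuous).pow 2
    have : 0 < ∫ x in (a 1)..B, rop K a h x ^ 2 := by
      refine intervalIntegral.integral_pos hB hc.continuousOn (fun y _ => sq_nonneg _)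
        ⟨x, Ioo_subset_Icc_self hx, by positivity⟩
    linarith
  have h0 := huc h h.continuous hvan
  have : ∫ x in (a 0)..(a 1), h x ^ 2 = 0 := by
    rw [intervalIntegral.integral_congr (g := fun _ => (0 : ℝ))]
    · simp
    · intro x hx
      rw [uIcc_of_le hab] at hx
      simp only [hfix x hx, h0 x]
      simp
  linarith

/-- The operator inequality for a kernel with the reproducing property on a larger interval. -/
lemma integral_sq_rop_of_reproducing {c d : ℝ}
    (hrep : ∀ x z, ∫ y in c..d, K (y, x) * K (y, z) = K (x, z)) {f : ℝ → ℝ} (hf : Continuous f) :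
    ∫ y in c..d, rop K a f y ^ 2 = ∫ x in (a 0)..(a 1), f x * rop K a f x := by
  have hc := continuous_rop (K := K) (a := a) hf
  calc ∫ y in c..d, rop K a f y ^ 2
      = ∫ y in c..d, ∫ x in (a 0)..(a 1), K (y, x) * f x * rop K a f y := by
        refine intervalIntegral.integral_congr fun y _ => ?_
        simp only [intervalIntegral.integral_mul_const]
        rw [sq]; rfl
    _ = ∫ x in (a 0)..(a 1), ∫ y in c..d, K (y, x) * f x * rop K a f y :=
        integral_integral_swap_of_continuous (by fun_prop) _ _ _ _
    _ = ∫ x in (a 0)..(a 1), f x * rop K a f x := by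
        refine intervalIntegral.integral_congr fun x _ => ?_
        have e1 : ∫ y in c..d, K (y, x) * f x * rop K a f y =
            f x * ∫ y in c..d, ∫ z in (a 0)..(a 1), K (y, x) * (K (y, z) * f z) := by
          rw [← intervalIntegral.integral_const_mul]
          refine intervalIntegral.integral_congr fun y _ => ?_
          simp only [intervalIntegral.integral_const_mul, rop]
          ring
        simp only [e1]
        rw [integral_integral_swap_of_continuous (by fun_prop)]
        congr 1
        refine intervalIntegral.integral_congr fun z _ => ?_
        simp only [← mul_assoc, intervalIntegral.integral_mul_const, hrep]

end Criterion

end CUEJanossy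
end

noncomputable section
namespace CUEJanossy
open MeasureTheory

/-! ### Conditioned convolution kernels -/

/-- The plane wave `e^{iωx}`. -/
def wave (ω : ℝ) : C(ℝ, ℂ) := ⟨fun x => Complex.exp (Complex.I * ω * x), by fun_prop⟩

@[simp] lemma wave_apply (ω x : ℝ) : wave ω x = Complex.exp (Complex.I * ω * x) := rfl

/-- The kernel `k(x-y)`, conditioned on a particle at the origin. -/
def convKernel (k : C(ℝ, ℝ)) : C(ℝ × ℝ, ℝ) :=
  ⟨fun p => k (p.1 - p.2) - k p.1 * (k 0)⁻¹ * k p.2, by fun_prop⟩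

lemma convKernel_apply (k : C(ℝ, ℝ)) (x y : ℝ) :
    convKernel k (x, y) = k (x - y) - k x * (k 0)⁻¹ * k y := rfl

/-- The plane wave of frequency `ω`, conditioned on a particle at the origin. -/
def condWave (ω : ℝ) (k : C(ℝ, ℝ)) : C(ℝ, ℂ) :=
  ⟨fun x => (wave ω x - k x / k 0) / √(2 * Real.pi), by fun_prop⟩

lemma condWave_apply (ω : ℝ) (k : C(ℝ, ℝ)) (x : ℝ) :
    condWave ω k x = (wave ω x - k x / k 0) / √(2 * Real.pi) := rfl

/-- An even entire function `k`, real on the real axis, for which the convolution kernel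
`k(x-y)` is of integrable form. -/
structure Profile where
  k : C(ℝ, ℝ)
  kc : ℂ → ℂ
  e : C(ℝ, ℂ)
  e' : C(ℝ, ℂ)
  ω : ℝ
  ω' : ℝ
  entire : Differentiable ℂ kc
  k_coe : ∀ x : ℝ, (k x : ℂ) = kc x
  even : ∀ x, k (-x) = k x
  k_zero : k 0 ≠ 0
  hasDeriv_e : ∀ x, HasDerivAt e (e' x) x
  e_zero : e 0 = 0
  form : ∀ x y : ℝ, 2 * Real.pi * (e x - e y) * k (x - y) =
    wave ω x * wave ω' y - wave ω' x * wave ω y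

namespace Profile

variable (P : Profile)

/-- The derivative of `k`. -/
def k' : C(ℝ, ℝ) :=
  ⟨fun x => (deriv P.kc x).re, Complex.continuous_re.comp
    (P.entire.contDiff.continuous_deriv le_top |>.comp Complex.continuous_ofReal)⟩

lemma hasDeriv_k (x : ℝ) : HasDerivAt P.k (P.k' x) x := by
  refine (P.entire (x : ℂ)).hasDerivAt.real_of_complex.congr_of_eventuallyEq
    (Eventually.of_forall fun y => ?_)
  change P.k y = (P.kc y).re
  rw [← P.k_coe, Complex.ofReal_re]

lemma hasDeriv_k_ofReal (x : ℝ) : HasDerivAt (fun s : ℝ => (P.k s : ℂ)) (P.k' x) x :=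
  (P.hasDeriv_k x).ofReal_comp

lemma k'_neg (x : ℝ) : P.k' (-x) = -P.k' x := by
  have h1 := (P.hasDeriv_k (-x)).scomp x (hasDerivAt_neg x)
  have h2 : (P.k ∘ fun s => -s) = P.k := funext P.even
  rw [show (P.k ∘ Neg.neg) = P.k from h2] at h1
  have := h1.unique (P.hasDeriv_k x)
  simp at this; linarith

lemma hasDeriv_wave (ω x : ℝ) : HasDerivAt (wave ω) (Complex.I * ω * wave ω x) x := by
  have h1 : HasDerivAt (fun s : ℝ => Complex.I * ω * (s : ℂ)) (Complex.I * ω * 1) x :=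
    (Complex.ofRealCLM.hasDerivAt (x := x)).const_mul _
  refine (h1.cexp.congr_deriv ?_)
  rw [mul_one, mul_comm]; rfl

lemma wave_zero (ω : ℝ) : wave ω 0 = 1 := by simp

/-- The derivative of the integrable form in the second variable. -/
lemma form_deriv (x y : ℝ) :
    2 * Real.pi * (-Complex.I * (P.e x - P.e y) * P.k' (x - y) + -Complex.I * P.e' y * P.k (x - y)) =
    P.ω * (wave P.ω' x * wave P.ω y) - P.ω' * (wave P.ω x * wave P.ω' y) := by
  have h1 : HasDerivAt (fun s : ℝ => (P.k (x - s) : ℂ)) (-(P.k' (x - y) : ℂ)) y := by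
    have := (P.hasDeriv_k_ofReal (x - y)).scomp y ((hasDerivAt_id y).const_sub x)
    simpa [Function.comp_def] using this
  have h2 : HasDerivAt (fun s => 2 * Real.pi * (P.e x - P.e s) * P.k (x - s))
      (2 * Real.pi * (-P.e' y) * P.k (x - y)
        + 2 * Real.pi * (P.e x - P.e y) * (-(P.k' (x - y) : ℂ))) y :=
    (((P.hasDeriv_e y).const_sub (P.e x)).const_mul (2 * Real.pi : ℂ)).mul h1
  have h3 := ((hasDeriv_wave P.ω' y).const_mul (wave P.ω x)).sub
    ((hasDeriv_wave P.ω y).const_mul (wave P.ω' x))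
  have h4 := h2.unique (h3.congr_of_eventuallyEq (Eventually.of_forall fun s => P.form x s))
  linear_combination Complex.I * h4 + (P.ω' * (wave P.ω x * wave P.ω' y)
    - P.ω * (wave P.ω' x * wave P.ω y)) * Complex.I_sq

lemma form_zero (x : ℝ) : 2 * Real.pi * P.e x * P.k x = wave P.ω x - wave P.ω' x := by
  have := P.form x 0
  simpa only [P.e_zero, sub_zero, wave_zero, mul_one] using this

lemma two_pi_ne : (2 * Real.pi : ℂ) ≠ 0 := by
  exact_mod_cast Real.two_pi_pos.ne'

lemma sqrt_sq : ((√(2 * Real.pi) : ℝ) : ℂ) ^ 2 = 2 * Real.pi := by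
  rw [← Complex.ofReal_pow, Real.sq_sqrt Real.two_pi_pos.le]; push_cast; rfl

lemma sqrt_ne : ((√(2 * Real.pi) : ℝ) : ℂ) ≠ 0 := by
  exact_mod_cast (Real.sqrt_pos.2 Real.two_pi_pos).ne'

lemma hasDeriv_condWave (ω x : ℝ) : HasDerivAt (condWave ω P.k)
    ((Complex.I * ω * wave ω x - P.k' x / P.k 0) / √(2 * Real.pi)) x :=
  ((hasDeriv_wave ω x).sub ((P.hasDeriv_k_ofReal x).div_const _)).div_const _

/-- The integrable kernel of a profile. -/
def toIntegrableKernel : IntegrableKernel where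
  K := convKernel P.k
  K₁ := ⟨fun p => P.k' (p.1 - p.2) - P.k' p.1 * (P.k 0)⁻¹ * P.k p.2, by fun_prop⟩
  φ := condWave P.ω P.k
  ψ := condWave P.ω' P.k
  φ' := ⟨fun x => (Complex.I * P.ω * wave P.ω x - P.k' x / P.k 0) / √(2 * Real.pi), by fun_prop⟩
  ψ' := ⟨fun x => (Complex.I * P.ω' * wave P.ω' x - P.k' x / P.k 0) / √(2 * Real.pi), by fun_prop⟩
  e := P.e
  e' := P.e'
  m := ⟨fun x => -Complex.I * P.e x, by fun_prop⟩
  m' := ⟨fun x => -Complex.I * P.e' x, by fun_prop⟩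
  α := -P.ω'
  β := P.ω
  c₀ := (2 * Real.pi * P.k 0)⁻¹ * (P.ω + P.ω')
  c₁ := P.ω
  c₂ := -(2 * Real.pi * P.k 0)⁻¹ * (2 * P.ω)
  d₀ := -(2 * Real.pi * P.k 0)⁻¹ * (P.ω + P.ω')
  d₁ := P.ω'
  d₂ := (2 * Real.pi * P.k 0)⁻¹ * (2 * P.ω')
  symm x y := by
    rw [convKernel_apply, convKernel_apply, ← P.even (x - y), neg_sub]; ring
  hasDeriv_K x y := by
    have h1 : HasDerivAt (fun s => P.k (s - y)) (P.k' (x - y)) x := by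
      simpa [Function.comp_def] using
        (P.hasDeriv_k (x - y)).scomp x ((hasDerivAt_id x).sub_const y)
    exact h1.sub (((P.hasDeriv_k x).mul_const (P.k 0)⁻¹).mul_const (P.k y))
  hasDeriv_φ := P.hasDeriv_condWave P.ω
  hasDeriv_ψ := P.hasDeriv_condWave P.ω'
  hasDeriv_e := P.hasDeriv_e
  hasDeriv_m x := (P.hasDeriv_e x).const_mul _
  commutator x y := by
    have h1 := P.form x y
    have h2 := P.form_zero x
    have h3 := P.form_zero y
    simp only [convKernel_apply, condWave_apply]
    push_cast
    rw [div_mul_div_comm, div_mul_div_comm, ← sub_div, ← sq, sqrt_sq, eq_div_iff two_pi_ne,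
      div_eq_mul_inv, div_eq_mul_inv]
    linear_combination h1 - (P.k 0 : ℂ)⁻¹ * P.k y * h2 + (P.k 0 : ℂ)⁻¹ * P.k x * h3
  dilation x y := by
    have h0 : (P.k 0 : ℂ)⁻¹ * P.k 0 = 1 := inv_mul_cancel₀ (Complex.ofReal_ne_zero.2 P.k_zero)
    have h1 := P.form_deriv x y
    have h2 := P.form_deriv x 0
    have h3 := P.form_deriv 0 y
    have h4 := P.form_deriv 0 0
    simp only [P.e_zero, sub_zero, zero_sub, wave_zero, mul_one, one_mul, P.k'_neg, P.even,
      Complex.ofReal_neg, mul_zero, zero_mul, zero_add] at h2 h3 h4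
    simp only [convKernel_apply, condWave_apply, ContinuousMap.coe_mk, ← neg_sub x y, P.k'_neg]
    push_cast
    rw [mul_assoc (-(P.ω' : ℂ)), mul_assoc (P.ω : ℂ), div_mul_div_comm, div_mul_div_comm,
      mul_div_assoc', mul_div_assoc', ← add_div, ← sq, sqrt_sq, eq_div_iff two_pi_ne]
    simp only [div_eq_mul_inv]
    -- The differentiated form at (x,y), (x,0), (0,y) and (0,0), with weights modelled on the
    -- product of two conditioned waves; h0 cancels k(0).
    linear_combination h1 - (P.k 0 : ℂ)⁻¹ * P.k y * h2 - (P.k 0 : ℂ)⁻¹ * P.k x * h3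
      + (P.k 0 : ℂ)⁻¹ ^ 2 * P.k x * P.k y * h4
      + 2 * Real.pi * Complex.I * P.e' 0 * (P.k 0 : ℂ)⁻¹ * P.k x * P.k y * h0
  deriv_φ x := by
    have h0 : (2 * Real.pi * (P.k 0 : ℂ))⁻¹ * (2 * Real.pi * P.k 0) = 1 :=
      inv_mul_cancel₀ (mul_ne_zero two_pi_ne (Complex.ofReal_ne_zero.2 P.k_zero))
    have h1 := P.form_zero x
    have h2 := P.form_deriv x 0
    have h4 := P.form_deriv 0 0
    simp only [P.e_zero, sub_zero, wave_zero, mul_one, mul_zero, zero_mul, zero_add] at h2 h4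
    simp only [condWave_apply, ContinuousMap.coe_mk]
    have hg : (P.k 0 : ℂ)⁻¹ = 2 * Real.pi * (2 * Real.pi * (P.k 0 : ℂ))⁻¹ := by
      rw [mul_inv, ← mul_assoc, mul_inv_cancel₀ two_pi_ne, one_mul]
    simp only [div_eq_mul_inv]
    push_cast
    rw [hg]
    generalize (2 * Real.pi * (P.k 0 : ℂ))⁻¹ = g at h0 ⊢
    generalize ((√(2 * Real.pi) : ℝ) : ℂ)⁻¹ = t
    linear_combination t * (-g * h2 + 2 * Real.pi * g ^ 2 * P.k x * h4 + P.ω * g * h1)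
      + t * 2 * Real.pi * g * Complex.I * P.e' 0 * P.k x * h0
      - t * P.ω * P.e x * wave P.ω x * Complex.I_sq
  deriv_ψ x := by
    have h0 : (2 * Real.pi * (P.k 0 : ℂ))⁻¹ * (2 * Real.pi * P.k 0) = 1 :=
      inv_mul_cancel₀ (mul_ne_zero two_pi_ne (Complex.ofReal_ne_zero.2 P.k_zero))
    have h1 := P.form_zero x
    have h2 := P.form_deriv x 0
    have h4 := P.form_deriv 0 0
    simp only [P.e_zero, sub_zero, wave_zero, mul_one, mul_zero, zero_mul, zero_add] at h2 h4
    simp only [condWave_apply, ContinuousMap.coe_mk]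
    have hg : (P.k 0 : ℂ)⁻¹ = 2 * Real.pi * (2 * Real.pi * (P.k 0 : ℂ))⁻¹ := by
      rw [mul_inv, ← mul_assoc, mul_inv_cancel₀ two_pi_ne, one_mul]
    simp only [div_eq_mul_inv]
    push_cast
    rw [hg]
    generalize (2 * Real.pi * (P.k 0 : ℂ))⁻¹ = g at h0 ⊢
    generalize ((√(2 * Real.pi) : ℝ) : ℂ)⁻¹ = t
    linear_combination t * (-g * h2 + 2 * Real.pi * g ^ 2 * P.k x * h4 + P.ω' * g * h1)
      + t * 2 * Real.pi * g * Complex.I * P.e' 0 * P.k x * h0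
      - t * P.ω' * P.e x * wave P.ω' x * Complex.I_sq

end Profile

end CUEJanossy
end

/-! ### Entire extensions and unique continuation -/

noncomputable section
namespace CUEJanossy
open MeasureTheory

namespace Profile

variable (P : Profile) {a : Fin 2 → ℝ}

/-- The image of the integral operator of a profile consists of restrictions of entire functions. -/
lemma unique_continuation {B : ℝ} (hB : a 1 < B) {f : ℝ → ℝ} (hf : Continuous f)
    (h : ∀ x ∈ Ioo (a 1) B, rop (convKernel P.k) a f x = 0) (x : ℝ) :
    rop (convKernel P.k) a f x = 0 := by
  -- The integrand with the first variable made complex; its integral is entire and equals 𝕂f on the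
  -- real axis.
  set F : ℂ → ℝ → ℂ := fun w z => (P.kc (w - z) - P.kc w * (P.k 0 : ℂ)⁻¹ * P.k z) * f z
  set F' : ℂ → ℝ → ℂ :=
    fun w z => (deriv P.kc (w - z) - deriv P.kc w * (P.k 0 : ℂ)⁻¹ * P.k z) * f z
  have hk : Continuous P.kc := P.entire.continuous
  have hk' : Continuous (deriv P.kc) := P.entire.contDiff.continuous_deriv le_top
  have hd : Differentiable ℂ fun w => ∫ z in (a 0)..(a 1), F w z := fun w =>
    (hasDerivAt_integral_of_continuous (F := F) (F' := F') (by fun_prop) (by fun_prop)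
      (fun w z => by
        have h1 : HasDerivAt (fun w => P.kc (w - z)) (deriv P.kc (w - z)) w := by
          simpa [Function.comp_def] using
            (P.entire (w - z)).hasDerivAt.comp w ((hasDerivAt_id w).sub_const (z : ℂ))
        exact (h1.sub (((P.entire w).hasDerivAt.mul_const _).mul_const _)).mul_const _)
      (a 0) (a 1) w).differentiableAt
  have hG : ∀ x : ℝ, ∫ z in (a 0)..(a 1), F x z = (rop (convKernel P.k) a f x : ℂ) := by
    intro x
    rw [rop, ← intervalIntegral.integral_ofReal]
    refine intervalIntegral.integral_congr fun z _ => ?_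
    simp only [F, convKernel_apply, ← P.k_coe, ← Complex.ofReal_sub]
    push_cast
    rfl
  have han : AnalyticOnNhd ℝ (fun x : ℝ => ∫ z in (a 0)..(a 1), F x z) univ := fun x _ =>
    ((hd.analyticAt (x : ℂ)).restrictScalars (𝕜 := ℝ)).comp (Complex.ofRealCLM.analyticAt x)
  have hm : (a 1 + B) / 2 ∈ Ioo (a 1) B := ⟨by linarith, by linarith⟩
  have h0 := han.eqOn_zero_of_preconnected_of_eventuallyEq_zero isPreconnected_univ
    (mem_univ ((a 1 + B) / 2)) (by
      filter_upwards [isOpen_Ioo.mem_nhds hm] with y hy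
      rw [hG, h y hy]; simp) (mem_univ x)
  have h1 : (rop (convKernel P.k) a f x : ℂ) = 0 := (hG x).symm.trans h0
  exact_mod_cast h1

/-- Strict contraction follows from the inequality `𝕂² ≤ 𝕂` on a larger interval. -/
lemma contractive_of_le (hab : a 0 ≤ a 1) {B : ℝ} (hB : a 1 < B)
    (hkey : ∀ f : ℝ → ℝ, Continuous f → ∫ x in (a 0)..B, rop (convKernel P.k) a f x ^ 2 ≤
      ∫ x in (a 0)..(a 1), f x * rop (convKernel P.k) a f x) :
    Contractive (ker (convKernel P.k)) a :=
  contractive_of_unique_continuation hab hB hkey fun _ hf h => P.unique_continuation hB hf h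

end Profile

/-! ### The Dirichlet kernel -/

/-- The density `c/(2π) ∑_{|μ| ≤ (N-1)/2} cos(μ c θ)` of the CUE on the scale `c`. -/
def cueDensity (N : ℕ) (c : ℝ) : C(ℝ, ℝ) :=
  ⟨fun θ => c / (2 * Real.pi) *
    ∑ m ∈ Finset.range N, Real.cos ((m - (N - 1) / 2) * (c * θ)), by fun_prop⟩

lemma cueDensity_apply (N : ℕ) (c θ : ℝ) : cueDensity N c θ = c / (2 * Real.pi) *
    ∑ m ∈ Finset.range N, Real.cos ((m - (N - 1) / 2) * (c * θ)) := rfl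

lemma cueDensity_zero (N : ℕ) (c : ℝ) : cueDensity N c 0 = c / (2 * Real.pi) * N := by
  simp [cueDensity_apply]

lemma cueDensity_neg (N : ℕ) (c θ : ℝ) : cueDensity N c (-θ) = cueDensity N c θ := by
  simp [cueDensity_apply]

/-- Telescoping: 2 sin(θ/2)cos(μθ) = sin((μ+½)θ) - sin((μ-½)θ). -/
lemma sin_mul_cueDensity (N : ℕ) (c θ : ℝ) : Real.sin (c * θ / 2) * cueDensity N c θ =
    c / (2 * Real.pi) * Real.sin (N * (c * θ) / 2) := by
  have h := Finset.sum_range_sub (fun m : ℕ => Real.sin ((m - N / 2) * (c * θ))) N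
  have h1 : ∀ m : ℕ, Real.sin (((m + 1 : ℕ) - N / 2) * (c * θ)) - Real.sin ((m - N / 2) * (c * θ)) =
      2 * Real.sin (c * θ / 2) * Real.cos ((m - (N - 1) / 2) * (c * θ)) := by
    intro m
    rw [Real.sin_sub_sin]
    congr 2
    · congr 1; push_cast; ring
    · push_cast; ring
  simp only [h1, ← Finset.mul_sum] at h
  have h2 : Real.sin ((N - N / 2) * (c * θ)) = Real.sin (N * (c * θ) / 2) := by congr 1; ring
  have h3 : Real.sin (((0 : ℕ) - N / 2) * (c * θ)) = -Real.sin (N * (c * θ) / 2) := by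
    rw [← Real.sin_neg]; congr 1; push_cast; ring
  rw [h2, h3] at h
  rw [cueDensity_apply]
  linear_combination c / (2 * Real.pi) / 2 * h

lemma integral_cos_period {c : ℝ} (hc : c ≠ 0) (n : ℤ) (b d : ℝ) :
    ∫ y in d..(d + 2 * Real.pi / c), Real.cos (n * (c * y) + b) =
      if n = 0 then 2 * Real.pi / c * Real.cos b else 0 := by
  split_ifs with hn
  · simp [hn]
  · have hn' : (n : ℝ) * c ≠ 0 := mul_ne_zero (Int.cast_ne_zero.2 hn) hc
    have h1 : ∀ y : ℝ, (n : ℝ) * (c * y) + b = (n * c) * y + b := fun y => by ring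
    simp only [h1]
    rw [intervalIntegral.integral_comp_mul_add (fun y => Real.cos y) hn', integral_cos]
    have h2 : (n : ℝ) * c * (d + 2 * Real.pi / c) + b = (n * c * d + b) + n * (2 * Real.pi) := by
      field_simp
      ring
    rw [h2, Real.sin_add_int_mul_two_pi, sub_self, smul_zero]

/-- The frequencies may be half-integers, but their sums and differences are integers, so products
are periodic. Two terms survive because the frequency set is symmetric: equal frequencies n = m and
opposite ones n = N-1-m. -/
lemma integral_cos_mul_cos {N m n : ℕ} (hm : m < N) {c : ℝ} (hc : c ≠ 0) (d x z : ℝ) :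
    ∫ y in d..(d + 2 * Real.pi / c), Real.cos ((m - (N - 1) / 2) * (c * (y - x))) *
        Real.cos ((n - (N - 1) / 2) * (c * (y - z))) =
      Real.pi / c * ((if n = m then Real.cos ((m - (N - 1) / 2) * (c * (x - z))) else 0) +
        if n = N - 1 - m then Real.cos ((m - (N - 1) / 2) * (c * (x - z))) else 0) := by
  have hT : ∀ y : ℝ, Real.cos ((m - (N - 1) / 2) * (c * (y - x))) *
        Real.cos ((n - (N - 1) / 2) * (c * (y - z))) =
      1 / 2 * (Real.cos (((m - n : ℤ) : ℝ) * (c * y) +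
          (-((m - (N - 1) / 2) * (c * x)) + (n - (N - 1) / 2) * (c * z))) +
        Real.cos (((m + n - (N - 1) : ℤ) : ℝ) * (c * y) +
          (-((m - (N - 1) / 2) * (c * x)) - (n - (N - 1) / 2) * (c * z)))) := by
    intro y
    have e1 : ((m - n : ℤ) : ℝ) * (c * y) +
        (-((m - (N - 1) / 2) * (c * x)) + (n - (N - 1) / 2) * (c * z)) =
        (m - (N - 1) / 2) * (c * (y - x)) - (n - (N - 1) / 2) * (c * (y - z)) := by
      push_cast; ring
    have e2 : ((m + n - (N - 1) : ℤ) : ℝ) * (c * y) +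
        (-((m - (N - 1) / 2) * (c * x)) - (n - (N - 1) / 2) * (c * z)) =
        (m - (N - 1) / 2) * (c * (y - x)) + (n - (N - 1) / 2) * (c * (y - z)) := by
      push_cast; ring
    rw [e1, e2, Real.cos_sub, Real.cos_add]
    ring
  simp only [hT]
  rw [intervalIntegral.integral_const_mul, intervalIntegral.integral_add
    (Continuous.intervalIntegrable (by fun_prop) _ _)
    (Continuous.intervalIntegrable (by fun_prop) _ _), integral_cos_period hc,
    integral_cos_period hc]
  have e1 : ((m : ℤ) - n = 0) ↔ n = m := by omega
  have e2 : ((m : ℤ) + n - (N - 1) = 0) ↔ n = N - 1 - m := by omega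
  simp only [e1, e2]
  have g1 : (if n = m then 2 * Real.pi / c * Real.cos (-((m - (N - 1) / 2) * (c * x)) +
      (n - (N - 1) / 2) * (c * z)) else 0) = 2 * Real.pi / c *
        if n = m then Real.cos ((m - (N - 1) / 2) * (c * (x - z))) else 0 := by
    split_ifs with h
    · rw [h, ← Real.cos_neg]; congr 2; ring
    · simp
  have g2 : (if n = N - 1 - m then 2 * Real.pi / c * Real.cos (-((m - (N - 1) / 2) * (c * x)) -
      (n - (N - 1) / 2) * (c * z)) else 0) = 2 * Real.pi / c *
        if n = N - 1 - m then Real.cos ((m - (N - 1) / 2) * (c * (x - z))) else 0 := by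
    split_ifs with h
    · have : (n : ℝ) = N - 1 - m := by
        rw [h, Nat.cast_sub (by omega), Nat.cast_sub (by omega)]; simp
      rw [this, ← Real.cos_neg]; congr 2; ring
    · simp
  rw [g1, g2]
  ring

lemma cueDensity_reproducing (N : ℕ) {c : ℝ} (hc : c ≠ 0) (d x z : ℝ) :
    ∫ y in d..(d + 2 * Real.pi / c), cueDensity N c (y - x) * cueDensity N c (y - z) =
      cueDensity N c (x - z) := by
  have h1 : ∀ y, cueDensity N c (y - x) * cueDensity N c (y - z) = (c / (2 * Real.pi)) ^ 2 *
      ∑ m ∈ Finset.range N, ∑ n ∈ Finset.range N,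
        Real.cos ((m - (N - 1) / 2) * (c * (y - x))) *
          Real.cos ((n - (N - 1) / 2) * (c * (y - z))) := by
    intro y
    rw [cueDensity_apply, cueDensity_apply, ← Finset.sum_mul_sum]; ring
  simp only [h1]
  rw [intervalIntegral.integral_const_mul, intervalIntegral.integral_finsetSum fun m _ =>
    Continuous.intervalIntegrable (by fun_prop) _ _]
  have h2 : ∀ m ∈ Finset.range N, ∫ y in d..(d + 2 * Real.pi / c), ∑ n ∈ Finset.range N,
        Real.cos ((m - (N - 1) / 2) * (c * (y - x))) *
          Real.cos ((n - (N - 1) / 2) * (c * (y - z))) =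
      2 * Real.pi / c * Real.cos ((m - (N - 1) / 2) * (c * (x - z))) := by
    intro m hm
    rw [intervalIntegral.integral_finsetSum fun n _ =>
      Continuous.intervalIntegrable (by fun_prop) _ _]
    have hm' := Finset.mem_range.1 hm
    simp only [integral_cos_mul_cos hm' hc]
    rw [← Finset.mul_sum, Finset.sum_add_distrib, Finset.sum_ite_eq' _ m,
      Finset.sum_ite_eq' _ (N - 1 - m), if_pos hm, if_pos (Finset.mem_range.2 (by omega))]
    ring
  rw [Finset.sum_congr rfl h2, ← Finset.mul_sum, cueDensity_apply, ← mul_assoc]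
  congr 1
  field_simp

/-- Subtracting K(x,0)K(0,0)⁻¹K(0,y) from a projection kernel removes the direction K(·,0); what
remains is again a projection kernel. -/
lemma convKernel_reproducing {k : C(ℝ, ℝ)} (h0 : k 0 ≠ 0) {c d : ℝ}
    (h : ∀ x z, ∫ y in c..d, k (y - x) * k (y - z) = k (x - z)) (hs : ∀ x, k (-x) = k x) (x z : ℝ) :
    ∫ y in c..d, convKernel k (y, x) * convKernel k (y, z) = convKernel k (x, z) := by
  have h1 : ∀ y, convKernel k (y, x) * convKernel k (y, z) =
      k (y - x) * k (y - z) - ((k 0)⁻¹ * k z) * (k (y - x) * k (y - 0)) -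
        ((k 0)⁻¹ * k x) * (k (y - 0) * k (y - z)) +
        ((k 0)⁻¹ * k x * ((k 0)⁻¹ * k z)) * (k (y - 0) * k (y - 0)) := by
    intro y; simp only [convKernel_apply, sub_zero]; ring
  have hi : ∀ x z : ℝ, IntervalIntegrable (fun y => k (y - x) * k (y - z)) volume c d := fun x z =>
    Continuous.intervalIntegrable (by fun_prop) _ _
  simp only [h1]
  rw [intervalIntegral.integral_add
      ((((hi _ _).sub ((hi _ _).const_mul _))).sub ((hi _ _).const_mul _)) ((hi _ _).const_mul _),
    intervalIntegral.integral_sub ((hi _ _).sub ((hi _ _).const_mul _)) ((hi _ _).const_mul _),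
    intervalIntegral.integral_sub (hi _ _) ((hi _ _).const_mul _)]
  simp only [intervalIntegral.integral_const_mul, h]
  simp only [sub_zero, zero_sub, hs, convKernel_apply]
  field_simp
  ring

end CUEJanossy
end

/-! ### The CUE and sine profiles and their contraction property -/

noncomputable section
namespace CUEJanossy
open MeasureTheory

/-- `(e^{icx} - 1)/c`. -/
def cueExp (c : ℝ) : C(ℝ, ℂ) := ⟨fun x => (wave c x - 1) / c, by fun_prop⟩

lemma cueExp_apply (c x : ℝ) : cueExp c x = (wave c x - 1) / c := rfl

lemma wave_mul_cueExp {c : ℝ} (x y : ℝ) :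
    c * (cueExp c x - cueExp c y) = wave c x - wave c y := by
  rw [cueExp_apply, cueExp_apply]
  rcases eq_or_ne c 0 with rfl | hc
  · simp
  · have : (c : ℂ) ≠ 0 := Complex.ofReal_ne_zero.2 hc
    field_simp
    ring

/-- The profile of the CUE on the scale `c`. -/
def cueProfile (N : ℕ) (c : ℝ) (hN : 1 ≤ N) (hc : c ≠ 0) : Profile where
  k := cueDensity N c
  kc w := c / (2 * Real.pi) *
    ∑ m ∈ Finset.range N, Complex.cos ((m - (N - 1) / 2) * (c * w))
  e := cueExp c
  e' := ⟨fun x => Complex.I * wave c x, by fun_prop⟩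
  -- The waves e^{±icNx/2} are multiplied by e^{icx/2}, which makes sin(c(x-y)/2) a multiple of
  -- e(x)-e(y); this shifts the frequencies ±cN/2 by c/2.
  ω := c * ((N + 1) / 2)
  ω' := -(c * ((N - 1) / 2))
  entire := by fun_prop
  k_coe x := by rw [cueDensity_apply]; push_cast; rfl
  even := cueDensity_neg N c
  k_zero := by
    rw [cueDensity_zero]
    have : (N : ℝ) ≠ 0 := by positivity
    have := Real.pi_ne_zero
    positivity
  hasDeriv_e x := by
    refine (((Profile.hasDeriv_wave c x).sub_const 1).div_const (c : ℂ)).congr_deriv ?_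
    have : (c : ℂ) ≠ 0 := Complex.ofReal_ne_zero.2 hc
    simp only [ContinuousMap.coe_mk]
    field_simp
  e_zero := by simp [cueExp_apply]
  form x y := by
    have hc' : (c : ℂ) ≠ 0 := Complex.ofReal_ne_zero.2 hc
    have h1 := congrArg (fun t : ℝ => (t : ℂ)) (sin_mul_cueDensity N c (x - y))
    have h2 := wave_mul_cueExp (c := c) x y
    simp only [wave_apply] at h2 ⊢
    have hp := Profile.two_pi_ne
    refine mul_left_cancel₀ hc' ?_
    -- Factoring out the midpoint exponential turns both differences into sines, and the claim into
    -- `sin_mul_cueDensity`.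
    have h3 : ∀ s t : ℂ, Complex.exp s - Complex.exp t =
        2 * Complex.I * Complex.exp ((s + t) / 2) * Complex.sin (-Complex.I * (s - t) / 2) := by
      intro s t
      have e1 : -Complex.I * (s - t) / 2 * Complex.I = (s - t) / 2 := by
        linear_combination (-(s - t) / 2) * Complex.I_sq
      rw [Complex.sin, neg_mul, e1]
      have e2 : Complex.exp s = Complex.exp ((s + t) / 2) * Complex.exp ((s - t) / 2) := by
        rw [← Complex.exp_add]; congr 1; ring
      have e3 : Complex.exp t = Complex.exp ((s + t) / 2) * Complex.exp (-((s - t) / 2)) := by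
        rw [← Complex.exp_add]; congr 1; ring
      rw [e2, e3]
      linear_combination (Complex.exp ((s + t) / 2) * (Complex.exp ((s - t) / 2)
        - Complex.exp (-((s - t) / 2)))) * Complex.I_sq
    rw [← Complex.exp_add, ← Complex.exp_add, h3]
    rw [h3] at h2
    push_cast at h1 h2 ⊢
    have a1 : (Complex.I * (c * ((N + 1) / 2)) * x + Complex.I * -(c * ((N - 1) / 2)) * y +
        (Complex.I * -(c * ((N - 1) / 2)) * x + Complex.I * (c * ((N + 1) / 2)) * y)) / 2 =
        (Complex.I * c * x + Complex.I * c * y) / 2 := by ring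
    have a2 : -Complex.I * (Complex.I * (c * ((N + 1) / 2)) * x +
        Complex.I * -(c * ((N - 1) / 2)) * y - (Complex.I * -(c * ((N - 1) / 2)) * x +
          Complex.I * (c * ((N + 1) / 2)) * y)) / 2 = N * (c * (x - y)) / 2 := by
      linear_combination (-(N * (c * (x - y)) / 2 : ℂ)) * Complex.I_sq
    have a3 : -Complex.I * (Complex.I * c * x - Complex.I * c * y) / 2 = c * (x - y) / 2 := by
      linear_combination (-(c * (x - y) / 2 : ℂ)) * Complex.I_sq
    rw [a1, a2]
    rw [a3] at h2
    set E := Complex.exp ((Complex.I * c * x + Complex.I * c * y) / 2)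
    have h4 : 2 * Real.pi * (c / (2 * Real.pi)) = (c : ℂ) := mul_div_cancel₀ _ hp
    linear_combination (2 * Real.pi * cueDensity N c (x - y)) * h2
      + 2 * Complex.I * E * (2 * Real.pi) * h1
      + 2 * Complex.I * E * Complex.sin (N * (c * (x - y)) / 2) * h4

/-- `sin x / (π x)`. -/
def sineDensity : C(ℝ, ℝ) := ⟨fun x => Real.sinc x / Real.pi, Real.continuous_sinc.div_const _⟩

lemma sineDensity_apply (x : ℝ) : sineDensity x = Real.sinc x / Real.pi := rfl

lemma sineDensity_zero : sineDensity 0 = 1 / Real.pi := by rw [sineDensity_apply, Real.sinc_zero]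

lemma mul_sinc (x : ℝ) : x * Real.sinc x = Real.sin x := by
  rcases eq_or_ne x 0 with rfl | hx
  · simp
  · rw [Real.sinc_of_ne_zero hx, mul_div_cancel₀ _ hx]

/-- The profile of the sine kernel. -/
def sineProfile : Profile where
  k := sineDensity
  kc w := dslope Complex.sin 0 w / Real.pi
  e := ⟨fun x => Complex.I * x, by fun_prop⟩
  e' := ⟨fun _ => Complex.I, by fun_prop⟩
  ω := 1
  ω' := -1
  entire := (differentiableOn_univ.1 ((Complex.differentiableOn_dslope univ_mem).2
    Complex.differentiable_sin.differentiableOn)).div_const _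
  k_coe x := by
    rw [sineDensity_apply]
    rcases eq_or_ne x 0 with rfl | hx
    · simp [dslope_same]
    · rw [dslope_of_ne _ (by simpa using hx), slope_def_field, Real.sinc_of_ne_zero hx]
      push_cast
      simp
  even x := by rw [sineDensity_apply, sineDensity_apply, Real.sinc_neg]
  k_zero := by rw [sineDensity_zero]; positivity
  hasDeriv_e x := by
    simpa using (Complex.ofRealCLM.hasDerivAt (x := x)).const_mul Complex.I
  e_zero := by simp
  form x y := by
    have h1 := congrArg (fun t : ℝ => (t : ℂ)) (mul_sinc (x - y))
    have hp : (Real.pi : ℂ) ≠ 0 := Complex.ofReal_ne_zero.2 Real.pi_ne_zero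
    simp only [wave_apply, sineDensity_apply, ContinuousMap.coe_mk]
    rw [← Complex.exp_add, ← Complex.exp_add]
    push_cast at h1 ⊢
    have e1 : Complex.I * 1 * x + Complex.I * -1 * y = (x - y) * Complex.I := by ring
    have e2 : Complex.I * -1 * x + Complex.I * 1 * y = -(x - y) * Complex.I := by ring
    have h2 : Complex.exp ((x - y) * Complex.I) - Complex.exp (-(x - y) * Complex.I) =
        2 * Complex.I * Complex.sin (x - y) := by
      rw [Complex.sin]
      linear_combination (Complex.exp ((x - y) * Complex.I)
        - Complex.exp (-(x - y) * Complex.I)) * Complex.I_sq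
    rw [e1, e2, h2, ← h1]
    field_simp

/-! ### Strict contraction -/

/-- Over a full period from a₁ there is equality, by the reproducing property; a smaller B only
discards a nonnegative part. -/
lemma cue_energy {N : ℕ} {c : ℝ} (hN : 1 ≤ N) (hc : 0 < c) {a : Fin 2 → ℝ} {B : ℝ}
    (hB : B ≤ a 0 + 2 * Real.pi / c) {f : ℝ → ℝ} (hf : Continuous f) :
    ∫ x in (a 0)..B, rop (convKernel (cueDensity N c)) a f x ^ 2 ≤
      ∫ x in (a 0)..(a 1), f x * rop (convKernel (cueDensity N c)) a f x := by
  have h0 : cueDensity N c 0 ≠ 0 := (cueProfile N c hN hc.ne').k_zero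
  rw [← integral_sq_rop_of_reproducing (convKernel_reproducing h0
    (cueDensity_reproducing N hc.ne' (a 0)) (cueDensity_neg N c)) hf]
  have hcont : Continuous fun x => rop (convKernel (cueDensity N c)) a f x ^ 2 :=
    (continuous_rop hf).pow 2
  rw [← sub_nonneg, intervalIntegral.integral_interval_sub_left (hcont.intervalIntegrable _ _)
    (hcont.intervalIntegrable _ _)]
  exact intervalIntegral.integral_nonneg hB fun _ _ => sq_nonneg _

lemma contractive_cue {N : ℕ} {c : ℝ} (hN : 1 ≤ N) (hc : 0 < c) {a : Fin 2 → ℝ} (hab : a 0 ≤ a 1)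
    (h : a 1 - a 0 < 2 * Real.pi / c) : Contractive (ker (convKernel (cueDensity N c))) a :=
  (cueProfile N c hN hc.ne').contractive_of_le hab (B := a 0 + 2 * Real.pi / c) (by linarith)
    fun _ hf => cue_energy hN hc le_rfl hf

end CUEJanossy
end

noncomputable section
namespace CUEJanossy
open MeasureTheory

/-! ### The large-`N` limit of the profiles -/

/-- Joint convergence implies locally uniform convergence. -/
lemma tendstoLocallyUniformlyOn_of_joint {X E : Type*} [TopologicalSpace X] [PseudoMetricSpace E]
    {F : ℕ → X → E} {G : X → E} {s : Set X} (hs : IsOpen s)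
    (h : ∀ a ∈ s, Tendsto (fun y : ℕ × X => F y.1 y.2) (atTop ×ˢ 𝓝 a) (𝓝 (G a))) :
    TendstoLocallyUniformlyOn F G atTop s := by
  rw [Metric.tendstoLocallyUniformlyOn_iff]
  intro ε hε a ha
  have h1 := (h a ha).eventually (Metric.ball_mem_nhds (G a) (half_pos hε))
  obtain ⟨u, hu, v, hv, huv⟩ := mem_prod_iff.1 h1
  refine ⟨v ∩ s, mem_nhdsWithin_of_mem_nhds (inter_mem hv (hs.mem_nhds ha)), ?_⟩
  filter_upwards [hu] with n hn
  rintro y ⟨hy, hys⟩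
  have h2 : dist (F n y) (G a) < ε / 2 := huv (mk_mem_prod hn hy)
  have h3 : Tendsto (fun m => F m y) atTop (𝓝 (G y)) :=
    (h y hys).comp (tendsto_id.prodMk tendsto_const_nhds)
  -- Continuity of G is not assumed: G y is a limit of values F m y lying within ε/2 of G a.
  have h4 : dist (G y) (G a) ≤ ε / 2 := le_of_tendsto (h3.dist tendsto_const_nhds) (by
    filter_upwards [hu] with m hm
    exact (huv (mk_mem_prod hm hy) : dist (F m y) (G a) < ε / 2).le)
  calc dist (G y) (F n y) ≤ dist (G y) (G a) + dist (F n y) (G a) := dist_triangle_right _ _ _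
    _ < ε := by linarith

lemma tendsto_continuousMap_of_joint {X E : Type*} [TopologicalSpace X] [PseudoMetricSpace E]
    {F : ℕ → C(X, E)} {G : C(X, E)}
    (h : ∀ a, Tendsto (fun y : ℕ × X => F y.1 y.2) (atTop ×ˢ 𝓝 a) (𝓝 (G a))) :
    Tendsto F atTop (𝓝 G) := by
  refine ContinuousMap.tendsto_of_tendstoLocallyUniformly ?_
  rw [← tendstoLocallyUniformlyOn_univ]
  exact tendstoLocallyUniformlyOn_of_joint isOpen_univ fun a _ => h a

lemma tendsto_apply {ι X E : Type*} [TopologicalSpace X] [LocallyCompactSpace X]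
    [TopologicalSpace E] {l : Filter ι} {F : ι → C(X, E)} {G : C(X, E)} {x : ι → X} {a : X}
    (hF : Tendsto F l (𝓝 G)) (hx : Tendsto x l (𝓝 a)) : Tendsto (fun i => F i (x i)) l (𝓝 (G a)) :=
  ((continuous_eval (F := C(X, E))).tendsto (G, a)).comp (hF.prodMk_nhds hx)

lemma tendsto_two_div : Tendsto (fun N : ℕ => 2 / (N : ℝ)) atTop (𝓝 0) :=
  tendsto_const_nhds.div_atTop tendsto_natCast_atTop_atTop

/-- At scale 2/N the density is the limiting density divided by sinc(θ/N), a form that shows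
convergence uniformly near every point. -/
lemma sinc_mul_cueDensity {N : ℕ} (hN : 1 ≤ N) (θ : ℝ) :
    Real.sinc (2 / N * θ / 2) * cueDensity N (2 / N) θ = sineDensity θ := by
  have hN' : (N : ℝ) ≠ 0 := by positivity
  have hp := Real.pi_ne_zero
  rw [sineDensity_apply]
  rcases eq_or_ne θ 0 with rfl | hθ
  · rw [cueDensity_zero]; simp; field_simp
  · have h := sin_mul_cueDensity N (2 / N) θ
    have e1 : (N : ℝ) * (2 / N * θ) / 2 = θ := by field_simp
    rw [e1, ← mul_sinc, ← mul_sinc θ] at h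
    field_simp at h ⊢
    linear_combination h

lemma tendsto_cueDensity :
    Tendsto (fun N : ℕ => cueDensity N (2 / N)) atTop (𝓝 sineDensity) := by
  refine tendsto_continuousMap_of_joint fun θ => ?_
  have h1 : Tendsto (fun y : ℕ × ℝ => Real.sinc (2 / y.1 * y.2 / 2)) (atTop ×ˢ 𝓝 θ) (𝓝 1) := by
    have := ((tendsto_two_div.comp tendsto_fst).mul (tendsto_snd (f := atTop) (g := 𝓝 θ))).div_const 2
    have h2 := (Real.continuous_sinc.tendsto _).comp this
    simpa [Function.comp_def] using h2
  have h2 : Tendsto (fun y : ℕ × ℝ => sineDensity y.2) (atTop ×ˢ 𝓝 θ) (𝓝 (sineDensity θ)) :=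
    (sineDensity.continuous.tendsto θ).comp tendsto_snd
  have h3 := h2.div h1 one_ne_zero
  rw [div_one] at h3
  refine h3.congr' ?_
  have h4 : ∀ᶠ y : ℕ × ℝ in atTop ×ˢ 𝓝 θ, 1 ≤ y.1 := tendsto_fst.eventually (eventually_ge_atTop 1)
  filter_upwards [h1.eventually_ne one_ne_zero, h4] with y hy hN
  rw [Pi.div_apply, div_eq_iff hy, ← sinc_mul_cueDensity hN, mul_comm]

lemma tendsto_convKernel {ks : ℕ → C(ℝ, ℝ)} {k : C(ℝ, ℝ)} (h : Tendsto ks atTop (𝓝 k))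
    (h0 : k 0 ≠ 0) : Tendsto (fun N => convKernel (ks N)) atTop (𝓝 (convKernel k)) := by
  refine tendsto_continuousMap_of_joint fun p => ?_
  have hk : Tendsto (fun y : ℕ × (ℝ × ℝ) => ks y.1) (atTop ×ˢ 𝓝 p) (𝓝 k) := h.comp tendsto_fst
  have h1 : Tendsto (fun y : ℕ × (ℝ × ℝ) => y.2.1) (atTop ×ˢ 𝓝 p) (𝓝 p.1) :=
    (continuous_fst.tendsto p).comp tendsto_snd
  have h2 : Tendsto (fun y : ℕ × (ℝ × ℝ) => y.2.2) (atTop ×ˢ 𝓝 p) (𝓝 p.2) :=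
    (continuous_snd.tendsto p).comp tendsto_snd
  exact (tendsto_apply hk (h1.sub h2)).sub (((tendsto_apply hk h1).mul
    ((tendsto_apply hk tendsto_const_nhds).inv₀ h0)).mul (tendsto_apply hk h2))

lemma tendsto_condWave {ks : ℕ → C(ℝ, ℝ)} {k : C(ℝ, ℝ)} (h : Tendsto ks atTop (𝓝 k))
    (h0 : k 0 ≠ 0) {ωs : ℕ → ℝ} {ω : ℝ} (hω : Tendsto ωs atTop (𝓝 ω)) :
    Tendsto (fun N => condWave (ωs N) (ks N)) atTop (𝓝 (condWave ω k)) := by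
  refine tendsto_continuousMap_of_joint fun x => ?_
  have hk : Tendsto (fun y : ℕ × ℝ => ks y.1) (atTop ×ˢ 𝓝 x) (𝓝 k) := h.comp tendsto_fst
  have h1 : Tendsto (fun y : ℕ × ℝ => wave (ωs y.1) y.2) (atTop ×ˢ 𝓝 x) (𝓝 (wave ω x)) := by
    have hc : Continuous fun p : ℝ × ℝ => Complex.exp (Complex.I * p.1 * p.2) := by fun_prop
    have hω' : Tendsto (fun y : ℕ × ℝ => ωs y.1) (atTop ×ˢ 𝓝 x) (𝓝 ω) := hω.comp tendsto_fst
    have hx : Tendsto (fun y : ℕ × ℝ => y.2) (atTop ×ˢ 𝓝 x) (𝓝 x) := tendsto_snd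
    have h2 := (hc.tendsto (ω, x)).comp (hω'.prodMk_nhds hx)
    simpa only [Function.comp_def, wave_apply] using h2
  have h2 : Tendsto (fun y : ℕ × ℝ => ((ks y.1 y.2 : ℝ) : ℂ)) (atTop ×ˢ 𝓝 x) (𝓝 (k x : ℂ)) :=
    (Complex.continuous_ofReal.tendsto _).comp (tendsto_apply hk tendsto_snd)
  have h3 : Tendsto (fun y : ℕ × ℝ => ((ks y.1 0 : ℝ) : ℂ)) (atTop ×ˢ 𝓝 x) (𝓝 (k 0 : ℂ)) :=
    (Complex.continuous_ofReal.tendsto _).comp (tendsto_apply hk tendsto_const_nhds)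
  simp only [condWave_apply]
  exact (h1.sub (h2.div h3 (Complex.ofReal_ne_zero.2 h0))).div_const _

lemma sineDensity_zero_ne : sineDensity 0 ≠ 0 := sineProfile.k_zero

lemma tendsto_cueKer : Tendsto (fun N : ℕ => convKernel (cueDensity N (2 / N))) atTop
    (𝓝 (convKernel sineDensity)) := tendsto_convKernel tendsto_cueDensity sineDensity_zero_ne

lemma tendsto_cueFreq : Tendsto (fun N : ℕ => 2 / (N : ℝ) * ((N + 1) / 2)) atTop (𝓝 1) := by
  have h := (tendsto_const_nhds (x := (1 : ℝ))).add (tendsto_two_div.div_const 2)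
  rw [zero_div, add_zero] at h
  refine h.congr' ?_
  filter_upwards [eventually_ge_atTop 1] with N hN
  have hN' : (N : ℝ) ≠ 0 := by positivity
  field_simp

lemma tendsto_cueFreq' : Tendsto (fun N : ℕ => -(2 / (N : ℝ) * ((N - 1) / 2))) atTop (𝓝 (-1)) := by
  have h := ((tendsto_const_nhds (x := (1 : ℝ))).sub (tendsto_two_div.div_const 2)).neg
  rw [zero_div, sub_zero] at h
  refine h.congr' ?_
  filter_upwards [eventually_ge_atTop 1] with N hN
  have hN' : (N : ℝ) ≠ 0 := by positivity
  field_simp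

/-- `(e^{icx} - 1)/c → ix` as `c → 0`. -/
lemma tendsto_cueExp {ι : Type*} {l : Filter ι} {cs xs : ι → ℝ} {x : ℝ} (hc : Tendsto cs l (𝓝 0))
    (hc0 : ∀ᶠ i in l, cs i ≠ 0) (hx : Tendsto xs l (𝓝 x)) :
    Tendsto (fun i => cueExp (cs i) (xs i)) l (𝓝 (Complex.I * x)) := by
  have hd : Continuous (dslope Complex.exp 0) := (differentiableOn_univ.1
    ((Complex.differentiableOn_dslope univ_mem).2
      Complex.differentiable_exp.differentiableOn)).continuous
  have hg : Continuous fun p : ℝ × ℝ =>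
      Complex.I * p.2 * dslope Complex.exp 0 (Complex.I * p.1 * p.2) := by fun_prop
  have h := (hg.tendsto (0, x)).comp (hc.prodMk_nhds hx)
  simp only [Complex.ofReal_zero, mul_zero, zero_mul, dslope_same, Complex.deriv_exp,
    Complex.exp_zero, mul_one] at h
  refine h.congr' ?_
  filter_upwards [hc0] with i hi
  have hi' : (cs i : ℂ) ≠ 0 := Complex.ofReal_ne_zero.2 hi
  simp only [Function.comp_apply, cueExp_apply, wave_apply]
  rcases eq_or_ne (xs i) 0 with h0 | h0
  · simp [h0]
  · have h0' : (xs i : ℂ) ≠ 0 := Complex.ofReal_ne_zero.2 h0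
    rw [dslope_of_ne _ (mul_ne_zero (mul_ne_zero Complex.I_ne_zero hi') h0'), slope_def_field,
      sub_zero, Complex.exp_zero]
    field_simp [Complex.I_ne_zero]

/-! ### Strict contraction for the sine kernel -/

lemma continuous_energy {f : ℝ → ℝ} (hf : Continuous f) (a : Fin 2 → ℝ) (B : ℝ) :
    Continuous (fun K : C(ℝ × ℝ, ℝ) => ∫ x in (a 0)..B, rop K a f x ^ 2) ∧
    Continuous (fun K : C(ℝ × ℝ, ℝ) => ∫ x in (a 0)..(a 1), f x * rop K a f x) := by
  have h : Continuous fun p : C(ℝ × ℝ, ℝ) × ℝ => rop p.1 a f p.2 := by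
    refine intervalIntegral.continuous_parametric_intervalIntegral_of_continuous' ?_ _ _
    exact (Continuous.eval (by fun_prop) (by fun_prop)).mul (hf.comp continuous_snd)
  exact ⟨intervalIntegral.continuous_parametric_intervalIntegral_of_continuous' (h.pow 2) _ _,
    intervalIntegral.continuous_parametric_intervalIntegral_of_continuous'
      ((hf.comp continuous_snd).mul h) _ _⟩

/-- The interval [a₁, a₂+1] is shorter than the CUE period πN for large N, so the energy inequality
holds for the rescaled CUE kernels and survives the limit. Strictness is recovered afterwards by
unique continuation. -/
lemma contractive_sine {a : Fin 2 → ℝ} (hab : a 0 ≤ a 1) :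
    Contractive (ker (convKernel sineDensity)) a := by
  refine sineProfile.contractive_of_le hab (lt_add_one (a 1)) fun f hf => ?_
  obtain ⟨h1, h2⟩ := continuous_energy hf a (a 1 + 1)
  refine le_of_tendsto_of_tendsto ((h1.tendsto _).comp tendsto_cueKer)
    ((h2.tendsto _).comp tendsto_cueKer) ?_
  obtain ⟨M, hM⟩ := exists_nat_gt (a 1 + 1 - a 0)
  filter_upwards [eventually_ge_atTop 1, eventually_ge_atTop M] with N hN hNM
  have hN' : (0 : ℝ) < N := by positivity
  refine cue_energy hN (by positivity) ?_ hf
  have e : 2 * Real.pi / (2 / N) = Real.pi * N := by field_simp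
  have : (M : ℝ) ≤ N := by exact_mod_cast hNM
  rw [e]
  nlinarith [Real.pi_gt_three]

end CUEJanossy
end

noncomputable section
namespace CUEJanossy
open MeasureTheory

/-! ### Change of scale -/

section Scale

variable {E : Type*} [NormedAddCommGroup E] [NormedSpace ℝ E] (K : ℝ → ℝ → ℝ) (a : Fin 2 → ℝ)
  (c : ℝ)

lemma kernelIter_scale (f : ℝ → E) (n : ℕ) (x : ℝ) : kernelIter K (c • a) f n (c * x) =
    kernelIter (fun x z => c * K (c * x) (c * z)) a (fun x => f (c * x)) n x := by
  induction n generalizing x with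
  | zero => rfl
  | succ n ih =>
    simp only [kernelIter, Pi.smul_apply, smul_eq_mul, mul_smul]
    rw [← intervalIntegral.smul_integral_comp_mul_left, ← intervalIntegral.integral_smul]
    simp only [ih]

lemma resolvent_scale (f : ℝ → E) (x : ℝ) : resolvent K (c • a) f (c * x) =
    resolvent (fun x z => c * K (c * x) (c * z)) a (fun x => f (c * x)) x := by
  simp only [resolvent, kernelIter_scale]

lemma kernelIter_const_smul (f : ℝ → E) (n : ℕ) (x : ℝ) :
    kernelIter K a (fun z => c • f z) n x = c • kernelIter K a f n x := by
  induction n generalizing x with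
  | zero => rfl
  | succ n ih =>
    simp only [kernelIter, ih]
    rw [← intervalIntegral.integral_smul]
    simp only [smul_comm c]

lemma resolvent_const_smul (f : ℝ → E) (x : ℝ) :
    resolvent K a (fun z => c • f z) x = c • resolvent K a f x := by
  simp only [resolvent, kernelIter_const_smul]
  exact tsum_const_smul'' c

lemma traceSucc_scale (n : ℕ) : traceSucc K (c • a) n =
    traceSucc (fun x z => c * K (c * x) (c * z)) a n := by
  simp only [traceSucc, Pi.smul_apply, smul_eq_mul]
  rw [← intervalIntegral.smul_integral_comp_mul_left, ← intervalIntegral.integral_smul]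
  refine intervalIntegral.integral_congr fun x _ => ?_
  simp only [kernelIter_scale]
  rw [← kernelIter_const_smul]
  rfl

lemma fredholmDet_scale : fredholmDet K (c • a) =
    fredholmDet (fun x z => c * K (c * x) (c * z)) a := by
  simp only [fredholmDet, traceSucc_scale]

end Scale

/-! ### The CUE kernel on the scale `c` -/

section CUE

variable {N : ℕ} {c : ℝ}

lemma abs_lt_iff_scale (hc : 0 < c) {x : ℝ} (hx : |x| < 2 * Real.pi / c) :
    -(2 * Real.pi) < c * x ∧ c * x < 2 * Real.pi := by
  rw [lt_div_iff₀ hc, mul_comm, ← abs_of_pos hc, ← abs_mul] at hx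
  exact abs_lt.1 hx

/-- The bound on x - y excludes nonzero multiples of the period, where division by zero in
`cueKernel` does not give the continuous value. -/
lemma cueKernel_scale (hc : 0 < c) {x y : ℝ} (h : |x - y| < 2 * Real.pi / c) :
    c * cueKernel N (c * x) (c * y) = cueDensity N c (x - y) := by
  rcases eq_or_ne x y with rfl | hxy
  · rw [cueKernel, if_pos rfl, sub_self, cueDensity_zero]; ring
  · have hne : c * x ≠ c * y := fun h => hxy (mul_left_cancel₀ hc.ne' h)
    obtain ⟨h1, h2⟩ := abs_lt_iff_scale hc h
    have hs : Real.sin (c * (x - y) / 2) ≠ 0 := by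
      rw [Ne, Real.sin_eq_zero_iff_of_lt_of_lt (by linarith) (by linarith)]
      have := mul_ne_zero hc.ne' (sub_ne_zero.2 hxy)
      positivity
    have h3 := sin_mul_cueDensity N c (x - y)
    have hp := Real.pi_ne_zero
    rw [cueKernel, if_neg hne, ← mul_sub]
    field_simp at h3 ⊢
    linear_combination -h3

lemma conditioned_cue_scale (hc : 0 < c) {x y : ℝ} (hx : |x| < 2 * Real.pi / c)
    (hy : |y| < 2 * Real.pi / c) (h : |x - y| < 2 * Real.pi / c) :
    c * conditioned (cueKernel N) (c * x) (c * y) = convKernel (cueDensity N c) (x, y) := by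
  have h0 : |(0 : ℝ) - 0| < 2 * Real.pi / c := by
    rw [sub_zero, abs_zero]; positivity
  have e1 := cueKernel_scale (N := N) hc h
  have e2 := cueKernel_scale (N := N) hc (x := x) (y := 0) (by rwa [sub_zero])
  have e3 := cueKernel_scale (N := N) hc (x := 0) (y := y) (by rwa [zero_sub, abs_neg])
  have e4 := cueKernel_scale (N := N) hc h0
  rw [mul_zero, sub_zero] at e2 e4
  rw [mul_zero, zero_sub, cueDensity_neg] at e3
  rw [conditioned, convKernel_apply, ← e1, ← e2, ← e3, ← e4, mul_inv]
  field_simp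

/-- The integrable form at y = 0, divided by k(0). It identifies φ̃ and ψ̃ as plane waves
conditioned on a particle at the origin. -/
lemma cueRatio_scale (hN : 1 ≤ N) (hc : 0 < c) {x : ℝ} (hx : |x| < 2 * Real.pi / c) :
    Complex.exp (Complex.I * ((c * x : ℝ) : ℂ) / 2) * cueRatio N (c * x) =
      cueDensity N c x / cueDensity N c 0 := by
  have hc' : (c : ℂ) ≠ 0 := Complex.ofReal_ne_zero.2 hc.ne'
  have hN' : (N : ℂ) ≠ 0 := by
    have : N ≠ 0 := by omega
    exact_mod_cast this
  have hp : (Real.pi : ℂ) ≠ 0 := Complex.ofReal_ne_zero.2 Real.pi_ne_zero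
  have h0 : (cueDensity N c 0 : ℂ) ≠ 0 :=
    Complex.ofReal_ne_zero.2 (cueProfile N c hN hc.ne').k_zero
  rcases eq_or_ne x 0 with rfl | hx0
  · simp [cueRatio, h0]
  · have hne : c * x ≠ 0 := mul_ne_zero hc.ne' hx0
    have h1 : Complex.exp (Complex.I * ((c * x : ℝ) : ℂ)) - 1 ≠ 0 := by
      rw [sub_ne_zero, mul_comm]
      intro h
      have h2 := congrArg Complex.re h
      rw [Complex.exp_ofReal_mul_I_re, Complex.one_re] at h2
      obtain ⟨h3, h4⟩ := abs_lt_iff_scale hc hx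
      exact hne ((Real.cos_eq_one_iff_of_lt_of_lt h3 h4).1 h2)
    have h2 := (cueProfile N c hN hc.ne').form_zero x
    simp only [cueProfile, cueExp_apply, wave_apply] at h2
    rw [cueRatio, if_neg hne, cueDensity_zero]
    push_cast at h1 h2 ⊢
    have e1 : Complex.exp (Complex.I * (c * ((N + 1) / 2)) * x) =
        Complex.exp (Complex.I * (c * x) / 2) * Complex.exp (Complex.I * N * (c * x) / 2) := by
      rw [← Complex.exp_add]; congr 1; ring
    have e2 : Complex.exp (Complex.I * -(c * ((N - 1) / 2)) * x) =
        Complex.exp (Complex.I * (c * x) / 2) * Complex.exp (-(Complex.I * N * (c * x) / 2)) := by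
      rw [← Complex.exp_add]; congr 1; ring
    rw [e1, e2, ← mul_sub, mul_assoc Complex.I] at h2
    rw [mul_div_assoc', ← h2]
    generalize Complex.exp (Complex.I * (c * x)) - 1 = t at h1 ⊢
    field_simp

lemma cuePhi_scale (hN : 1 ≤ N) (hc : 0 < c) {x : ℝ} (hx : |x| < 2 * Real.pi / c) :
    cuePhi N (c * x) = condWave (c * ((N + 1) / 2)) (cueDensity N c) x := by
  have h := cueRatio_scale hN hc hx
  rw [cuePhi, condWave_apply, ← h, wave_apply, div_mul_eq_mul_div, mul_sub, ← Complex.exp_add]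
  congr 3
  push_cast; ring

lemma cuePsi_scale (hN : 1 ≤ N) (hc : 0 < c) {x : ℝ} (hx : |x| < 2 * Real.pi / c) :
    cuePsi N (c * x) = condWave (-(c * ((N - 1) / 2))) (cueDensity N c) x := by
  have h := cueRatio_scale hN hc hx
  rw [cuePsi, condWave_apply, ← h, wave_apply, div_mul_eq_mul_div, mul_sub, ← Complex.exp_add]
  congr 3
  push_cast; ring

/-- The integrable kernel of the CUE on the scale `c`. -/
def cueIK (N : ℕ) (c : ℝ) (hN : 1 ≤ N) (hc : 0 < c) : IntegrableKernel :=
  (cueProfile N c hN hc.ne').toIntegrableKernel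

/-- Intervals around the origin shorter than the period. -/
def shortDomain (c : ℝ) : Set (Fin 2 → ℝ) := {a | a ∈ domain ∧ a 1 - a 0 < 2 * Real.pi / c}

lemma isOpen_domain : IsOpen domain :=
  (isOpen_lt (continuous_apply 0) continuous_const).inter
    (isOpen_lt continuous_const (continuous_apply 1))

lemma isOpen_shortDomain (c : ℝ) : IsOpen (shortDomain c) :=
  isOpen_domain.inter (isOpen_lt ((continuous_apply 1).sub (continuous_apply 0)) continuous_const)

lemma domain.le {a : Fin 2 → ℝ} (ha : a ∈ domain) : a 0 ≤ a 1 := (ha.1.trans ha.2).le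

/-- The relations between the CUE quantities and those on the scale `c`. -/
structure ScaledQuantities (Q D : Quantities) (c : ℝ) (a : Fin 2 → ℝ) : Prop where
  q (j : Fin 2) : Q.q j (c • a) = D.q j a
  p (j : Fin 2) : Q.p j (c • a) = D.p j a
  u : Q.u (c • a) = c * D.u a
  w : Q.w (c • a) = c * D.w a
  v : Q.v (c • a) = c * D.v a
  R (j k : Fin 2) : c * Q.R j k (c • a) = D.R j k a
  J : Q.J (c • a) = D.J a

/-- Change of variables x ↦ cx. The factor c of the rescaled kernel is the Jacobian of one
integration; u, w, v carry an outer Jacobian, and R needs c because its column is itself a kernel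
value. -/
lemma quantitiesOf_scale {K K' : ℝ → ℝ → ℝ} {φ ψ φ' ψ' : ℝ → ℂ} {a : Fin 2 → ℝ}
    (hab : a 0 ≤ a 1)
    (hK : ∀ x ∈ Icc (a 0) (a 1), ∀ z ∈ Icc (a 0) (a 1), c * K (c * x) (c * z) = K' x z)
    (hφ : ∀ x ∈ Icc (a 0) (a 1), φ (c * x) = φ' x)
    (hψ : ∀ x ∈ Icc (a 0) (a 1), ψ (c * x) = ψ' x) :
    ScaledQuantities (quantitiesOf K φ ψ) (quantitiesOf K' φ' ψ') c a := by
  have hI : uIcc (a 0) (a 1) = Icc (a 0) (a 1) := uIcc_of_le hab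
  have hsub : uIcc (a 0) (a 1) ⊆ Icc (a 0) (a 1) := hI.subset
  have hj : ∀ j, a j ∈ Icc (a 0) (a 1) := by
    intro j; fin_cases j
    · exact left_mem_Icc.2 hab
    · exact right_mem_Icc.2 hab
  rw [← hI] at hK
  have hK' : ∀ x ∈ Icc (a 0) (a 1), ∀ z ∈ uIcc (a 0) (a 1), c * K (c * x) (c * z) = K' x z := by
    rw [← hI]; exact hK
  have rφ : ∀ x ∈ Icc (a 0) (a 1), resolvent K (c • a) φ (c * x) = resolvent K' a φ' x := by
    intro x hx
    rw [resolvent_scale]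
    exact resolvent_congr hsub hK' hφ x hx
  have rψ : ∀ x ∈ Icc (a 0) (a 1), resolvent K (c • a) ψ (c * x) = resolvent K' a ψ' x := by
    intro x hx
    rw [resolvent_scale]
    exact resolvent_congr hsub hK' hψ x hx
  have hint : ∀ f g f' g' : ℝ → ℂ, (∀ x ∈ Icc (a 0) (a 1), f (c * x) = f' x) →
      (∀ x ∈ Icc (a 0) (a 1), g (c * x) = g' x) →
      ∫ x in ((c • a) 0)..((c • a) 1), f x * g x = c * ∫ x in (a 0)..(a 1), f' x * g' x := by
    intro f g f' g' hf hg
    simp only [Pi.smul_apply, smul_eq_mul]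
    rw [← intervalIntegral.smul_integral_comp_mul_left, Complex.real_smul]
    congr 1
    refine intervalIntegral.integral_congr fun x hx => ?_
    simp only [hf x (hsub hx), hg x (hsub hx)]
  refine ⟨fun j => rφ _ (hj j), fun j => rψ _ (hj j), hint _ _ _ _ hφ rφ, hint _ _ _ _ hψ rψ,
    hint _ _ _ _ hψ rφ, fun j k => ?_, ?_⟩
  · change c * resolvent K (c • a) (fun z => K z (c * a k)) (c * a j) = _
    rw [resolvent_scale, ← smul_eq_mul, ← resolvent_const_smul]
    exact resolvent_congr hsub hK' (fun x hx => hK' x hx _ (hI ▸ hj k)) _ (hj j)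
  · change fredholmDet K (c • a) = fredholmDet K' a
    rw [fredholmDet_scale]
    simp only [fredholmDet]
    congr 2
    refine tsum_congr fun n => ?_
    rw [traceSucc_congr (fun x hx z hz => hK x (hI.symm ▸ hx) z (hI.symm ▸ hz))]

lemma abs_lt_of_shortDomain {a : Fin 2 → ℝ} (ha : a ∈ shortDomain c) {x z : ℝ}
    (hx : x ∈ Icc (a 0) (a 1)) (hz : z ∈ Icc (a 0) (a 1)) :
    |x| < 2 * Real.pi / c ∧ |x - z| < 2 * Real.pi / c := by
  obtain ⟨⟨h0, h1⟩, h2⟩ := ha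
  constructor
  · rw [abs_lt]; constructor <;> linarith [hx.1, hx.2]
  · rw [abs_lt]; constructor <;> linarith [hx.1, hx.2, hz.1, hz.2]

lemma cue_scale (hN : 1 ≤ N) (hc : 0 < c) {a : Fin 2 → ℝ} (ha : a ∈ shortDomain c) :
    ScaledQuantities (cue N) (cueIK N c hN hc).quant c a := by
  refine quantitiesOf_scale (domain.le ha.1) ?_ ?_ ?_
  · intro x hx z hz
    exact conditioned_cue_scale hc (abs_lt_of_shortDomain ha hx hx).1
      (abs_lt_of_shortDomain ha hz hz).1 (abs_lt_of_shortDomain ha hx hz).2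
  · intro x hx
    exact cuePhi_scale hN hc (abs_lt_of_shortDomain ha hx hx).1
  · intro x hx
    exact cuePsi_scale hN hc (abs_lt_of_shortDomain ha hx hx).1

end CUE

end CUEJanossy
end

noncomputable section
namespace CUEJanossy
open MeasureTheory

/-! ### Quantities that agree locally -/

section Agree

variable {a : Fin 2 → ℝ}

lemma pd_congr {E : Type*} [NormedAddCommGroup E] [NormedSpace ℝ E] {F G : (Fin 2 → ℝ) → E}
    (h : F =ᶠ[𝓝 a] G) (k : Fin 2) : pd F k a = pd G k a := by
  have h1 : Tendsto (fun s : ℝ => Function.update a k s) (𝓝 (a k)) (𝓝 a) := by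
    have : Continuous fun s : ℝ => Function.update a k s := by fun_prop
    simpa using this.tendsto (a k)
  exact Filter.EventuallyEq.deriv_eq (h1.eventually h)

/-- Equality of all quantities at a point. -/
structure QuantitiesEq (Q D : Quantities) (a : Fin 2 → ℝ) : Prop where
  q (j : Fin 2) : Q.q j a = D.q j a
  p (j : Fin 2) : Q.p j a = D.p j a
  u : Q.u a = D.u a
  w : Q.w a = D.w a
  v : Q.v a = D.v a
  R (j k : Fin 2) : Q.R j k a = D.R j k a
  J : Q.J a = D.J a

variable {Q D : Quantities}

lemma Regular.congr (h : ∀ᶠ b in 𝓝 a, QuantitiesEq Q D b) (hD : Regular D a) : Regular Q a where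
  q j := (hD.q j).congr_of_eventuallyEq (h.mono fun _ hb => hb.q j)
  p j := (hD.p j).congr_of_eventuallyEq (h.mono fun _ hb => hb.p j)
  u := hD.u.congr_of_eventuallyEq (h.mono fun _ hb => hb.u)
  w := hD.w.congr_of_eventuallyEq (h.mono fun _ hb => hb.w)
  v := hD.v.congr_of_eventuallyEq (h.mono fun _ hb => hb.v)
  J := hD.J.congr_of_eventuallyEq (h.mono fun _ hb => hb.J)
  J_pos := by rw [h.self_of_nhds.J]; exact hD.J_pos

lemma CUESystem.congr {N : ℕ} (h : ∀ᶠ b in 𝓝 a, QuantitiesEq Q D b) (hD : CUESystem N D a) :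
    CUESystem N Q a := by
  have h0 := h.self_of_nhds
  have pq : ∀ j k, pd (Q.q j) k a = pd (D.q j) k a := fun j k =>
    pd_congr (h.mono fun _ hb => hb.q j) k
  have pp : ∀ j k, pd (Q.p j) k a = pd (D.p j) k a := fun j k =>
    pd_congr (h.mono fun _ hb => hb.p j) k
  have pu : ∀ k, pd Q.u k a = pd D.u k a := pd_congr (h.mono fun _ hb => hb.u)
  have pw : ∀ k, pd Q.w k a = pd D.w k a := pd_congr (h.mono fun _ hb => hb.w)
  have pv : ∀ k, pd Q.v k a = pd D.v k a := pd_congr (h.mono fun _ hb => hb.v)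
  have pJ : ∀ k, pd (fun b => Real.log (Q.J b)) k a = pd (fun b => Real.log (D.J b)) k a :=
    pd_congr (h.mono fun _ hb => by simp only [hb.J])
  refine ⟨hD.regular.congr h, ?_, ?_, ?_, ?_, ?_, ?_, ?_, ?_, ?_, ?_⟩ <;>
    simp only [pq, pp, pu, pw, pv, pJ, h0.q, h0.p, h0.u, h0.w, h0.v, h0.R]
  exacts [hD.dq, hD.dp, hD.dq_off, hD.dp_off, hD.du, hD.dw, hD.dv, hD.dlogJ, hD.R_off, hD.R_diag]

end Agree

/-! ### The CUE system -/

lemma cos_ne_of_short {x y : ℝ} (hxy : x ≠ y) (h : |x - y| < 2 * Real.pi) :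
    Complex.exp (Complex.I * x) - Complex.exp (Complex.I * y) ≠ 0 := by
  rw [sub_ne_zero]
  intro he
  have h1 : Complex.exp (((x - y : ℝ) : ℂ) * Complex.I) = 1 := by
    have e1 : ((x - y : ℝ) : ℂ) * Complex.I = Complex.I * x - Complex.I * y := by push_cast; ring
    rw [e1, Complex.exp_sub, he, div_self (Complex.exp_ne_zero _)]
  have h2 := congrArg Complex.re h1
  rw [Complex.exp_ofReal_mul_I_re, Complex.one_re] at h2
  obtain ⟨h3, h4⟩ := abs_lt.1 h
  exact hxy (sub_eq_zero.1 ((Real.cos_eq_one_iff_of_lt_of_lt h3 h4).1 h2))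

lemma cueIK_system {N : ℕ} (hN : 1 ≤ N) {c : ℝ} (hc : 0 < c) {a : Fin 2 → ℝ}
    (ha : a ∈ shortDomain c) : (cueIK N c hN hc).System a :=
  (cueIK N c hN hc).system (domain.le ha.1) (contractive_cue hN hc (domain.le ha.1) (by
    exact ha.2))

lemma cueIK_cueSystem {N : ℕ} (hN : 1 ≤ N) {a : Fin 2 → ℝ} (ha : a ∈ shortDomain 1) :
    CUESystem N (cueIK N 1 hN one_pos).quant a := by
  have h := cueIK_system hN one_pos ha
  have hN' : (N : ℂ) ≠ 0 := by
    have : N ≠ 0 := by omega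
    exact_mod_cast this
  have hp := Profile.two_pi_ne
  -- The density at the origin is N/(2π), the source of the constants 1/N.
  have hγ : (2 * Real.pi * (cueDensity N 1 0 : ℂ))⁻¹ = 1 / N := by
    rw [cueDensity_zero]
    push_cast
    rw [mul_comm (1 / (2 * Real.pi) : ℂ), ← mul_assoc, mul_one_div, mul_div_assoc]
    field_simp
  have he : ∀ x, cueExp 1 x = Complex.exp (Complex.I * x) - 1 := by
    intro x
    rw [cueExp_apply, wave_apply]
    simp
  obtain ⟨h1, h2, h3, h4, h5, h6, h7, h8, h9, h10, h11⟩ := h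
  refine ⟨h1, fun j k hjk => ?_, fun j k hjk => ?_, h4, h5, h6, h7, h8, h9,
    fun j k hjk => ?_, fun j => ?_⟩
  · have h := h2 j k hjk
    generalize (cueIK N 1 hN one_pos).quant = D at h ⊢
    simp only [cueIK, Profile.toIntegrableKernel, cueProfile, ContinuousMap.coe_mk, he] at h
    push_cast at h
    rw [hγ] at h
    simp only [div_eq_mul_inv] at h ⊢
    linear_combination h
  · have h := h3 j k hjk
    generalize (cueIK N 1 hN one_pos).quant = D at h ⊢
    simp only [cueIK, Profile.toIntegrableKernel, cueProfile, ContinuousMap.coe_mk, he] at h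
    push_cast at h
    rw [hγ] at h
    simp only [div_eq_mul_inv] at h ⊢
    linear_combination h
  · have h := h10 j k
    generalize (cueIK N 1 hN one_pos).quant = D at h ⊢
    simp only [cueIK, Profile.toIntegrableKernel, cueProfile, he] at h
    have hne : a j ≠ a k := by
      have := ha.1.1.trans ha.1.2
      fin_cases j <;> fin_cases k <;> first | exact absurd rfl hjk | exact this.ne | exact this.ne'
    have hm : ∀ j, a j ∈ Icc (a 0) (a 1) := by
      intro j; fin_cases j
      · exact left_mem_Icc.2 (domain.le ha.1)
      · exact right_mem_Icc.2 (domain.le ha.1)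
    have h0 := (abs_lt_of_shortDomain ha (hm j) (hm k)).2
    rw [div_one] at h0
    rw [eq_div_iff (cos_ne_of_short hne h0)]
    linear_combination h
  · have h := h11 j
    generalize (cueIK N 1 hN one_pos).quant = D at h ⊢
    simp only [cueIK, Profile.toIntegrableKernel, cueProfile, ContinuousMap.coe_mk, wave_apply,
      Complex.ofReal_one, mul_one] at h
    have h0 : Complex.exp (-(Complex.I * a j)) * Complex.exp (Complex.I * a j) = 1 := by
      rw [← Complex.exp_add]; simp
    linear_combination (-Complex.I * Complex.exp (-(Complex.I * a j))) * h
      - (D.R j j a : ℂ) * h0 + (Complex.exp (-(Complex.I * a j)) *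
        Complex.exp (Complex.I * a j) * (D.R j j a : ℂ)) * Complex.I_sq

lemma cue_eventuallyEq {N : ℕ} (hN : 1 ≤ N) {a : Fin 2 → ℝ} (ha : a ∈ shortDomain 1) :
    ∀ᶠ b in 𝓝 a, QuantitiesEq (cue N) (cueIK N 1 hN one_pos).quant b := by
  filter_upwards [(isOpen_shortDomain 1).mem_nhds ha] with b hb
  have h := cue_scale hN one_pos hb
  obtain ⟨h1, h2, h3, h4, h5, h6, h7⟩ := h
  simp only [one_smul, one_mul, Complex.ofReal_one] at h1 h2 h3 h4 h5 h6 h7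
  exact ⟨h1, h2, h3, h4, h5, h6, h7⟩

theorem cue_system {N : ℕ} (hN : 1 ≤ N) {a : Fin 2 → ℝ} (ha : a ∈ shortDomain 1) :
    CUESystem N (cue N) a := (cueIK_cueSystem hN ha).congr (cue_eventuallyEq hN ha)

lemma wellDefined_of_contractive {K : C(ℝ × ℝ, ℝ)} {K' : ℝ → ℝ → ℝ} {a : Fin 2 → ℝ}
    (hab : a 0 ≤ a 1)
    (hK : ∀ x ∈ Icc (a 0) (a 1), ∀ z ∈ Icc (a 0) (a 1), K' x z = K (x, z))
    (hc : Contractive (ker K) a) : WellDefined K' a := by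
  refine ⟨neumannInverts_of_contractive hab hK hc, neumannInverts_of_contractive hab hK hc, ?_⟩
  have h := summable_traceSucc hab hc
  rw [← uIcc_of_le hab] at hK
  simpa only [traceSucc_congr (K' := ker K) hK] using h

theorem cue_wellDefined {N : ℕ} (hN : 1 ≤ N) {a : Fin 2 → ℝ} (ha : a ∈ shortDomain 1) :
    WellDefined (conditioned (cueKernel N)) a := by
  refine wellDefined_of_contractive (K := convKernel (cueDensity N 1)) (domain.le ha.1) ?_
    (contractive_cue hN one_pos (domain.le ha.1) ha.2)
  intro x hx z hz
  have := conditioned_cue_scale (N := N) one_pos (abs_lt_of_shortDomain ha hx hx).1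
    (abs_lt_of_shortDomain ha hz hz).1 (abs_lt_of_shortDomain ha hx hz).2
  simpa only [one_mul] using this

end CUEJanossy
end

noncomputable section
namespace CUEJanossy
open MeasureTheory

/-! ### Complex conjugation -/

section Conj

variable {K : ℝ → ℝ → ℝ} {a : Fin 2 → ℝ}

lemma intervalIntegral_conj (f : ℝ → ℂ) (c d : ℝ) :
    ∫ x in c..d, conj (f x) = conj (∫ x in c..d, f x) := by
  simp only [intervalIntegral.intervalIntegral_eq_integral_uIoc, integral_conj, Complex.real_smul,
    map_mul, Complex.conj_ofReal]

lemma kernelIter_conj (f : ℝ → ℂ) (n : ℕ) (x : ℝ) :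
    kernelIter K a (fun z => conj (f z)) n x = conj (kernelIter K a f n x) := by
  induction n generalizing x with
  | zero => rfl
  | succ n ih =>
    simp only [kernelIter, ih]
    rw [← intervalIntegral_conj]
    simp only [Complex.real_smul, map_mul, Complex.conj_ofReal]

/-- The kernel is real, so each Neumann iterate commutes with conjugation. -/
lemma resolvent_conj (f : ℝ → ℂ) (x : ℝ) :
    resolvent K a (fun z => conj (f z)) x = conj (resolvent K a f x) := by
  simp only [resolvent, kernelIter_conj]
  exact (Complex.conj_tsum _).symm

lemma pd_conj (F : (Fin 2 → ℝ) → ℂ) (k : Fin 2) :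
    pd (fun b => conj (F b)) k a = conj (pd F k a) := deriv.star

end Conj

/-! ### The sine-kernel system -/

/-- The integrable kernel of the conditioned sine kernel. -/
def sineIK : IntegrableKernel := sineProfile.toIntegrableKernel

/-- The redefinition `u, w, v ↦ 2u, 2w, 2v`. -/
def doubled (D : Quantities) : Quantities where
  q := D.q
  p := D.p
  u a := 2 * D.u a
  w a := 2 * D.w a
  v a := 2 * D.v a
  R := D.R
  J := D.J

lemma conditioned_sine : conditioned sineKernel = ker (convKernel sineDensity) := by
  funext x y
  simp [conditioned, sineKernel, convKernel_apply, sineDensity_apply, Real.sinc_neg]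

lemma sinePhi_eq : sinePhi = condWave 1 sineDensity := by
  funext x
  have hp : (Real.pi : ℂ) ≠ 0 := Complex.ofReal_ne_zero.2 Real.pi_ne_zero
  rw [sinePhi, condWave_apply, sineDensity_zero, sineDensity_apply, wave_apply]
  push_cast
  field_simp

lemma sinePsi_eq : sinePsi = condWave (-1) sineDensity := by
  funext x
  have hp : (Real.pi : ℂ) ≠ 0 := Complex.ofReal_ne_zero.2 Real.pi_ne_zero
  rw [sinePsi, condWave_apply, sineDensity_zero, sineDensity_apply, wave_apply]
  push_cast
  field_simp

lemma sine_eq : sine = doubled sineIK.quant := by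
  rw [sine, conditioned_sine, sinePhi_eq, sinePsi_eq]
  rfl

lemma sinePsi_eq_conj (x : ℝ) : sinePsi x = conj (sinePhi x) := by
  simp [sinePsi, sinePhi, ← Complex.exp_conj]

lemma sine_p_eq (j : Fin 2) (a : Fin 2 → ℝ) : sine.p j a = conj (sine.q j a) := by
  change resolvent _ a sinePsi (a j) = conj (resolvent _ a sinePhi (a j))
  rw [← resolvent_conj]
  simp only [← sinePsi_eq_conj]

lemma sine_w_eq (a : Fin 2 → ℝ) : sine.w a = conj (sine.u a) := by
  change 2 * (∫ x in (a 0)..(a 1), sinePsi x * resolvent _ a sinePsi x) =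
    conj (2 * ∫ x in (a 0)..(a 1), sinePhi x * resolvent _ a sinePhi x)
  rw [map_mul, ← intervalIntegral_conj, Complex.conj_ofNat]
  simp only [map_mul, ← resolvent_conj, ← sinePsi_eq_conj]

lemma Regular.doubled {D : Quantities} {a : Fin 2 → ℝ} (h : Regular D a) :
    Regular (doubled D) a where
  q := h.q
  p := h.p
  u := h.u.const_mul 2
  w := h.w.const_mul 2
  v := h.v.const_mul 2
  J := h.J
  J_pos := h.J_pos

lemma pd_const_mul {F : (Fin 2 → ℝ) → ℂ} (c : ℂ) (k : Fin 2) (a : Fin 2 → ℝ) :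
    pd (fun b => c * F b) k a = c * pd F k a := deriv_const_mul_field c

theorem sine_wellDefined {a : Fin 2 → ℝ} (ha : a ∈ domain) : WellDefined (conditioned sineKernel) a :=
  wellDefined_of_contractive (K := convKernel sineDensity) (domain.le ha)
    (fun x _ z _ => by rw [conditioned_sine]) (contractive_sine (domain.le ha))

lemma sineIK_system {a : Fin 2 → ℝ} (hab : a 0 ≤ a 1) : sineIK.System a :=
  sineIK.system hab (contractive_sine hab)

theorem sine_system {a : Fin 2 → ℝ} (ha : a ∈ domain) : SineSystem sine a := by
  obtain ⟨h1, h2, h3, h4, h5, h6, h7, h8, h9, h10, h11⟩ := sineIK_system (domain.le ha)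
  have hp := sine_p_eq
  have hw := sine_w_eq a
  rw [sine_eq] at hp hw ⊢
  have hp' : ∀ j, conj (sineIK.quant.q j a) = sineIK.quant.p j a := fun j => (hp j a).symm
  have hq' : ∀ j, conj (sineIK.quant.p j a) = sineIK.quant.q j a := fun j => by
    rw [← hp', Complex.conj_conj]
  have hpd : ∀ j k, pd (sineIK.quant.p j) k a = conj (pd (sineIK.quant.q j) k a) := fun j k => by
    rw [← pd_conj]; exact congrArg (fun F => pd F k a) (funext (hp j))
  -- The density 1/π gives 1/2; together with the doubling of u and w this produces u - 1 and w - 1.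
  have hγ : (2 * Real.pi * (sineDensity 0 : ℂ))⁻¹ = 1 / 2 := by
    have hp : (Real.pi : ℂ) ≠ 0 := Complex.ofReal_ne_zero.2 Real.pi_ne_zero
    rw [sineDensity_zero]
    push_cast
    field_simp
  refine ⟨h1.doubled, fun j => hp j a, hw, fun j k hjk => ?_, fun j k hjk => ?_, h4, fun j => ?_, h9,
    fun j k hjk => ?_, fun j => ?_⟩
  · have h := h2 j k hjk
    simp only [doubled, hp'] at h ⊢
    generalize sineIK.quant = D at h ⊢
    simp only [sineIK, Profile.toIntegrableKernel, sineProfile, ContinuousMap.coe_mk] at h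
    push_cast at h
    rw [hγ] at h
    linear_combination h + (a j * pd (D.q j) j a + sgn k * a k * D.R j k a * D.q k a) * Complex.I_sq
  · have h := h3 j k hjk
    simp only [doubled, hq'] at h ⊢
    generalize sineIK.quant = D at h ⊢
    simp only [sineIK, Profile.toIntegrableKernel, sineProfile, ContinuousMap.coe_mk] at h
    push_cast at h
    rw [hγ] at h
    linear_combination h + (a j * pd (D.p j) j a + sgn k * a k * D.R j k a * D.p k a) * Complex.I_sq
  · simp only [doubled]
    rw [pd_const_mul, h6]
    ring
  · have h := h10 j k
    simp only [doubled, hp']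
    have hne : (a j : ℂ) - a k ≠ 0 := by
      have := ha.1.trans ha.2
      rw [← Complex.ofReal_sub, Complex.ofReal_ne_zero, sub_ne_zero]
      fin_cases j <;> fin_cases k <;> first | exact absurd rfl hjk | exact this.ne | exact this.ne'
    rw [eq_div_iff (mul_ne_zero Complex.I_ne_zero hne), ← h]
    simp only [sineIK, Profile.toIntegrableKernel, sineProfile, ContinuousMap.coe_mk]
    ring
  · have h := h11 j
    simp only [doubled, hp', ← hpd]
    generalize sineIK.quant = D at h ⊢
    simp only [sineIK, Profile.toIntegrableKernel, sineProfile, ContinuousMap.coe_mk] at h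
    linear_combination -Complex.I * h + (D.R j j a : ℂ) * Complex.I_sq

end CUEJanossy
end

noncomputable section
namespace CUEJanossy
open MeasureTheory

/-! ### Convergence of the quantities of integrable kernels -/

lemma pd_eq_mul_pd_log {J : (Fin 2 → ℝ) → ℝ} {a : Fin 2 → ℝ} (hd : DifferentiableAt ℝ J a)
    (h0 : 0 < J a) (k : Fin 2) : pd J k a = J a * pd (fun b => Real.log (J b)) k a := by
  have h1 : HasFDerivAt (fun b => Real.log (J b)) ((J a)⁻¹ • fderiv ℝ J a) a :=
    hd.hasFDerivAt.log h0.ne'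
  rw [pd_of_hasFDerivAt hd.hasFDerivAt, pd_of_hasFDerivAt h1, smul_apply, smul_eq_mul,
    mul_inv_cancel_left₀ h0.ne']

/-- The diagonal derivatives appear multiplied by m(a_j); a nonzero limit of m allows division. -/
lemma tendsto_of_mul_eq {ι : Type*} {l : Filter ι} {m X Y : ι → ℂ} {m' X' Y' : ℂ}
    (hm : Tendsto m l (𝓝 m')) (hY : Tendsto Y l (𝓝 Y')) (h : ∀ᶠ i in l, m i * X i = Y i)
    (h' : m' * X' = Y') (h0 : m' ≠ 0) : Tendsto X l (𝓝 X') := by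
  have h1 := hY.div hm h0
  rw [← h', mul_div_cancel_left₀ _ h0] at h1
  refine h1.congr' ?_
  filter_upwards [h, hm.eventually_ne h0] with i hi hi0
  rw [Pi.div_apply, ← hi, mul_div_cancel_left₀ _ hi0]

/-- Convergence of integrable kernels and endpoints. -/
structure IKTendsto {ι : Type*} (l : Filter ι) (D : ι → IntegrableKernel) (D' : IntegrableKernel)
    (b : ι → Fin 2 → ℝ) (a : Fin 2 → ℝ) : Prop where
  hb : Tendsto b l (𝓝 a)
  K : Tendsto (fun i => (D i).K) l (𝓝 D'.K)
  φ : Tendsto (fun i => (D i).φ) l (𝓝 D'.φ)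
  ψ : Tendsto (fun i => (D i).ψ) l (𝓝 D'.ψ)
  e (j : Fin 2) : Tendsto (fun i => (D i).e (b i j)) l (𝓝 (D'.e (a j)))
  m (j : Fin 2) : Tendsto (fun i => (D i).m (b i j)) l (𝓝 (D'.m (a j)))
  α : Tendsto (fun i => (D i).α) l (𝓝 D'.α)
  β : Tendsto (fun i => (D i).β) l (𝓝 D'.β)
  c₀ : Tendsto (fun i => (D i).c₀) l (𝓝 D'.c₀)
  c₁ : Tendsto (fun i => (D i).c₁) l (𝓝 D'.c₁)
  c₂ : Tendsto (fun i => (D i).c₂) l (𝓝 D'.c₂)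
  d₀ : Tendsto (fun i => (D i).d₀) l (𝓝 D'.d₀)
  d₁ : Tendsto (fun i => (D i).d₁) l (𝓝 D'.d₁)
  d₂ : Tendsto (fun i => (D i).d₂) l (𝓝 D'.d₂)
  m_ne (j : Fin 2) : D'.m (a j) ≠ 0
  hab : a 0 ≤ a 1
  hc : Contractive (ker D'.K) a
  sys : ∀ᶠ i in l, (D i).System (b i)

/-- Convergence of all quantities and their first partial derivatives along a filter. -/
structure QuantTendsto {ι : Type*} (l : Filter ι) (Q : ι → Quantities) (Q' : Quantities)
    (b : ι → Fin 2 → ℝ) (a : Fin 2 → ℝ) : Prop where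
  q (j : Fin 2) : Tendsto (fun i => (Q i).q j (b i)) l (𝓝 (Q'.q j a))
  p (j : Fin 2) : Tendsto (fun i => (Q i).p j (b i)) l (𝓝 (Q'.p j a))
  u : Tendsto (fun i => (Q i).u (b i)) l (𝓝 (Q'.u a))
  w : Tendsto (fun i => (Q i).w (b i)) l (𝓝 (Q'.w a))
  v : Tendsto (fun i => (Q i).v (b i)) l (𝓝 (Q'.v a))
  R (j k : Fin 2) : Tendsto (fun i => (Q i).R j k (b i)) l (𝓝 (Q'.R j k a))
  J : Tendsto (fun i => (Q i).J (b i)) l (𝓝 (Q'.J a))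
  dq (j k : Fin 2) : Tendsto (fun i => pd ((Q i).q j) k (b i)) l (𝓝 (pd (Q'.q j) k a))
  dp (j k : Fin 2) : Tendsto (fun i => pd ((Q i).p j) k (b i)) l (𝓝 (pd (Q'.p j) k a))
  du (k : Fin 2) : Tendsto (fun i => pd (Q i).u k (b i)) l (𝓝 (pd Q'.u k a))
  dw (k : Fin 2) : Tendsto (fun i => pd (Q i).w k (b i)) l (𝓝 (pd Q'.w k a))
  dv (k : Fin 2) : Tendsto (fun i => pd (Q i).v k (b i)) l (𝓝 (pd Q'.v k a))
  dJ (k : Fin 2) : Tendsto (fun i => pd (Q i).J k (b i)) l (𝓝 (pd Q'.J k a))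

/-- Quantities converge by joint continuity of resolvents and determinants. No limit is exchanged
with a derivative: the system holds along the family and in the limit, and its right-hand sides
involve only converging quantities. -/
theorem IKTendsto.quant {ι : Type*} {l : Filter ι} {D : ι → IntegrableKernel}
    {D' : IntegrableKernel} {b : ι → Fin 2 → ℝ} {a : Fin 2 → ℝ} (h : IKTendsto l D D' b a) :
    QuantTendsto l (fun i => (D i).quant) D'.quant b a := by
  have hbj : ∀ j, Tendsto (fun i => b i j) l (𝓝 (a j)) := fun j => (tendsto_pi_nhds.1 h.hb) j
  have S := D'.system h.hab h.hc
  have hq : ∀ j, Tendsto (fun i => (D i).quant.q j (b i)) l (𝓝 (D'.quant.q j a)) := fun j =>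
    tendsto_resolvent h.hab h.hc h.K h.hb h.φ (hbj j)
  have hp : ∀ j, Tendsto (fun i => (D i).quant.p j (b i)) l (𝓝 (D'.quant.p j a)) := fun j =>
    tendsto_resolvent h.hab h.hc h.K h.hb h.ψ (hbj j)
  have hu : Tendsto (fun i => (D i).quant.u (b i)) l (𝓝 (D'.quant.u a)) :=
    tendsto_integral_resolvent h.hab h.hc h.K h.hb h.φ h.φ
  have hw : Tendsto (fun i => (D i).quant.w (b i)) l (𝓝 (D'.quant.w a)) :=
    tendsto_integral_resolvent h.hab h.hc h.K h.hb h.ψ h.ψ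
  have hv : Tendsto (fun i => (D i).quant.v (b i)) l (𝓝 (D'.quant.v a)) :=
    tendsto_integral_resolvent h.hab h.hc h.K h.hb h.ψ h.φ
  have hR : ∀ j k, Tendsto (fun i => (D i).quant.R j k (b i)) l (𝓝 (D'.quant.R j k a)) := fun j k =>
    tendsto_resolvent h.hab h.hc h.K h.hb (tendsto_col h.K (hbj k)) (hbj j)
  have hJ : Tendsto (fun i => (D i).quant.J (b i)) l (𝓝 (D'.quant.J a)) :=
    tendsto_fredholmDet h.hab h.hc h.K h.hb
  have hRc : ∀ j k, Tendsto (fun i => ((D i).quant.R j k (b i) : ℂ)) l (𝓝 (D'.quant.R j k a)) :=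
    fun j k => (Complex.continuous_ofReal.tendsto _).comp (hR j k)
  have other : ∀ j : Fin 2, ∃ k, j ≠ k := by decide
  refine ⟨hq, hp, hu, hw, hv, hR, hJ, fun j k => ?_, fun j k => ?_, fun k => ?_, fun k => ?_,
    fun k => ?_, fun k => ?_⟩
  · rcases eq_or_ne j k with rfl | hjk
    · obtain ⟨k, hk⟩ := other j
      refine tendsto_of_mul_eq (h.m j) ?_ (h.sys.mono fun i hi => hi.dq j k hk) (S.dq j k hk)
        (h.m_ne j)
      exact (((((h.c₀.mul (hq j)).add (h.c₁.mul ((((h.e j).mul (hq j)).sub (hv.mul (hq j))).add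
        (hu.mul (hp j))))).add (h.c₂.mul (hp j))).add ((h.α.mul hv).mul (hq j))).add
        ((h.β.mul hu).mul (hp j))).sub (((tendsto_const_nhds.mul (h.m k)).mul (hRc j k)).mul (hq k))
    · rw [S.dq_off j k hjk]
      refine Tendsto.congr' (h.sys.mono fun i hi => (hi.dq_off j k hjk).symm) ?_
      exact (tendsto_const_nhds.mul (hRc j k)).mul (hq k)
  · rcases eq_or_ne j k with rfl | hjk
    · obtain ⟨k, hk⟩ := other j
      refine tendsto_of_mul_eq (h.m j) ?_ (h.sys.mono fun i hi => hi.dp j k hk) (S.dp j k hk)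
        (h.m_ne j)
      exact (((((h.d₀.mul (hp j)).add (h.d₁.mul ((((h.e j).mul (hp j)).sub (hw.mul (hq j))).add
        (hv.mul (hp j))))).add (h.d₂.mul (hq j))).add ((h.α.mul hw).mul (hq j))).add
        ((h.β.mul hv).mul (hp j))).sub (((tendsto_const_nhds.mul (h.m k)).mul (hRc j k)).mul (hp k))
    · rw [S.dp_off j k hjk]
      refine Tendsto.congr' (h.sys.mono fun i hi => (hi.dp_off j k hjk).symm) ?_
      exact (tendsto_const_nhds.mul (hRc j k)).mul (hp k)
  · rw [S.du k]
    exact Tendsto.congr' (h.sys.mono fun i hi => (hi.du k).symm)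
      (tendsto_const_nhds.mul ((hq k).pow 2))
  · rw [S.dw k]
    exact Tendsto.congr' (h.sys.mono fun i hi => (hi.dw k).symm)
      (tendsto_const_nhds.mul ((hp k).pow 2))
  · rw [S.dv k]
    exact Tendsto.congr' (h.sys.mono fun i hi => (hi.dv k).symm)
      (tendsto_const_nhds.mul ((hq k).mul (hp k)))
  · rw [pd_eq_mul_pd_log S.regular.J S.regular.J_pos, S.dlogJ]
    refine Tendsto.congr' (h.sys.mono fun i hi => ?_) (hJ.mul (tendsto_const_nhds.mul (hR k k)))
    beta_reduce
    rw [pd_eq_mul_pd_log hi.regular.J hi.regular.J_pos, hi.dlogJ]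

lemma QuantTendsto.doubled {ι : Type*} {l : Filter ι} {Q : ι → Quantities} {Q' : Quantities}
    {b : ι → Fin 2 → ℝ} {a : Fin 2 → ℝ} (h : QuantTendsto l Q Q' b a) :
    QuantTendsto l (fun i => doubled (Q i)) (doubled Q') b a := by
  refine ⟨h.q, h.p, h.u.const_mul 2, h.w.const_mul 2, h.v.const_mul 2, h.R, h.J, h.dq, h.dp,
    fun k => ?_, fun k => ?_, fun k => ?_, h.dJ⟩
  · simpa only [CUEJanossy.doubled, pd_const_mul] using (h.du k).const_mul 2
  · simpa only [CUEJanossy.doubled, pd_const_mul] using (h.dw k).const_mul 2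
  · simpa only [CUEJanossy.doubled, pd_const_mul] using (h.dv k).const_mul 2

lemma QuantTendsto.congr {ι : Type*} {l : Filter ι} {P Q : ι → Quantities} {Q' : Quantities}
    {b : ι → Fin 2 → ℝ} {a : Fin 2 → ℝ} (h : QuantTendsto l Q Q' b a)
    (he : ∀ᶠ i in l, ∀ᶠ x in 𝓝 (b i), QuantitiesEq (P i) (Q i) x) : QuantTendsto l P Q' b a := by
  have h0 : ∀ᶠ i in l, QuantitiesEq (P i) (Q i) (b i) := he.mono fun _ hi => hi.self_of_nhds
  refine ⟨fun j => ?_, fun j => ?_, ?_, ?_, ?_, fun j k => ?_, ?_, fun j k => ?_, fun j k => ?_,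
    fun k => ?_, fun k => ?_, fun k => ?_, fun k => ?_⟩
  · exact (h.q j).congr' (h0.mono fun _ hi => (hi.q j).symm)
  · exact (h.p j).congr' (h0.mono fun _ hi => (hi.p j).symm)
  · exact h.u.congr' (h0.mono fun _ hi => hi.u.symm)
  · exact h.w.congr' (h0.mono fun _ hi => hi.w.symm)
  · exact h.v.congr' (h0.mono fun _ hi => hi.v.symm)
  · exact (h.R j k).congr' (h0.mono fun _ hi => (hi.R j k).symm)
  · exact h.J.congr' (h0.mono fun _ hi => hi.J.symm)
  · exact (h.dq j k).congr' (he.mono fun _ hi => (pd_congr (hi.mono fun _ hx => hx.q j) k).symm)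
  · exact (h.dp j k).congr' (he.mono fun _ hi => (pd_congr (hi.mono fun _ hx => hx.p j) k).symm)
  · exact (h.du k).congr' (he.mono fun _ hi => (pd_congr (hi.mono fun _ hx => hx.u) k).symm)
  · exact (h.dw k).congr' (he.mono fun _ hi => (pd_congr (hi.mono fun _ hx => hx.w) k).symm)
  · exact (h.dv k).congr' (he.mono fun _ hi => (pd_congr (hi.mono fun _ hx => hx.v) k).symm)
  · exact (h.dJ k).congr' (he.mono fun _ hi => (pd_congr (hi.mono fun _ hx => hx.J) k).symm)

end CUEJanossy
end

noncomputable section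
namespace CUEJanossy
open MeasureTheory

/-! ### The unfolded CUE -/

lemma two_div_pos {N : ℕ} (hN : 1 ≤ N) : 0 < 2 / (N : ℝ) := by
  have : (0 : ℝ) < N := by exact_mod_cast hN
  positivity

/-- The integrable kernel of the unfolded CUE; its value for `N = 0` is irrelevant. -/
def unfoldedIK (N : ℕ) : IntegrableKernel :=
  if h : 1 ≤ N then cueIK N (2 / N) h (two_div_pos h) else sineIK

lemma unfoldedIK_eq {N : ℕ} (h : 1 ≤ N) : unfoldedIK N = cueIK N (2 / N) h (two_div_pos h) :=
  dif_pos h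

/-- The Jacobian 2/N and the redefinition factor N combine to 2. Equality is needed near the point,
as partial derivatives are compared later. -/
lemma unfolded_eq {N : ℕ} (hN : 1 ≤ N) {a : Fin 2 → ℝ} (ha : a ∈ shortDomain (2 / N)) :
    ∀ᶠ b in 𝓝 a, QuantitiesEq (unfoldedCue N) (doubled (unfoldedIK N).quant) b := by
  filter_upwards [(isOpen_shortDomain _).mem_nhds ha] with b hb
  have h := cue_scale hN (two_div_pos hN) hb
  rw [unfoldedIK_eq hN]
  have hN' : (N : ℂ) ≠ 0 := by
    have : N ≠ 0 := by omega
    exact_mod_cast this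
  have hs : ∀ x : ℂ, N * (((2 / N : ℝ) : ℂ) * x) = 2 * x := by
    intro x
    push_cast
    field_simp
  refine ⟨h.q, h.p, ?_, ?_, ?_, h.R, h.J⟩
  · simp only [unfoldedCue, doubled, h.u, hs]
  · simp only [unfoldedCue, doubled, h.w, hs]
  · simp only [unfoldedCue, doubled, h.v, hs]

/-- The unfolded period πN eventually exceeds any fixed length. -/
lemma eventually_short {X : Type*} (L : X → ℝ) {l : Filter X} {C : ℝ} (hL : ∀ᶠ x in l, L x < C) :
    ∀ᶠ y : ℕ × X in atTop ×ˢ l, 1 ≤ y.1 ∧ L y.2 < 2 * Real.pi / (2 / y.1) := by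
  obtain ⟨M, hM⟩ := exists_nat_gt C
  filter_upwards [tendsto_fst.eventually (eventually_ge_atTop 1),
    tendsto_fst.eventually (eventually_ge_atTop M), tendsto_snd.eventually hL] with y h1 h2 h3
  refine ⟨h1, ?_⟩
  have hN : (0 : ℝ) < y.1 := by exact_mod_cast h1
  have e : 2 * Real.pi / (2 / (y.1 : ℝ)) = Real.pi * y.1 := by field_simp
  have : (M : ℝ) ≤ y.1 := by exact_mod_cast h2
  rw [e]
  nlinarith [Real.pi_gt_three]

lemma eventually_shortDomain {a : Fin 2 → ℝ} (ha : a ∈ domain) :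
    ∀ᶠ y : ℕ × (Fin 2 → ℝ) in atTop ×ˢ 𝓝 a, 1 ≤ y.1 ∧ y.2 ∈ shortDomain (2 / y.1) := by
  have hc : Continuous fun b : Fin 2 → ℝ => b 1 - b 0 := by fun_prop
  have h1 : ∀ᶠ b : Fin 2 → ℝ in 𝓝 a, b 1 - b 0 < a 1 - a 0 + 1 :=
    hc.continuousAt.eventually_lt_const (lt_add_one _)
  filter_upwards [eventually_short _ h1, tendsto_snd.eventually (isOpen_domain.mem_nhds ha)]
    with y h h'
  exact ⟨h.1, h', h.2⟩

lemma tendsto_unfoldedIK {a : Fin 2 → ℝ} (ha : a ∈ domain) :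
    IKTendsto (atTop ×ˢ 𝓝 a) (fun y : ℕ × (Fin 2 → ℝ) => unfoldedIK y.1) sineIK
      (fun y => y.2) a := by
  set l : Filter (ℕ × (Fin 2 → ℝ)) := atTop ×ˢ 𝓝 a
  have hf : Tendsto Prod.fst l atTop := tendsto_fst
  have hN : ∀ᶠ y : ℕ × (Fin 2 → ℝ) in l, 1 ≤ y.1 := hf.eventually (eventually_ge_atTop 1)
  have tr : ∀ {Y : Type} [TopologicalSpace Y] (G : IntegrableKernel → Y) (F : ℕ → Y) (z : Y),
      (∀ (N : ℕ) (h : 1 ≤ N), F N = G (cueIK N (2 / N) h (two_div_pos h))) →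
      Tendsto F atTop (𝓝 z) → Tendsto (fun y : ℕ × (Fin 2 → ℝ) => G (unfoldedIK y.1)) l (𝓝 z) := by
    intro Y _ G F z h1 h2
    refine (h2.comp hf).congr' (hN.mono fun y hy => ?_)
    beta_reduce
    rw [unfoldedIK_eq hy]
    exact h1 _ hy
  have ofR : ∀ {F : ℕ → ℝ} {z : ℝ}, Tendsto F atTop (𝓝 z) →
      Tendsto (fun N => (F N : ℂ)) atTop (𝓝 (z : ℂ)) := fun h =>
    (Complex.continuous_ofReal.tendsto _).comp h
  have hω := ofR tendsto_cueFreq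
  have hω' := ofR tendsto_cueFreq'
  have hγ : Tendsto (fun N : ℕ => (((2 * Real.pi * cueDensity N (2 / N) 0)⁻¹ : ℝ) : ℂ)) atTop
      (𝓝 (((2 * Real.pi * sineDensity 0)⁻¹ : ℝ) : ℂ)) :=
    ofR (((tendsto_apply tendsto_cueDensity tendsto_const_nhds).const_mul _).inv₀
      (mul_ne_zero Real.two_pi_pos.ne' sineDensity_zero_ne))
  have hbj : ∀ j, Tendsto (fun y : ℕ × (Fin 2 → ℝ) => y.2 j) l (𝓝 (a j)) := fun j =>
    ((continuous_apply j).tendsto a).comp tendsto_snd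
  have he : ∀ j, Tendsto (fun y : ℕ × (Fin 2 → ℝ) => (unfoldedIK y.1).e (y.2 j)) l
      (𝓝 (sineIK.e (a j))) := by
    intro j
    have h1 := tendsto_cueExp (tendsto_two_div.comp hf) (hN.mono fun y hy => (two_div_pos hy).ne')
      (hbj j)
    refine h1.congr' (hN.mono fun y hy => ?_)
    beta_reduce
    rw [unfoldedIK_eq hy]
    rfl
  have hm : ∀ j, Tendsto (fun y : ℕ × (Fin 2 → ℝ) => (unfoldedIK y.1).m (y.2 j)) l
      (𝓝 (sineIK.m (a j))) := by
    intro j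
    refine ((he j).const_mul (-Complex.I)).congr' (hN.mono fun y hy => ?_)
    beta_reduce
    rw [unfoldedIK_eq hy]
    rfl
  refine ⟨tendsto_snd, tr (fun D => D.K) _ _ (fun _ _ => rfl) tendsto_cueKer,
    tr (fun D => D.φ) _ _ (fun _ _ => rfl)
      (tendsto_condWave tendsto_cueDensity sineDensity_zero_ne tendsto_cueFreq),
    tr (fun D => D.ψ) _ _ (fun _ _ => rfl)
      (tendsto_condWave tendsto_cueDensity sineDensity_zero_ne tendsto_cueFreq'),
    he, hm, tr (fun D => D.α) _ _ (fun _ _ => rfl) hω'.neg, tr (fun D => D.β) _ _ (fun _ _ => rfl) hω,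
    tr (fun D => D.c₀) _ _ (fun _ _ => rfl) (hγ.mul (hω.add hω')),
    tr (fun D => D.c₁) _ _ (fun _ _ => rfl) hω,
    tr (fun D => D.c₂) _ _ (fun _ _ => rfl) (hγ.neg.mul (hω.const_mul 2)),
    tr (fun D => D.d₀) _ _ (fun _ _ => rfl) (hγ.neg.mul (hω.add hω')),
    tr (fun D => D.d₁) _ _ (fun _ _ => rfl) hω',
    tr (fun D => D.d₂) _ _ (fun _ _ => rfl) (hγ.mul (hω'.const_mul 2)), ?_, domain.le ha,
    contractive_sine (domain.le ha), ?_⟩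
  · intro j
    have hne : (a j : ℂ) ≠ 0 := by
      rw [Complex.ofReal_ne_zero]
      fin_cases j
      · exact ha.1.ne
      · exact ha.2.ne'
    change -Complex.I * (Complex.I * (a j : ℂ)) ≠ 0
    simp [hne]
  · filter_upwards [eventually_shortDomain ha] with y hy
    rw [unfoldedIK_eq hy.1]
    exact cueIK_system hy.1 (two_div_pos hy.1) hy.2

lemma quantTendsto_unfolded {a : Fin 2 → ℝ} (ha : a ∈ domain) :
    QuantTendsto (atTop ×ˢ 𝓝 a) (fun y : ℕ × (Fin 2 → ℝ) => unfoldedCue y.1) sine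
      (fun y => y.2) a := by
  rw [sine_eq]
  refine (tendsto_unfoldedIK ha).quant.doubled.congr ?_
  filter_upwards [eventually_shortDomain ha] with y hy
  exact unfolded_eq hy.1 hy.2

theorem unfolded_tendsto : QuantitiesTendsto unfoldedCue sine := by
  have h := fun a ha => quantTendsto_unfolded (a := a) ha
  refine ⟨fun j => ⟨?_, fun k => ?_⟩, fun j => ⟨?_, fun k => ?_⟩, ⟨?_, fun k => ?_⟩,
    ⟨?_, fun k => ?_⟩, ⟨?_, fun k => ?_⟩, fun j k => ?_, ⟨?_, fun k => ?_⟩⟩ <;>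
    refine tendstoLocallyUniformlyOn_of_joint isOpen_domain fun a ha => ?_
  exacts [(h a ha).q j, (h a ha).dq j k, (h a ha).p j, (h a ha).dp j k, (h a ha).u, (h a ha).du k,
    (h a ha).w, (h a ha).dw k, (h a ha).v, (h a ha).dv k, (h a ha).R j k, (h a ha).J, (h a ha).dJ k]

/-! ### Convergence of the unfolded kernel and functions -/

lemma tendstoLocallyUniformly_of_eventuallyEq {X E : Type*} [TopologicalSpace X]
    [PseudoMetricSpace E] [LocallyCompactSpace X] {F : ℕ → X → E} {Fc : ℕ → C(X, E)} {G : C(X, E)}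
    (hF : Tendsto Fc atTop (𝓝 G))
    (h : ∀ a, ∀ᶠ y : ℕ × X in atTop ×ˢ 𝓝 a, F y.1 y.2 = Fc y.1 y.2) :
    TendstoLocallyUniformly F G atTop := by
  rw [← tendstoLocallyUniformlyOn_univ]
  refine tendstoLocallyUniformlyOn_of_joint isOpen_univ fun a _ => ?_
  have h1 : Tendsto (fun y : ℕ × X => Fc y.1 y.2) (atTop ×ˢ 𝓝 a) (𝓝 (G a)) :=
    tendsto_apply (hF.comp tendsto_fst) tendsto_snd
  exact h1.congr' ((h a).mono fun _ hy => hy.symm)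

lemma eventually_abs_lt_period {X : Type*} [TopologicalSpace X] {g : X → ℝ} (hg : Continuous g)
    (a : X) : ∀ᶠ y : ℕ × X in atTop ×ˢ 𝓝 a, 1 ≤ y.1 ∧ |g y.2| < 2 * Real.pi / (2 / y.1) :=
  eventually_short _ (hg.abs.continuousAt.eventually_lt_const (lt_add_one _))

theorem tendsto_unfolded_kernel : TendstoLocallyUniformly (fun (N : ℕ) (z : ℝ × ℝ) =>
    2 / N * conditioned (cueKernel N) (2 / N * z.1) (2 / N * z.2))
    (fun z => conditioned sineKernel z.1 z.2) atTop := by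
  rw [conditioned_sine]
  refine tendstoLocallyUniformly_of_eventuallyEq (G := convKernel sineDensity) tendsto_cueKer
    fun a => ?_
  filter_upwards [eventually_abs_lt_period continuous_fst a,
    eventually_abs_lt_period continuous_snd a,
    eventually_abs_lt_period (continuous_fst.sub continuous_snd) a] with y h1 h2 h3
  exact conditioned_cue_scale (two_div_pos h1.1) h1.2 h2.2 h3.2

theorem tendsto_unfolded_phi : TendstoLocallyUniformly
    (fun (N : ℕ) (x : ℝ) => cuePhi N (2 / N * x)) sinePhi atTop := by
  rw [sinePhi_eq]
  refine tendstoLocallyUniformly_of_eventuallyEq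
    (tendsto_condWave tendsto_cueDensity sineDensity_zero_ne tendsto_cueFreq) fun a => ?_
  filter_upwards [eventually_abs_lt_period continuous_id a] with y h
  exact cuePhi_scale h.1 (two_div_pos h.1) h.2

theorem tendsto_unfolded_psi : TendstoLocallyUniformly
    (fun (N : ℕ) (x : ℝ) => cuePsi N (2 / N * x)) sinePsi atTop := by
  rw [sinePsi_eq]
  refine tendstoLocallyUniformly_of_eventuallyEq
    (tendsto_condWave tendsto_cueDensity sineDensity_zero_ne tendsto_cueFreq') fun a => ?_
  filter_upwards [eventually_abs_lt_period continuous_id a] with y h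
  exact cuePsi_scale h.1 (two_div_pos h.1) h.2

end CUEJanossy
end

noncomputable section
namespace CUEJanossy
open MeasureTheory

/-! ### Symmetric intervals -/

@[simp] lemma sym_zero (t : ℝ) : sym t 0 = -t := rfl

@[simp] lemma sym_one (t : ℝ) : sym t 1 = t := rfl

lemma sym_mem_domain {t : ℝ} (ht : 0 < t) : sym t ∈ domain := ⟨neg_lt_zero.2 ht, ht⟩

lemma hasDerivAt_comp_sym {E : Type*} [NormedAddCommGroup E] [NormedSpace ℝ E]
    {F : (Fin 2 → ℝ) → E} {t : ℝ} (h : DifferentiableAt ℝ F (sym t)) :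
    HasDerivAt (fun s => F (sym s)) (pd F 1 (sym t) - pd F 0 (sym t)) t := by
  have h1 : HasDerivAt sym ![-1, 1] t := by
    rw [hasDerivAt_pi]
    intro j
    fin_cases j
    · exact hasDerivAt_neg t
    · exact hasDerivAt_id t
  have h2 := h.hasFDerivAt.comp_hasDerivAt t h1
  have e : (![-1, 1] : Fin 2 → ℝ) = Pi.single 1 1 - Pi.single 0 1 := by
    ext j; fin_cases j <;> simp
  rw [e, map_sub, ← pd_of_hasFDerivAt h.hasFDerivAt, ← pd_of_hasFDerivAt h.hasFDerivAt] at h2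
  exact h2

lemma Regular.sym {D : Quantities} {t : ℝ} (h : Regular D (sym t)) : SymRegular D t where
  q j := (hasDerivAt_comp_sym (h.q j)).differentiableAt
  p j := (hasDerivAt_comp_sym (h.p j)).differentiableAt
  u := (hasDerivAt_comp_sym h.u).differentiableAt
  w := (hasDerivAt_comp_sym h.w).differentiableAt
  v := (hasDerivAt_comp_sym h.v).differentiableAt
  J := (hasDerivAt_comp_sym h.J).differentiableAt
  J_pos := h.J_pos

/-! ### Reflection symmetry of symmetric intervals -/

section Reflection

variable {E : Type*} [NormedAddCommGroup E] [NormedSpace ℝ E] {K : ℝ → ℝ → ℝ}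

lemma integral_comp_neg_sym (f : ℝ → E) (t : ℝ) :
    ∫ x in (sym t 0)..(sym t 1), f (-x) = ∫ x in (sym t 0)..(sym t 1), f x := by
  rw [intervalIntegral.integral_comp_neg]; simp

lemma resolvent_reflect (hK : ∀ x z, K (-x) (-z) = K x z) (t : ℝ) (f : ℝ → E) (x : ℝ) :
    resolvent K (sym t) (fun z => f (-z)) x = resolvent K (sym t) f (-x) := by
  have h : ∀ n x, kernelIter K (sym t) (fun z => f (-z)) n x = kernelIter K (sym t) f n (-x) := by
    intro n
    induction n with
    | zero => intro x; rfl
    | succ n ih =>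
      intro x
      simp only [kernelIter, ih]
      rw [← integral_comp_neg_sym (fun z => K (-x) z • kernelIter K (sym t) f n z)]
      simp only [hK]
  simp only [resolvent, h]

end Reflection

/-- The reflection symmetry of the quantities of a symmetric interval. -/
structure Reflected (Q : Quantities) (t : ℝ) : Prop where
  q : Q.q 1 (sym t) = conj (Q.q 0 (sym t))
  p : Q.p 1 (sym t) = conj (Q.p 0 (sym t))
  u : (Q.u (sym t)).im = 0
  w : (Q.w (sym t)).im = 0
  v : (Q.v (sym t)).im = 0
  R : Q.R 0 0 (sym t) = Q.R 1 1 (sym t)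

/-- k is even and real, so reflecting a conditioned wave conjugates it, while the kernel is
invariant under (x,y) ↦ (-x,-y). -/
lemma Profile.reflected (P : Profile) (t : ℝ) : Reflected P.toIntegrableKernel.quant t := by
  set K := ker (convKernel P.k)
  have hK : ∀ x z, K (-x) (-z) = K x z := by
    intro x z
    change P.k (-x - -z) - P.k (-x) * _ * P.k (-z) = P.k (x - z) - _ * _ * _
    rw [P.even, P.even, ← P.even (x - z), neg_sub_neg, neg_sub]
  have hw : ∀ ω x, condWave ω P.k (-x) = conj (condWave ω P.k x) := by
    intro ω x
    simp only [condWave_apply, wave_apply, P.even]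
    simp [← Complex.exp_conj]
  have hr : ∀ ω x, resolvent K (sym t) (condWave ω P.k) (-x) =
      conj (resolvent K (sym t) (condWave ω P.k) x) := by
    intro ω x
    rw [← resolvent_reflect hK, ← resolvent_conj]
    simp only [hw]
  have hi : ∀ ω ω' : ℝ, (∫ x in (sym t 0)..(sym t 1),
      condWave ω P.k x * resolvent K (sym t) (condWave ω' P.k) x).im = 0 := by
    intro ω ω'
    rw [← Complex.conj_eq_iff_im, ← intervalIntegral_conj, ← integral_comp_neg_sym]
    simp only [map_mul, hw, hr, Complex.conj_conj]
  have hc : ∀ ω, resolvent K (sym t) (condWave ω P.k) t =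
      conj (resolvent K (sym t) (condWave ω P.k) (-t)) := by
    intro ω
    rw [hr, Complex.conj_conj]
  refine ⟨hc P.ω, hc P.ω', hi _ _, hi _ _, hi _ _, ?_⟩
  change resolvent K (sym t) (fun z => K z (-t)) (-t) = resolvent K (sym t) (fun z => K z t) t
  rw [← resolvent_reflect hK]
  simp only [hK]

lemma Reflected.congr {Q D : Quantities} {t : ℝ} (hD : Reflected D t)
    (h : QuantitiesEq Q D (sym t)) : Reflected Q t := by
  refine ⟨?_, ?_, ?_, ?_, ?_, ?_⟩ <;> simp only [h.q, h.p, h.u, h.w, h.v, h.R]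
  exacts [hD.q, hD.p, hD.u, hD.w, hD.v, hD.R]

/-- Along (-t,t) the derivative is the difference of the two partials. The R₂₁ terms combine to 2i(1
- cos t)R₂₁ = 2i tan(t/2) sin t · R₂₁, and 2i sin t · R₂₁ = q p̄ - p q̄ by the quotient formula. -/
theorem cueSym_of_cue {N : ℕ} {Q : Quantities} {t : ℝ} (ht : t ∈ Ioo 0 Real.pi)
    (h : CUESystem N Q (sym t)) (hr : Reflected Q t) : CUESymSystem N Q t := by
  have hs : (0 : ℝ) < Real.sin t := Real.sin_pos_of_pos_of_lt_pi ht.1 ht.2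
  have q0 : Q.q 0 (sym t) = conj (Q.q 1 (sym t)) := by rw [hr.q, Complex.conj_conj]
  have p0 : Q.p 0 (sym t) = conj (Q.p 1 (sym t)) := by rw [hr.p, Complex.conj_conj]
  have dq := (hasDerivAt_comp_sym (h.regular.q 1)).deriv
  have dp := (hasDerivAt_comp_sym (h.regular.p 1)).deriv
  have du := (hasDerivAt_comp_sym h.regular.u).deriv
  have dw := (hasDerivAt_comp_sym h.regular.w).deriv
  have dv := (hasDerivAt_comp_sym h.regular.v).deriv
  have dJ := (hasDerivAt_comp_sym (F := fun b => Real.log (Q.J b))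
    (h.regular.J.log h.regular.J_pos.ne')).deriv
  have s0 : ((sgn 0 : ℝ) : ℂ) = -1 := by simp [sgn]
  have s1 : ((sgn 1 : ℝ) : ℂ) = 1 := by simp [sgn]
  have h10 : (1 : Fin 2) ≠ 0 := by decide
  have eqq := h.dq 1 0 h10
  have eqp := h.dp 1 0 h10
  have hR := h.R_off 1 0 h10
  have hR1 := h.R_diag 1
  rw [h.dq_off 1 0 h10, s0] at dq
  rw [h.dp_off 1 0 h10, s0] at dp
  rw [h.du, h.du, s0, s1] at du
  rw [h.dw, h.dw, s0, s1] at dw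
  rw [h.dv, h.dv, s0, s1] at dv
  rw [h.dlogJ, h.dlogJ, hr.R] at dJ
  simp only [sym_zero, sym_one, s0, q0, p0] at dq dp du dw dv eqq eqp hR hR1
  have hE : Complex.exp (Complex.I * t) = Real.cos t + Real.sin t * Complex.I := by
    rw [mul_comm, Complex.exp_mul_I]; push_cast; rfl
  have hE' : Complex.exp (Complex.I * ((-t : ℝ) : ℂ)) = Real.cos t - Real.sin t * Complex.I := by
    rw [mul_comm, Complex.exp_mul_I]; push_cast; simp; ring
  have hE'' : Complex.exp (-(Complex.I * t)) = Real.cos t - Real.sin t * Complex.I := by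
    rw [← hE']; congr 1; push_cast; ring
  have hs' : ((Real.sin t : ℝ) : ℂ) ≠ 0 := Complex.ofReal_ne_zero.2 hs.ne'
  have htan : (Real.tan (t / 2) : ℂ) * Real.sin t = 1 - Real.cos t := by
    rw [← Complex.ofReal_mul, ← Complex.ofReal_one, ← Complex.ofReal_sub, Complex.ofReal_inj]
    have e1 : Real.sin t = 2 * Real.sin (t / 2) * Real.cos (t / 2) := by
      rw [← Real.sin_two_mul]; congr 1; ring
    have e2 : Real.cos t = 1 - 2 * Real.sin (t / 2) ^ 2 := by
      have h1 := Real.cos_two_mul (t / 2)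
      rw [Real.cos_sq', mul_div_cancel₀ t two_ne_zero] at h1
      linear_combination h1
    have hc : Real.cos (t / 2) ≠ 0 :=
      (Real.cos_pos_of_mem_Ioo ⟨by linarith [ht.1, Real.pi_pos], by linarith [ht.2]⟩).ne'
    rw [e1, e2, Real.tan_eq_sin_div_cos]
    field_simp
    ring
  have hcot : (Real.cot t : ℂ) * Real.sin t = Real.cos t := by
    rw [← Complex.ofReal_mul, Complex.ofReal_inj, Real.cot_eq_cos_div_sin, div_mul_cancel₀ _ hs.ne']
  -- Since R₁₁ = R₂₂ is real, (log J)' = -2R₂₂ is written as -R₂₂ minus its conjugate, which gives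
  -- the symmetric form of the formula.
  have hR1' := congrArg conj hR1
  have hcE : conj (Complex.exp (-(Complex.I * t))) = Complex.exp (Complex.I * t) := by
    rw [← Complex.exp_conj]; simp
  simp only [map_mul, map_sub, map_neg, Complex.conj_ofReal, Complex.conj_I, hcE] at hR1'
  rw [hE, hE', eq_div_iff (by
    have : (Real.cos t + Real.sin t * Complex.I) - (Real.cos t - Real.sin t * Complex.I) =
      2 * (Real.sin t * Complex.I) := by ring
    rw [this]
    exact mul_ne_zero two_ne_zero (mul_ne_zero hs' Complex.I_ne_zero))] at hR
  rw [hE, hE'] at eqq eqp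
  rw [hE''] at hR1
  rw [hE] at hR1'
  have hd := congrArg conj dq
  have hd' := congrArg conj dp
  simp only [map_mul, map_sub, map_neg, map_one, Complex.conj_ofReal, Complex.conj_conj] at hd hd'
  refine ⟨h.regular.sym, hr.q, hr.p, hr.u, hr.w, hr.v, ?_, ?_, ?_, ?_, ?_, ?_⟩
  · rw [dq, hE]
    linear_combination eqq - 2 * Complex.I * Q.R 1 0 (sym t) * conj (Q.q 1 (sym t)) * htan
      + Real.tan (t / 2) * conj (Q.q 1 (sym t)) * hR
  · rw [dp, hE]
    linear_combination eqp - 2 * Complex.I * Q.R 1 0 (sym t) * conj (Q.p 1 (sym t)) * htan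
      + Real.tan (t / 2) * conj (Q.p 1 (sym t)) * hR
  · rw [du]; ring
  · rw [dw]; ring
  · rw [dv]; ring
  · rw [dJ, hE, hE'', hd, hd', dq, dp]
    set X := Q.q 1 (sym t) * conj (Q.p 1 (sym t)) - Q.p 1 (sym t) * conj (Q.q 1 (sym t)) with hX
    rw [Complex.ofReal_sub, Complex.ofReal_mul, Complex.ofReal_mul, Complex.ofReal_neg,
      Complex.ofReal_neg, s0, s1]
    linear_combination -hR1 - hR1' - 2 * Complex.I * Q.R 1 0 (sym t) * X * hcot
      + Real.cot t * X * hR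

theorem cue_symSystem {N : ℕ} (hN : 1 ≤ N) {t : ℝ} (ht : t ∈ Ioo 0 Real.pi) :
    CUESymSystem N (cue N) t := by
  have ha : sym t ∈ shortDomain 1 := ⟨sym_mem_domain ht.1, by
    rw [sym_zero, sym_one, div_one]; linarith [ht.2]⟩
  exact cueSym_of_cue ht (cue_system hN ha)
    (((cueProfile N 1 hN one_ne_zero).reflected t).congr (cue_eventuallyEq hN ha).self_of_nhds)

end CUEJanossy
end

noncomputable section
namespace CUEJanossy
open MeasureTheory

/-! ### The sine kernel on symmetric intervals -/

lemma sine_reflected (t : ℝ) : Reflected sine t := by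
  have h := sineProfile.reflected t
  rw [sine_eq]
  refine ⟨h.q, h.p, ?_, ?_, ?_, h.R⟩
  · have := h.u
    change (2 * sineIK.quant.u (sym t)).im = 0
    rw [Complex.mul_im, show (sineIK.quant.u (sym t)).im = 0 from this]; simp
  · have := h.w
    change (2 * sineIK.quant.w (sym t)).im = 0
    rw [Complex.mul_im, show (sineIK.quant.w (sym t)).im = 0 from this]; simp
  · have := h.v
    change (2 * sineIK.quant.v (sym t)).im = 0
    rw [Complex.mul_im, show (sineIK.quant.v (sym t)).im = 0 from this]; simp

lemma sine_regular {a : Fin 2 → ℝ} (hab : a 0 ≤ a 1) : Regular sine a := by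
  rw [sine_eq]; exact (sineIK_system hab).regular.doubled

lemma sym_le {t : ℝ} (ht : 0 ≤ t) : sym t 0 ≤ sym t 1 := by simp; linarith

lemma sine_q0 (t : ℝ) : sine.q 0 (sym t) = conj (sine.q 1 (sym t)) := by
  rw [(sine_reflected t).q, Complex.conj_conj]

/-- The two R₂₁ contributions, one from each endpoint, cancel because a₁ = -a₂ and m is linear. -/
lemma sine_deriv_q {t : ℝ} (ht : 0 < t) : deriv (fun s => sine.q 1 (sym s)) t =
    Complex.I * sine.q 1 (sym t) + (sine.u (sym t) - 1) / t * conj (sine.q 1 (sym t)) := by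
  have S := sine_system (sym_mem_domain ht)
  have h10 : (1 : Fin 2) ≠ 0 := by decide
  have s0 : ((sgn 0 : ℝ) : ℂ) = -1 := by simp [sgn]
  have ht' : (t : ℂ) ≠ 0 := Complex.ofReal_ne_zero.2 ht.ne'
  have h := S.dq 1 0 h10
  rw [(hasDerivAt_comp_sym (S.regular.q 1)).deriv, S.dq_off 1 0 h10]
  simp only [sym_zero, sym_one, s0, sine_q0] at h ⊢
  push_cast at h
  field_simp
  linear_combination h

lemma sine_deriv_u {t : ℝ} (ht : 0 < t) : deriv (fun s => sine.u (sym s)) t =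
    2 * (sine.q 1 (sym t) ^ 2 + conj (sine.q 1 (sym t)) ^ 2) := by
  have S := sine_system (sym_mem_domain ht)
  have s0 : ((sgn 0 : ℝ) : ℂ) = -1 := by simp [sgn]
  have s1 : ((sgn 1 : ℝ) : ℂ) = 1 := by simp [sgn]
  rw [(hasDerivAt_comp_sym S.regular.u).deriv, S.du, S.du, s0, s1, sine_q0]
  ring

lemma sine_deriv_logJ {t : ℝ} (ht : 0 < t) :
    ((deriv (fun s => Real.log (sine.J (sym s))) t : ℝ) : ℂ) =
      2 * Complex.I * (conj (sine.q 1 (sym t)) * deriv (fun s => sine.q 1 (sym s)) t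
        - sine.q 1 (sym t) * conj (deriv (fun s => sine.q 1 (sym s)) t))
      + (sine.q 1 (sym t) ^ 2 - conj (sine.q 1 (sym t)) ^ 2) ^ 2 / t := by
  have S := sine_system (sym_mem_domain ht)
  have h10 : (1 : Fin 2) ≠ 0 := by decide
  have s0 : ((sgn 0 : ℝ) : ℂ) = -1 := by simp [sgn]
  have s1 : ((sgn 1 : ℝ) : ℂ) = 1 := by simp [sgn]
  have ht' : (t : ℂ) ≠ 0 := Complex.ofReal_ne_zero.2 ht.ne'
  have dq := (hasDerivAt_comp_sym (S.regular.q 1)).deriv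
  have dJ := (hasDerivAt_comp_sym (F := fun b => Real.log (sine.J b))
    (S.regular.J.log S.regular.J_pos.ne')).deriv
  have hR := S.R_off 1 0 h10
  have hR1 := S.R_diag 1
  rw [S.dq_off 1 0 h10, s0, sine_q0] at dq
  rw [S.dlogJ, S.dlogJ, (sine_reflected t).R] at dJ
  have hd := congrArg conj dq
  simp only [map_mul, map_sub, map_neg, map_one, Complex.conj_ofReal, Complex.conj_conj] at hd
  rw [dJ, hd, dq, Complex.ofReal_sub, Complex.ofReal_mul, Complex.ofReal_mul, Complex.ofReal_neg,
      Complex.ofReal_neg, s0, s1]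
  simp only [sym_zero, sym_one, sine_q0, Complex.conj_conj] at hR
  push_cast at hR
  rw [eq_div_iff (mul_ne_zero Complex.I_ne_zero (by
    rw [sub_neg_eq_add, ← two_mul]; exact mul_ne_zero two_ne_zero ht'))] at hR
  set q := sine.q 1 (sym t)
  have e : (q ^ 2 - conj q ^ 2) ^ 2 / t = 2 * Complex.I * sine.R 1 0 (sym t) *
      (q ^ 2 - conj q ^ 2) := by
    rw [div_eq_iff ht']
    linear_combination -(q ^ 2 - conj q ^ 2) * hR
  rw [e]
  linear_combination -2 * hR1

lemma sine_at_zero : sine.q 1 (sym 0) = 0 ∧ sine.u (sym 0) = 0 := by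
  constructor
  · rw [sine_eq]
    have h := resolvent_sub (sym_le le_rfl) (contractive_sine (sym_le le_rfl))
      (condWave 1 sineDensity) (0 : ℝ)
    simp only [sym_zero, sym_one, neg_zero, intervalIntegral.integral_same, sub_zero] at h
    change resolvent (ker (convKernel sineDensity)) (sym 0) (condWave 1 sineDensity) 0 = 0
    rw [h, condWave_apply, wave_apply, div_self (Complex.ofReal_ne_zero.2 sineDensity_zero_ne)]
    simp
  · change 2 * (∫ x in (sym 0 0)..(sym 0 1), _) = (0 : ℂ)
    simp only [sym_zero, sym_one, neg_zero, intervalIntegral.integral_same, mul_zero]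

/-- The first integral of the system on symmetric intervals. -/
lemma sine_u_eq {t : ℝ} (ht : 0 < t) : sine.u (sym t) = 2 * ((sine.q 1 (sym t) ^ 2).im : ℂ) := by
  set g : ℝ → ℝ := fun s => (sine.u (sym s)).re - 2 * (sine.q 1 (sym s) ^ 2).im with hg
  have hu : ∀ s, 0 ≤ s → DifferentiableAt ℝ (fun s => sine.u (sym s)) s := fun s hs =>
    (sine_regular (sym_le hs)).sym.u
  have hq : ∀ s, 0 ≤ s → DifferentiableAt ℝ (fun s => sine.q 1 (sym s)) s := fun s hs =>
    (sine_regular (sym_le hs)).sym.q 1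
  have hd : ∀ s, 0 ≤ s → HasDerivAt g ((deriv (fun s => sine.u (sym s)) s).re -
      2 * (2 * sine.q 1 (sym s) * deriv (fun s => sine.q 1 (sym s)) s).im) s := by
    intro s hs
    have h1 := Complex.reCLM.hasFDerivAt.comp_hasDerivAt s (hu s hs).hasDerivAt
    have h2 := Complex.imCLM.hasFDerivAt.comp_hasDerivAt s ((hq s hs).hasDerivAt.pow 2)
    refine (h1.sub (h2.const_mul 2)).congr_deriv ?_
    simp
  have h0 : ∀ s ∈ Ioo 0 t, HasDerivAt g 0 s := by
    intro s hs
    -- For real u, Im(q q') = Re(q²), the term in (u-1)/s being real; hence both u' and (2 Im q²)'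
    -- equal 4 Re(q²).
    refine (hd s hs.1.le).congr_deriv ?_
    rw [sine_deriv_u hs.1, sine_deriv_q hs.1]
    have him := (sine_reflected s).u
    have hur : sine.u (sym s) = ((sine.u (sym s)).re : ℂ) := by
      apply Complex.ext <;> simp [him]
    rw [hur]
    set q := sine.q 1 (sym s)
    set r := (sine.u (sym s)).re
    have e1 : ((r : ℂ) - 1) / s = (((r - 1) / s : ℝ) : ℂ) := by push_cast; rfl
    rw [e1]
    generalize (r - 1) / s = z
    simp [sq]
    ring
  -- Regularity also holds for the degenerate interval s = 0, where u = q = 0, so the mean value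
  -- theorem applies on [0,t].
  have hc : ContinuousOn g (Icc 0 t) := fun s hs => (hd s hs.1).continuousAt.continuousWithinAt
  obtain ⟨ξ, hξ, h⟩ := exists_hasDerivAt_eq_slope g (fun _ => 0) ht hc h0
  have hg0 : g 0 = 0 := by simp [hg, sine_at_zero.1, sine_at_zero.2]
  rw [hg0, sub_zero, sub_zero, eq_comm, div_eq_zero_iff, or_iff_left ht.ne'] at h
  apply Complex.ext
  · rw [← Complex.ofReal_ofNat, ← Complex.ofReal_mul, Complex.ofReal_re]
    exact sub_eq_zero.1 h
  · rw [(sine_reflected t).u]; simp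

theorem sine_foSystem {t : ℝ} (ht : 0 < t) : FOSystem sine t where
  regular := (sine_regular (sym_le ht.le)).sym
  q_sym := (sine_reflected t).q
  p_eq := sine_p_eq 1 _
  u_real := (sine_reflected t).u
  w_eq := by rw [sine_w_eq, Complex.conj_eq_iff_im]; exact (sine_reflected t).u
  dq := sine_deriv_q ht
  du := sine_deriv_u ht
  dlogJ := sine_deriv_logJ ht
  dq_autonomous := by rw [sine_deriv_q ht, sine_u_eq ht]

end CUEJanossy
end

noncomputable section
namespace CUEJanossy
open MeasureTheory

/-! ### Small intervals -/

/-- Imaginary part of the fourth-order Taylor estimate of e^{is}, divided by s. -/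
lemma sinc_taylor {s : ℝ} (h : |s| ≤ 1) : |Real.sinc s - (1 - s ^ 2 / 6)| ≤ s ^ 4 := by
  rcases eq_or_ne s 0 with rfl | hs
  · simp
  have h1 := Complex.exp_bound (x := s * Complex.I) (by simpa using h) (n := 5) (by norm_num)
  have h2 := (Complex.abs_im_le_norm _).trans h1
  have e : (Complex.exp (s * Complex.I) - ∑ m ∈ Finset.range 5, (s * Complex.I) ^ m / m.factorial).im
      = s * (Real.sinc s - (1 - s ^ 2 / 6)) := by
    have e1 : ∑ m ∈ Finset.range 5, (s * Complex.I) ^ m / (m.factorial : ℂ) =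
        ((1 - s ^ 2 / 2 + s ^ 4 / 24 : ℝ) : ℂ) + ((s - s ^ 3 / 6 : ℝ) : ℂ) * Complex.I := by
      simp only [Finset.sum_range_succ, Finset.sum_range_zero, Nat.factorial]
      push_cast
      linear_combination (s ^ 2 / 2 + s ^ 3 * Complex.I / 6 + s ^ 4 * (Complex.I ^ 2 - 1) / 24)
        * Complex.I_sq
    rw [e1, Complex.sub_im, Complex.exp_ofReal_mul_I_im, mul_sub, mul_sinc, Complex.add_im,
      Complex.ofReal_im, Complex.im_ofReal_mul, Complex.I_im]
    ring
  rw [e, abs_mul] at h2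
  have h3 : ‖(s : ℂ) * Complex.I‖ = |s| := by simp
  rw [h3] at h2
  have h4 : |s| * |Real.sinc s - (1 - s ^ 2 / 6)| ≤ |s| * s ^ 4 := by
    refine h2.trans ?_
    have : s ^ 4 = |s| ^ 4 := by rw [← abs_pow, abs_of_nonneg (by positivity)]
    rw [this, ← pow_succ']
    refine mul_le_of_le_one_right (by positivity) ?_
    norm_num [Nat.factorial]
  exact le_of_mul_le_mul_left h4 (abs_pos.2 hs)

lemma one_sub_sinc_le {s : ℝ} (h : |s| ≤ 1) : |1 - Real.sinc s| ≤ 2 * s ^ 2 := by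
  have h1 := sinc_taylor h
  have h2 : s ^ 4 ≤ s ^ 2 := by
    have : s ^ 2 ≤ 1 := by rw [← sq_abs]; exact pow_le_one₀ (abs_nonneg _) h
    nlinarith [sq_nonneg s]
  rw [abs_le] at h1 ⊢
  constructor <;> nlinarith [sq_nonneg s]

/-- Conditioning makes the kernel vanish at the origin to second order. The constant is 12 = 8 + 2 +
2, from 2(x-z)², 2x² and 2z² with |x-z| ≤ 2t. -/
lemma abs_sineKer_le {t x z : ℝ} (ht : t ≤ 1 / 2) (hx : |x| ≤ t) (hz : |z| ≤ t) :
    |convKernel sineDensity (x, z)| ≤ 12 * t ^ 2 := by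
  have ht0 : 0 ≤ t := (abs_nonneg x).trans hx
  have hxz : |x - z| ≤ 2 * t := (abs_sub _ _).trans (by linarith)
  have h1 := one_sub_sinc_le (s := x - z) (by linarith)
  have h2 := one_sub_sinc_le (s := x) (by linarith)
  have h3 := one_sub_sinc_le (s := z) (by linarith)
  have q1 : (x - z) ^ 2 ≤ (2 * t) ^ 2 := sq_le_sq' (by linarith [(abs_le.1 hxz).1]) (abs_le.1 hxz).2
  have q2 : x ^ 2 ≤ t ^ 2 := sq_le_sq' (by linarith [(abs_le.1 hx).1]) (abs_le.1 hx).2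
  have q3 : z ^ 2 ≤ t ^ 2 := sq_le_sq' (by linarith [(abs_le.1 hz).1]) (abs_le.1 hz).2
  have e : convKernel sineDensity (x, z) =
      (-(1 - Real.sinc (x - z)) + (1 - Real.sinc x) + Real.sinc x * (1 - Real.sinc z)) / Real.pi := by
    rw [convKernel_apply, sineDensity_zero, sineDensity_apply, sineDensity_apply, sineDensity_apply]
    have := Real.pi_ne_zero
    field_simp
    ring
  have h4 : |Real.sinc x * (1 - Real.sinc z)| ≤ 2 * z ^ 2 := by
    rw [abs_mul]
    exact (mul_le_of_le_one_left (abs_nonneg _) (Real.abs_sinc_le_one x)).trans h3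
  rw [e, abs_div, abs_of_pos Real.pi_pos]
  refine (div_le_self (abs_nonneg _) (by linarith [Real.pi_gt_three])).trans ?_
  refine (abs_add_le _ _).trans ?_
  have h5 := abs_add_le (-(1 - Real.sinc (x - z))) (1 - Real.sinc x)
  rw [abs_neg] at h5
  linarith

lemma norm_condWave_le {t x : ℝ} (ht : t ≤ 1 / 2) (hx : |x| ≤ t) :
    ‖condWave 1 sineDensity x‖ ≤ 2 * t := by
  have ht0 : 0 ≤ t := (abs_nonneg x).trans hx
  rw [← sinePhi_eq, sinePhi, norm_div]
  have h1 : 1 ≤ ‖((√(2 * Real.pi) : ℝ) : ℂ)‖ := by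
    rw [Complex.norm_real, Real.norm_eq_abs, abs_of_nonneg (Real.sqrt_nonneg _), Real.one_le_sqrt]
    linarith [Real.pi_gt_three]
  refine (div_le_self (norm_nonneg _) h1).trans ?_
  have e : Complex.exp (Complex.I * x) - Real.sinc x =
      (Complex.exp (Complex.I * x) - 1) + ((1 - Real.sinc x : ℝ) : ℂ) := by push_cast; ring
  rw [e]
  refine (norm_add_le _ _).trans ?_
  have h2 : ‖Complex.exp (Complex.I * x) - 1‖ ≤ ‖x‖ := Real.norm_exp_I_mul_ofReal_sub_one_le
  have h3 := one_sub_sinc_le (s := x) (by linarith)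
  rw [Complex.norm_real, Real.norm_eq_abs]
  rw [Real.norm_eq_abs] at h2
  have h4 : 2 * x ^ 2 ≤ t := by
    rw [← sq_abs]; nlinarith [abs_nonneg x]
  linarith

/-- The solution of the integral equation on a short interval is small. -/
lemma norm_sine_resolvent_le {t : ℝ} (ht0 : 0 < t) (ht : t ≤ 1 / 4) {x : ℝ}
    (hx : x ∈ Icc (-t) t) :
    ‖resolvent (ker (convKernel sineDensity)) (sym t) (condWave 1 sineDensity) x -
      condWave 1 sineDensity x‖ ≤ 96 * t ^ 4 := by
  set Q := resolvent (ker (convKernel sineDensity)) (sym t) (condWave 1 sineDensity) with hQ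
  have hc := contractive_sine (sym_le ht0.le)
  have hcont : Continuous Q := continuous_resolvent (sym_le ht0.le) hc _
  obtain ⟨y, hy, hmax⟩ := isCompact_Icc.exists_isMaxOn (nonempty_Icc.2 (by linarith : -t ≤ t))
    hcont.norm.continuousOn
  -- Kernel bound 12t² times length 2t. At the maximum point y, 24t³ ≤ 1/2 lets ‖Q y‖ be absorbed,
  -- so ‖Q y‖ ≤ 4t and the difference is at most 96t⁴.
  have hdiff : ∀ x ∈ Icc (-t) t, ‖Q x - condWave 1 sineDensity x‖ ≤ 24 * t ^ 3 * ‖Q y‖ := by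
    intro x hx
    have h := resolvent_sub (sym_le ht0.le) hc (condWave 1 sineDensity) x
    rw [← hQ, sym_zero, sym_one] at h
    rw [← h, sub_sub_cancel]
    have hb : ∀ z ∈ uIoc (-t) t, ‖convKernel sineDensity (x, z) • Q z‖ ≤ 12 * t ^ 2 * ‖Q y‖ := by
      intro z hz
      rw [uIoc_of_le (by linarith)] at hz
      rw [norm_smul, Real.norm_eq_abs]
      exact mul_le_mul (abs_sineKer_le (by linarith) (abs_le.2 hx) (abs_le.2 ⟨hz.1.le, hz.2⟩))
        (hmax ⟨hz.1.le, hz.2⟩) (norm_nonneg _) (by positivity)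
    refine (intervalIntegral.norm_integral_le_of_norm_le_const hb).trans ?_
    rw [sub_neg_eq_add, abs_of_pos (by linarith)]
    exact le_of_eq (by ring)
  have hM : ‖Q y‖ ≤ 4 * t := by
    have h1 := hdiff y hy
    have h2 := norm_condWave_le (t := t) (by linarith) (abs_le.2 hy)
    have h3 : ‖Q y‖ ≤ ‖Q y - condWave 1 sineDensity y‖ + ‖condWave 1 sineDensity y‖ := by
      simpa using norm_add_le (Q y - condWave 1 sineDensity y) (condWave 1 sineDensity y)
    have h4 : 24 * t ^ 3 ≤ 1 / 2 := by
      have : t ^ 3 ≤ (1 / 4) ^ 3 := by gcongr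
      linarith
    nlinarith [norm_nonneg (Q y)]
  refine (hdiff x hx).trans ?_
  calc 24 * t ^ 3 * ‖Q y‖ ≤ 24 * t ^ 3 * (4 * t) := by gcongr
    _ = 96 * t ^ 4 := by ring

lemma condWave_taylor {t : ℝ} (ht : |t| ≤ 1) :
    ‖condWave 1 sineDensity t - (Complex.I * t / √(2 * Real.pi)
      - (t : ℂ) ^ 2 / (3 * √(2 * Real.pi))
      - Complex.I * (t : ℂ) ^ 3 / (6 * √(2 * Real.pi)))‖ ≤ 2 * t ^ 4 := by
  have hs := Profile.sqrt_ne
  have h1 : 1 ≤ ‖((√(2 * Real.pi) : ℝ) : ℂ)‖ := by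
    rw [Complex.norm_real, Real.norm_eq_abs, abs_of_nonneg (Real.sqrt_nonneg _), Real.one_le_sqrt]
    linarith [Real.pi_gt_three]
  have e : condWave 1 sineDensity t - (Complex.I * t / √(2 * Real.pi)
      - (t : ℂ) ^ 2 / (3 * √(2 * Real.pi)) - Complex.I * (t : ℂ) ^ 3 / (6 * √(2 * Real.pi))) =
      ((Complex.exp (t * Complex.I) - (1 + Complex.I * t - t ^ 2 / 2 - Complex.I * t ^ 3 / 6))
        - ((Real.sinc t - (1 - t ^ 2 / 6) : ℝ) : ℂ)) / √(2 * Real.pi) := by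
    rw [← sinePhi_eq, sinePhi, mul_comm (t : ℂ) Complex.I]
    push_cast
    field_simp
    ring
  rw [e, norm_div]
  refine (div_le_self (norm_nonneg _) h1).trans ((norm_sub_le _ _).trans ?_)
  have h2 := sinc_taylor ht
  have h3 := Complex.exp_bound (x := t * Complex.I) (by simpa using ht) (n := 4) (by norm_num)
  have e1 : ∑ m ∈ Finset.range 4, (t * Complex.I) ^ m / (m.factorial : ℂ) =
      1 + Complex.I * t - t ^ 2 / 2 - Complex.I * t ^ 3 / 6 := by
    simp only [Finset.sum_range_succ, Finset.sum_range_zero, Nat.factorial]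
    push_cast
    linear_combination (t ^ 2 / 2 + t ^ 3 * Complex.I / 6) * Complex.I_sq
  rw [e1] at h3
  have h4 : ‖(t : ℂ) * Complex.I‖ = |t| := by simp
  have h5 : |t| ^ 4 = t ^ 4 := by rw [← abs_pow, abs_of_nonneg (by positivity)]
  rw [h4, h5] at h3
  have h6 : t ^ 4 * ((Nat.succ 4 : ℝ) * ((Nat.factorial 4 : ℝ) * 4)⁻¹) ≤ t ^ 4 :=
    mul_le_of_le_one_right (by positivity) (by norm_num [Nat.factorial])
  rw [Complex.norm_real, Real.norm_eq_abs]
  push_cast at h3 h6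
  linarith

theorem sine_q_asymptotics : (fun t : ℝ => sine.q 1 (sym t) -
        (Complex.I * t / Real.sqrt (2 * Real.pi)
          - (t : ℂ) ^ 2 / (3 * Real.sqrt (2 * Real.pi))
          - Complex.I * (t : ℂ) ^ 3 / (6 * Real.sqrt (2 * Real.pi))))
      =O[𝓝[>] 0] (fun t : ℝ => t ^ 4) := by
  -- 98 = 96 + 2: the error of replacing q by φ, plus the Taylor remainder of φ.
  refine Asymptotics.IsBigO.of_bound 98 ?_
  filter_upwards [Ioc_mem_nhdsGT (show (0 : ℝ) < 1 / 4 by norm_num)] with t ht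
  have h1 := norm_sine_resolvent_le ht.1 ht.2 (x := t) ⟨by linarith [ht.1], le_rfl⟩
  have h2 := condWave_taylor (t := t) (by rw [abs_of_pos ht.1]; linarith [ht.2])
  have hq : sine.q 1 (sym t) =
      resolvent (ker (convKernel sineDensity)) (sym t) (condWave 1 sineDensity) t := by
    rw [sine_eq]; rfl
  rw [hq, Real.norm_eq_abs, abs_of_nonneg (by positivity)]
  refine (norm_sub_le_norm_sub_add_norm_sub _ (condWave 1 sineDensity t) _).trans ?_
  linarith

end CUEJanossy
end

/-! ### Assembly of the theorem -/

theorem mainTheorem5 :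
    -- for every `N` the CUE quantities are well defined and solve the CUE systems
    (∀ N : ℕ, 1 ≤ N →
      (∀ a ∈ domain, a 1 - a 0 < 2 * Real.pi →
        WellDefined (conditioned (cueKernel N)) a ∧ CUESystem N (cue N) a) ∧
      ∀ t ∈ Ioo 0 Real.pi, CUESymSystem N (cue N) t) ∧
    -- large-`N` limit of the unfolded kernel and functions; the latter become conjugate
    TendstoLocallyUniformly
      (fun (N : ℕ) (z : ℝ × ℝ) =>
        2 / N * conditioned (cueKernel N) (2 / N * z.1) (2 / N * z.2))
      (fun z => conditioned sineKernel z.1 z.2) atTop ∧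
    TendstoLocallyUniformly (fun (N : ℕ) (x : ℝ) => cuePhi N (2 / N * x)) sinePhi atTop ∧
    TendstoLocallyUniformly (fun (N : ℕ) (x : ℝ) => cuePsi N (2 / N * x)) sinePsi atTop ∧
    (∀ x : ℝ, sinePsi x = conj (sinePhi x)) ∧
    -- large-`N` limit of the unfolded CUE quantities
    (∀ a ∈ domain, WellDefined (conditioned sineKernel) a) ∧
    QuantitiesTendsto unfoldedCue sine ∧
    -- the limits solve the sine-kernel system
    (∀ a ∈ domain, SineSystem sine a) ∧
    -- symmetric intervals
    (∀ t : ℝ, 0 < t → FOSystem sine t) ∧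
    (fun t : ℝ => sine.q 1 (sym t) -
        (Complex.I * t / Real.sqrt (2 * Real.pi)
          - (t : ℂ) ^ 2 / (3 * Real.sqrt (2 * Real.pi))
          - Complex.I * (t : ℂ) ^ 3 / (6 * Real.sqrt (2 * Real.pi))))
      =O[𝓝[>] 0] (fun t : ℝ => t ^ 4) := by
  refine ⟨fun N hN => ⟨fun a ha h => ?_, fun t ht => cue_symSystem hN ht⟩, tendsto_unfolded_kernel,
    tendsto_unfolded_phi, tendsto_unfolded_psi, sinePsi_eq_conj, fun a ha => sine_wellDefined ha,
    unfolded_tendsto, fun a ha => sine_system ha, fun t ht => sine_foSystem ht, sine_q_asymptotics⟩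
  have ha' : a ∈ shortDomain 1 := ⟨ha, by rwa [div_one]⟩
  exact ⟨cue_wellDefined hN ha', cue_system hN ha'⟩
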